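/- Let $m\ge 4$ be even. Let $M$ be a closed $m$-dimensional Riemannian manifold on which a torus $\mathbb T^n=(\mathbb R/\mathbb Z)^n$ acts smoothly by isometries, let $\nabla$ be its Levi-Civita connection, $g^{-1}$ the metric on the cotangent bundle and $\mathcal S_\Delta$ the scalar curvature. Let $\theta$ be a real skew-symmetric $n\times n$ matrix. Functions and tensor fields on $M$ are multiplied by the deformed product $F\times_\theta G=\sum_{r,l\in\mathbb Z^n}e^{i\pi\langle\theta r,l\rangle}F_rG_l$, where $F_r=\int_{\mathbb T^n}U_t(F)\,e^{-2\pi i r\cdot t}\,dt$ and $U_t$ is the pull-back along $t^{-1}$; this is the tensor calculus of the Connes-Landi deformation $C^\infty(M_\theta)$, and the deformed products are not written below. Let $h=h^*\in C^\infty(M_\theta)$ (i.e. $h$ is a smooth real-valued function), $k=e^h=\sum_j h^j/j!$ and $k^p=e^{ph}$. Let $\not\bigtriangledown(\psi)=2(\psi h-h\psi)=-2\,\mathrm{ad}_h(\psi)$ be the modular derivation and $\mathbf\Delta(\psi)=e^{-2h}\psi e^{2h}$ the modular operator, so $\mathbf\Delta=\exp(\not\bigtriangledown)$. A subscript $(j)$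 means that the operator acts on the $j$-th factor of a product, and an entire function of $\not\bigtriangledown$ (or of $\not\bigtriangledown_{(1)},\not\bigtriangledown_{(2)}$) is given by its Taylor series at $0$, a function $K(\mathbf\Delta)$ being $s\mapsto K(e^s)$ applied to $\not\bigtriangledown$. For $s,t>0$ put $$K(s)=K^{(m)}_{\Delta_k}(s)=\frac{d^{\,m/2-2}}{du^{\,m/2-2}}\Big|_{u=0}F(u,s,m),\qquad H(s,t)=H^{(m)}_{\Delta_k}(s,t)=\frac{d^{\,m/2-2}}{du^{\,m/2-2}}\Big|_{u=0}G(u,s,t,m),$$ where $$F(u,s,m)=\frac{m(\sqrt s+1)(u-1)+2(2\sqrt s+u+1)}{m(u-1)^3(u-s)},\qquad G(u,s,t,m)=\frac{N(u,s,t,m)}{m(u-1)^3(u-s)^2(u-st)},$$ $$\begin{aligned}N={}&s^{3/2}\big(m((2\sqrt s+1)\sqrt t+2)-4((2\sqrt s+1)\sqrt t+1)\big)\\&+u^2\big(2(s+2\sqrt s+3)(\sqrt s\sqrt t+1)-m(s^{3/2}\sqrt t-2s(\sqrt t-1)-2\sqrt s+2)\big)\\&-u\sqrt s\big[s(6\sqrt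 t+4)+\sqrt s(10-4\sqrt t)-2(\sqrt t+1)+m(2s^{3/2}\sqrt t+2\sqrt s(\sqrt t-1)+2s+\sqrt t+2)\big]\\&+u^3\big(m\sqrt s\sqrt t+2m+2\sqrt s+2\big).\end{aligned}$$ The $k$-form of the curvature density of the perturbed Laplacian $\Delta_k$ is $$R_{\Delta_k}=k^{-m+1}K(\mathbf\Delta)(\nabla^2k)\cdot g^{-1}+k^{-m}H(\mathbf\Delta_{(1)},\mathbf\Delta_{(2)})(\nabla k\,\nabla k)\cdot g^{-1}+c_\Delta k^{-m+2}\mathcal S_\Delta,\qquad c_\Delta=-\tfrac1{12}\Gamma(m/2).$$ **Proposition.** Let $f_1(s)=\frac{e^s-1}{s}$ and $g_2(s,t)=\frac{f_1(s+t)-f_1(s)}{t}$, both extended by continuity. There are functions $\mathcal K$ on $\mathbb R$ and $\mathcal H$ on $\mathbb R^2$, depending only on $m$ and given for all $s,t\in\mathbb R$ by $$\mathcal K(s)=K(e^s)f_1(s/2),\qquad \mathcal H(s,t)=e^{s/2}H(e^s,e^t)f_1(s/2)f_1(t/2)+2K(e^{s+t})g_2(s/2,t/2),$$ with the following property: for all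 $M$, $\theta$ and $h$ as above, the $k$-form of $R_{\Delta_k}$ equals its $h$-form $$R_{\Delta_k}=k^{-m+2}\Big(\mathcal K(\not\bigtriangledown)(\nabla^2h)+\mathcal H(\not\bigtriangledown_{(1)},\not\bigtriangledown_{(2)})(\nabla h\,\nabla h)\Big)\cdot g^{-1}+c_\Delta k^{-m+2}\mathcal S_\Delta$$ at every point of $M$, and the series that define $K(\mathbf\Delta)(\nabla^2k)$, $H(\mathbf\Delta_{(1)},\mathbf\Delta_{(2)})(\nabla k\,\nabla k)$, $\mathcal K(\not\bigtriangledown)(\nabla^2h)$ and $\mathcal H(\not\bigtriangledown_{(1)},\not\bigtriangledown_{(2)})(\nabla h\,\nabla h)$ converge absolutely at every point. -/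

import Mathlib

open scoped Manifold ContDiff Bundle Matrix Nat
open Bundle

noncomputable section

namespace ConnesLandi

/-! ## The deformed product

Throughout, `X` is a set on which the torus `𝕋ⁿ = (ℝ/ℤ)ⁿ` acts; the action is given by the map
`a : 𝕋ⁿ → X → X`.  It is used for `X = M` (complex functions on `M`) and for `X = TM ⊕ TM`
(complex covariant tensor fields of rank at most two on `M`, see below). -/

section DeformedProduct

variable {n : ℕ} {X : Type*}

/-- The isotypic component `F_r = ∫_{𝕋ⁿ} U_t(F) e^{-2πi r·t} dt`, where `U_t(F)(x) = F(t⁻¹·x)`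
and `dt` is the normalized Haar measure. -/
def component (a : UnitAddTorus (Fin n) → X → X) (F : X → ℂ) (r : Fin n → ℤ) (x : X) : ℂ :=
  UnitAddTorus.mFourierCoeff (fun t => F (a (-t) x)) r

/-- The bicharacter `χ_θ(r, l) = exp(i π ⟨θ r, l⟩)` on `ℤⁿ`. -/
def bichar (θ : Matrix (Fin n) (Fin n) ℝ) (r l : Fin n → ℤ) : ℂ :=
  Complex.exp (Complex.I * Real.pi * (((θ *ᵥ fun i => (r i : ℝ)) ⬝ᵥ fun i => (l i : ℝ) : ℝ) : ℂ))

/-- The deformed product `F ×_θ G = ∑_{r, l} χ_θ(r, l) F_r G_l`. -/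
def star (θ : Matrix (Fin n) (Fin n) ℝ) (a : UnitAddTorus (Fin n) → X → X) (F G : X → ℂ) :
    X → ℂ :=
  fun x => ∑' p : (Fin n → ℤ) × (Fin n → ℤ),
    bichar θ p.1 p.2 * component a F p.1 x * component a G p.2 x

/-- Powers with respect to the deformed product. -/
def starPow (θ : Matrix (Fin n) (Fin n) ℝ) (a : UnitAddTorus (Fin n) → X → X) (F : X → ℂ) :
    ℕ → X → ℂ
  | 0 => fun _ => 1
  | j + 1 => star θ a F (starPow θ a F j)

/-- The exponential `∑_j F^j / j!` with respect to the deformed product. -/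
def starExp (θ : Matrix (Fin n) (Fin n) ℝ) (a : UnitAddTorus (Fin n) → X → X) (F : X → ℂ) :
    X → ℂ :=
  fun x => ∑' j : ℕ, starPow θ a F j x / (j ! : ℂ)

/-- The power `k^p = e^{p h}` of the Weyl factor `k = e^h`, for real `p`. -/
def kPow (θ : Matrix (Fin n) (Fin n) ℝ) (a : UnitAddTorus (Fin n) → X → X) (h : X → ℂ) (p : ℝ) :
    X → ℂ :=
  starExp θ a (fun x => (p : ℂ) * h x)

/-! ## The modular derivation and its functional calculus -/

/-- The modular derivation `∇̸(ψ) = -2 ad_h(ψ) = 2 (ψ h - h ψ)`, products being deformed.  It is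
the logarithm of the modular operator `𝚫(ψ) = e^{-2h} ψ e^{2h}`. -/
def modDer (θ : Matrix (Fin n) (Fin n) ℝ) (a : UnitAddTorus (Fin n) → X → X) (h ψ : X → ℂ) :
    X → ℂ :=
  fun x => 2 * (star θ a ψ h x - star θ a h ψ x)

/-- Taylor coefficients at `0` of a function of one real variable. -/
def taylor₁ (f : ℝ → ℝ) (p : ℕ) : ℝ := iteratedDeriv p f 0 / p !

/-- Taylor coefficients `∂_s^p ∂_t^q f(0,0) / (p! q!)` of a function of two real variables. -/
def taylor₂ (f : ℝ → ℝ → ℝ) (p q : ℕ) : ℝ :=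
  iteratedDeriv p (fun s => iteratedDeriv q (fun t => f s t) 0) 0 / (p ! * q !)

/-- The terms of the series `f(∇̸)(ρ) = ∑_p c_p ∇̸^p(ρ)`, where `f(s) = ∑_p c_p s^p` is entire. -/
def calcTerm₁ (θ : Matrix (Fin n) (Fin n) ℝ) (a : UnitAddTorus (Fin n) → X → X) (h : X → ℂ)
    (f : ℝ → ℝ) (ρ : X → ℂ) (x : X) (p : ℕ) : ℂ :=
  (taylor₁ f p : ℂ) * ((modDer θ a h)^[p] ρ) x

/-- `f(∇̸)(ρ)`, for an entire function `f` of one variable. -/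
def calc₁ (θ : Matrix (Fin n) (Fin n) ℝ) (a : UnitAddTorus (Fin n) → X → X) (h : X → ℂ)
    (f : ℝ → ℝ) (ρ : X → ℂ) : X → ℂ :=
  fun x => ∑' p : ℕ, calcTerm₁ θ a h f ρ x p

/-- The terms of `f(∇̸₍₁₎, ∇̸₍₂₎)(ρ₁ ρ₂) = ∑_{p,q} c_{p,q} ∇̸^p(ρ₁) ∇̸^q(ρ₂)`, where
`f(s,t) = ∑_{p,q} c_{p,q} s^p t^q` is entire: `∇̸₍ⱼ₎` acts on the `j`-th factor. -/
def calcTerm₂ (θ : Matrix (Fin n) (Fin n) ℝ) (a : UnitAddTorus (Fin n) → X → X) (h : X → ℂ)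
    (f : ℝ → ℝ → ℝ) (ρ₁ ρ₂ : X → ℂ) (x : X) (p : ℕ × ℕ) : ℂ :=
  (taylor₂ f p.1 p.2 : ℂ) *
    star θ a ((modDer θ a h)^[p.1] ρ₁) ((modDer θ a h)^[p.2] ρ₂) x

/-- `f(∇̸₍₁₎, ∇̸₍₂₎)(ρ₁ ρ₂)`, for an entire function `f` of two variables. -/
def calc₂ (θ : Matrix (Fin n) (Fin n) ℝ) (a : UnitAddTorus (Fin n) → X → X) (h : X → ℂ)
    (f : ℝ → ℝ → ℝ) (ρ₁ ρ₂ : X → ℂ) : X → ℂ :=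
  fun x => ∑' p : ℕ × ℕ, calcTerm₂ θ a h f ρ₁ ρ₂ x p

end DeformedProduct

/-! ## Tensor calculus on a closed manifold with a torus action

A complex covariant tensor field of rank at most two on `M` is regarded as a function on
`TM ⊕ TM = {(x, u, v) : u, v ∈ T_x M}`: a function `f` as `f(x)`, a one-form `ω` as `ω_x(u)` if it
is the first factor of a tensor product and as `ω_x(v)` if it is the second one, and a tensor
field `ρ` of rank two as `ρ_x(u, v)`.  The torus acts on `TM ⊕ TM` by the differential of its action
on `M`, so that `U_t` is the pull-back of tensor fields along `t⁻¹`, and the products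
`f ×_θ ω`, `ω ×_θ f`, `ω ⊗_θ η`, `f ×_θ ρ`, `ρ ×_θ f` are all given by `star`. -/

section Geometry

variable {m n : ℕ} {M : Type*} [TopologicalSpace M] [ChartedSpace (EuclideanSpace ℝ (Fin m)) M]

variable (m M) in
/-- The total space of `TM ⊕ TM`. -/
abbrev TwoVec : Type _ := (x : M) × (TangentSpace (𝓡 m) x × TangentSpace (𝓡 m) x)

variable (m M) in
/-- The action of the torus on `TM ⊕ TM` by differentials. -/
def act₂ [AddAction (UnitAddTorus (Fin n)) M] (t : UnitAddTorus (Fin n)) (ξ : TwoVec m M) :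
    TwoVec m M :=
  ⟨t +ᵥ ξ.1, mfderiv (𝓡 m) (𝓡 m) (fun y : M => t +ᵥ y) ξ.1 ξ.2.1,
    mfderiv (𝓡 m) (𝓡 m) (fun y : M => t +ᵥ y) ξ.1 ξ.2.2⟩

variable (m M) in
/-- The action of the torus on `M`. -/
def act₀ [AddAction (UnitAddTorus (Fin n)) M] (t : UnitAddTorus (Fin n)) (x : M) : M := t +ᵥ x

/-- The action of the torus on `M` is smooth; smoothness in `t ∈ 𝕋ⁿ` is tested on `ℝⁿ`. -/
def SmoothAction (m n : ℕ) (M : Type*) [TopologicalSpace M]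
    [ChartedSpace (EuclideanSpace ℝ (Fin m)) M] [AddAction (UnitAddTorus (Fin n)) M] : Prop :=
  ContMDiff (𝓘(ℝ, Fin n → ℝ).prod (𝓡 m)) (𝓡 m) ∞
    (fun p : (Fin n → ℝ) × M => (fun i => (p.1 i : UnitAddCircle) : UnitAddTorus (Fin n)) +ᵥ p.2)

/-- The torus acts by isometries of the Riemannian metric. -/
def IsometricAction (m n : ℕ) (M : Type*) [TopologicalSpace M]
    [ChartedSpace (EuclideanSpace ℝ (Fin m)) M] [AddAction (UnitAddTorus (Fin n)) M]
    [RiemannianBundle (fun x : M => TangentSpace (𝓡 m) x)] : Prop :=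
  ∀ (t : UnitAddTorus (Fin n)) (x : M) (u v : TangentSpace (𝓡 m) x),
    inner ℝ (mfderiv (𝓡 m) (𝓡 m) (fun y : M => t +ᵥ y) x u)
      (mfderiv (𝓡 m) (𝓡 m) (fun y : M => t +ᵥ y) x v) = inner ℝ u v

/-- A function on `M`, as a function on `TM ⊕ TM`. -/
def lift (f : M → ℂ) : TwoVec m M → ℂ := fun ξ => f ξ.1

variable (m) in
/-- The one-form `∇f = df` in the first slot. -/
def grad₁ (f : M → ℂ) : TwoVec m M → ℂ := fun ξ => mvfderiv (𝓡 m) f ξ.1 ξ.2.1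

variable (m) in
/-- The one-form `∇f = df` in the second slot. -/
def grad₂ (f : M → ℂ) : TwoVec m M → ℂ := fun ξ => mvfderiv (𝓡 m) f ξ.1 ξ.2.2

variable [IsManifold (𝓡 m) ∞ M]

/-- The second covariant derivative `(∇²f)_x(u, v) = u(V f) - (∇_u V) f`, where `V` is a vector
field, smooth near `x`, with `V(x) = v`. -/
def hessian
    (cov : CovariantDerivative (𝓡 m) (EuclideanSpace ℝ (Fin m))
      (TangentSpace (𝓡 m) : M → Type _))
    (f : M → ℂ) : TwoVec m M → ℂ :=
  fun ξ =>
    mvfderiv (𝓡 m)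
      (fun y => mvfderiv (𝓡 m) f y
        (FiberBundle.extend (EuclideanSpace ℝ (Fin m)) ξ.2.2 y)) ξ.1 ξ.2.1
    - mvfderiv (𝓡 m) f ξ.1
        (cov (FiberBundle.extend (EuclideanSpace ℝ (Fin m)) ξ.2.2) ξ.1 ξ.2.1)

/-- `R(X, Y) Z = ∇_X ∇_Y Z - ∇_Y ∇_X Z - ∇_{[X, Y]} Z`. -/
def riemannCurvature
    (cov : CovariantDerivative (𝓡 m) (EuclideanSpace ℝ (Fin m))
      (TangentSpace (𝓡 m) : M → Type _))
    (U V Z : ∀ x : M, TangentSpace (𝓡 m) x) (x : M) : TangentSpace (𝓡 m) x :=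
  cov (fun y => cov Z y (V y)) x (U x) - cov (fun y => cov Z y (U y)) x (V x)
    - cov Z x (VectorField.mlieBracket (𝓡 m) U V x)

section Riemannian

variable [RiemannianBundle (fun x : M => TangentSpace (𝓡 m) x)]

instance finiteDimensionalTangent (x : M) : FiniteDimensional ℝ (TangentSpace (𝓡 m) x) :=
  inferInstanceAs (FiniteDimensional ℝ (EuclideanSpace ℝ (Fin m)))

variable (m) in
/-- An orthonormal basis of `T_x M`. -/
def frame (x : M) :
    OrthonormalBasis (Fin (Module.finrank ℝ (TangentSpace (𝓡 m) x))) ℝ (TangentSpace (𝓡 m) x) :=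
  stdOrthonormalBasis ℝ (TangentSpace (𝓡 m) x)

/-- The contraction `ρ · g⁻¹` of a tensor field of rank two with the metric on the cotangent
bundle. -/
def contract (ρ : TwoVec m M → ℂ) (x : M) : ℂ :=
  ∑ i, ρ ⟨x, frame m x i, frame m x i⟩

/-- The scalar curvature `∑_{i,j} ⟨R(e_i, e_j) e_j, e_i⟩` of the metric. -/
def scalarCurvature
    (cov : CovariantDerivative (𝓡 m) (EuclideanSpace ℝ (Fin m))
      (TangentSpace (𝓡 m) : M → Type _)) (x : M) : ℝ :=
  ∑ i, ∑ j,
    inner ℝ (riemannCurvature cov (FiberBundle.extend (EuclideanSpace ℝ (Fin m)) (frame m x i))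
      (FiberBundle.extend (EuclideanSpace ℝ (Fin m)) (frame m x j))
      (FiberBundle.extend (EuclideanSpace ℝ (Fin m)) (frame m x j)) x) (frame m x i)

set_option synthInstance.maxHeartbeats 400000 in
/-- `cov` is the Levi-Civita connection: metric and torsion-free. -/
def IsLeviCivita
    [IsContMDiffRiemannianBundle (𝓡 m) ∞ (EuclideanSpace ℝ (Fin m))
      (fun x : M => TangentSpace (𝓡 m) x)]
    (cov : CovariantDerivative (𝓡 m) (EuclideanSpace ℝ (Fin m))
      (TangentSpace (𝓡 m) : M → Type _)) : Prop :=
  cov.IsMetricCompatible ∧ cov.torsion = 0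

variable [AddAction (UnitAddTorus (Fin n)) M]

/-- The constant `c_Δ = -Γ(m/2)/12`. -/
def curvConst (m : ℕ) : ℝ := -(1 / 12) * Real.Gamma ((m : ℝ) / 2)

/-- The curvature density `R_{Δ_k}` in terms of the Weyl factor `k = e^h`:
`k^{-m+1} K(𝚫)(∇²k)·g⁻¹ + k^{-m} H(𝚫₍₁₎, 𝚫₍₂₎)(∇k ∇k)·g⁻¹ + c_Δ k^{-m+2} S_Δ`,
where `𝚫 = exp(∇̸)`, so that `K(𝚫)` is the function `s ↦ K(e^s)` of `∇̸`, and likewise for `H`. -/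
def curvatureK (θ : Matrix (Fin n) (Fin n) ℝ)
    (cov : CovariantDerivative (𝓡 m) (EuclideanSpace ℝ (Fin m))
      (TangentSpace (𝓡 m) : M → Type _))
    (h : M → ℂ) (K : ℝ → ℝ) (H : ℝ → ℝ → ℝ) (x : M) : ℂ :=
  let k : M → ℂ := starExp θ (act₀ M) h
  contract (star θ (act₂ m M) (lift (kPow θ (act₀ M) h (1 - m)))
      (calc₁ θ (act₂ m M) (lift h) (fun s => K (Real.exp s)) (hessian cov k))) x
  + contract (star θ (act₂ m M) (lift (kPow θ (act₀ M) h (-m)))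
      (calc₂ θ (act₂ m M) (lift h) (fun s t => H (Real.exp s) (Real.exp t))
        (grad₁ m k) (grad₂ m k))) x
  + (curvConst m : ℂ) *
      star θ (act₀ M) (kPow θ (act₀ M) h (2 - m)) (fun y => (scalarCurvature cov y : ℂ)) x

/-- The expression
`k^{-m+2} (𝒦(∇̸)(∇²h) + ℋ(∇̸₍₁₎, ∇̸₍₂₎)(∇h ∇h))·g⁻¹ + c_Δ k^{-m+2} S_Δ` in terms of
`h = log k`. -/
def curvatureLogK (θ : Matrix (Fin n) (Fin n) ℝ)
    (cov : CovariantDerivative (𝓡 m) (EuclideanSpace ℝ (Fin m))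
      (TangentSpace (𝓡 m) : M → Type _))
    (h : M → ℂ) (𝒦 : ℝ → ℝ) (ℋ : ℝ → ℝ → ℝ) (x : M) : ℂ :=
  contract (star θ (act₂ m M) (lift (kPow θ (act₀ M) h (2 - m)))
      (fun ξ => calc₁ θ (act₂ m M) (lift h) 𝒦 (hessian cov h) ξ
        + calc₂ θ (act₂ m M) (lift h) ℋ (grad₁ m h) (grad₂ m h) ξ)) x
  + (curvConst m : ℂ) *
      star θ (act₀ M) (kPow θ (act₀ M) h (2 - m)) (fun y => (scalarCurvature cov y : ℂ)) x

end Riemannian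

end Geometry

/-! ## The local curvature functions -/

/-- The function `F(u, s, m)`. -/
def genF (u s m : ℝ) : ℝ :=
  (m * (√s + 1) * (u - 1) + 2 * (2 * √s + u + 1)) / (m * (u - 1) ^ 3 * (u - s))

/-- The function `G(u, s, t, m)`. -/
def genG (u s t m : ℝ) : ℝ :=
  (√s ^ 3 * (m * ((2 * √s + 1) * √t + 2) - 4 * ((2 * √s + 1) * √t + 1))
    + u ^ 2 * (2 * (s + 2 * √s + 3) * (√s * √t + 1)
      - m * (√s ^ 3 * √t - 2 * s * (√t - 1) - 2 * √s + 2))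
    - u * √s * (s * (6 * √t + 4) + √s * (10 - 4 * √t) - 2 * (√t + 1)
      + m * (2 * √s ^ 3 * √t + 2 * √s * (√t - 1) + 2 * s + √t + 2))
    + u ^ 3 * (m * √s * √t + 2 * m + 2 * √s + 2))
  / (m * (u - 1) ^ 3 * (u - s) ^ 2 * (u - s * t))

/-- The one-variable curvature function `K^{(m)}_{Δ_k}(s) = (d/du)^{(m-4)/2}|_{u=0} F(u, s, m)`,
for `s > 0` and even `m ≥ 4`. -/
def curvK (m : ℕ) (s : ℝ) : ℝ := iteratedDeriv ((m - 4) / 2) (fun u => genF u s m) 0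

/-- The two-variable curvature function
`H^{(m)}_{Δ_k}(s, t) = (d/du)^{(m-4)/2}|_{u=0} G(u, s, t, m)`, for `s, t > 0` and even `m ≥ 4`. -/
def curvH (m : ℕ) (s t : ℝ) : ℝ := iteratedDeriv ((m - 4) / 2) (fun u => genG u s t m) 0

/-- `f₁(s) = (e^s - 1) / s`, extended by continuity to `f₁(0) = 1`. -/
def f₁ (s : ℝ) : ℝ := if s = 0 then 1 else (Real.exp s - 1) / s

/-- `g₂(s, t) = (f₁(s + t) - f₁(s)) / t`, extended by continuity to `t = 0`. -/
def g₂ (s t : ℝ) : ℝ := if t = 0 then deriv f₁ s else (f₁ (s + t) - f₁ s) / t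

end ConnesLandi

end

/-!
The deformed product becomes an honest product after lifting functions to a Banach algebra. Let
`Twisted θ` be the twisted convolution algebra `ℓ¹(ℤⁿ)`, with `δ_r δ_l = χ_θ(r, l) δ_{r + l}`. A tensor
field `F`, regarded as a function on `TM ⊕ TM`, lifts to the map `x ↦ ∑ F_r(x) δ_r` whenever its
isotypic components are absolutely summable (`IsLift`), and the sum of the coefficients takes the
lift back to `F`. Deformed products, exponentials and series in the modular derivation are then
lifted by products, exponentials and series in the Banach algebra (`IsLift.star`, `IsLift.starExp`,
`IsLift.tsum`, `IsLift.calcTerm₁`, `IsLift.calcTerm₂`); in particular all convergence statements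
reduce to norm convergence in this algebra (`IsLift.summable`).

Smooth functions have rapidly decreasing isotypic components, and therefore lift to smooth maps
(`SmoothAction.exists_isLift`). An isometry preserves the Levi-Civita connection, so that the lifts
of `∇f` and `∇²f` are obtained from the lift of `f` by the ordinary chart formulas for
vector-valued functions (`IsLift.grad₁`, `IsLift.hessian`). The lift of `k = e^h` is the exponential of the lift
`a` of `h`, and Duhamel's formula gives its first two derivatives (`fderiv_exp_apply`,
`fderiv_fderiv_exp_apply`): if `d` and `e` are the first and second derivative of `a` in a direction, then
those of `e^a` are `expD₁ a d` and `expD₁ a e + 2 expD₂ a d`, integrals of the modular group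
`x ↦ e^{-2la} x e^{2la}` applied to `d` and `e`.

In logarithmic variables the functions `K` and `H` are finite sums of exponentials
(`curvK_mem_expPoly`, `curvH_mem_expPoly`), while `f₁` and `g₂` are integrals of exponentials
(`f₁_eq_integral`, `g₂_eq_integral`). Hence every functional calculus in the theorem is a
superposition of modular groups (`hasSum_taylor₁_smul`, `hasSum_taylor₂_smul`), and the equality of
the two forms becomes the algebraic identity `exp_mul_sum_add_exp_mul_sum`: the factor `f₁(s/2)` comes
from the first derivative of the exponential, `e^{s/2}` from moving one factor `e^a` past the other
derivative, and `2 g₂(s/2, t/2)` from the second derivative.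
-/

noncomputable section

namespace ConnesLandi

/-! ### The twisted convolution algebra -/

/-- The Banach space `ℓ¹(ℤⁿ)`. -/
abbrev Seq (n : ℕ) : Type := lp (fun _ : Fin n → ℤ => ℂ) 1

section Twisted

variable {n : ℕ}

lemma Seq.summable_norm (a : Seq n) : Summable fun r => ‖a r‖ := by
  have := (lp.memℓp a).summable (by simp)
  simpa using this

lemma Seq.norm_eq (a : Seq n) : ‖a‖ = ∑' r, ‖a r‖ := by
  have := lp.norm_eq_tsum_rpow (p := 1) (by simp) a
  simpa using this

/-- The basis vector `δ_r` of `ℓ¹(ℤⁿ)`. -/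
def delta (r : Fin n → ℤ) : Seq n := lp.single 1 r (1 : ℂ)

lemma norm_delta (r : Fin n → ℤ) : ‖delta r‖ = 1 := by
  simp [delta, lp.norm_single]

lemma delta_apply (r l : Fin n → ℤ) : delta r l = if l = r then 1 else 0 := by
  simp [delta, lp.single_apply, Pi.single_apply]

lemma Seq.hasSum_delta (a : Seq n) : HasSum (fun r => a r • delta r) a := by
  have := lp.hasSum_single (p := 1) (by simp) a
  refine this.congr_fun fun r => ?_
  rw [delta, ← lp.single_smul]
  simp

section SumSMul

variable {E : Type*} [NormedAddCommGroup E] [NormedSpace ℂ E]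

lemma Seq.summable_norm_smul {v : (Fin n → ℤ) → E} (hv : ∀ r, ‖v r‖ ≤ 1) (a : Seq n) :
    Summable fun r => ‖a r • v r‖ :=
  a.summable_norm.of_nonneg_of_le (fun _ => norm_nonneg _) fun r => by
    rw [norm_smul]
    exact mul_le_of_le_one_right (norm_nonneg _) (hv r)

lemma Seq.norm_tsum_smul_le {v : (Fin n → ℤ) → E} (hv : ∀ r, ‖v r‖ ≤ 1) (a : Seq n) :
    ‖∑' r, a r • v r‖ ≤ 1 * ‖a‖ := by
  rw [one_mul, Seq.norm_eq]
  refine (norm_tsum_le_tsum_norm (a.summable_norm_smul hv)).trans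
    ((a.summable_norm_smul hv).tsum_le_tsum (fun r => ?_) a.summable_norm)
  rw [norm_smul]
  exact mul_le_of_le_one_right (norm_nonneg _) (hv r)

variable [CompleteSpace E]

/-- The bounded operator on `ℓ¹(ℤⁿ)` that sends `δ_r` to `v r`, for a family `v` in the unit ball
of a Banach space. -/
def sumSMul (v : (Fin n → ℤ) → E) (hv : ∀ r, ‖v r‖ ≤ 1) : Seq n →L[ℂ] E :=
  LinearMap.mkContinuous
    { toFun := fun a => ∑' r, a r • v r
      map_add' := fun a b => by
        rw [← (a.summable_norm_smul hv).of_norm.tsum_add (b.summable_norm_smul hv).of_norm]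
        simp [add_smul]
      map_smul' := fun c a => by
        rw [RingHom.id_apply, ← (a.summable_norm_smul hv).of_norm.tsum_const_smul]
        simp [mul_smul] } 1 (Seq.norm_tsum_smul_le hv)

lemma norm_sumSMul_le (v : (Fin n → ℤ) → E) (hv : ∀ r, ‖v r‖ ≤ 1) : ‖sumSMul v hv‖ ≤ 1 :=
  LinearMap.mkContinuous_norm_le _ zero_le_one _

lemma sumSMul_delta (v : (Fin n → ℤ) → E) (hv : ∀ r, ‖v r‖ ≤ 1) (r : Fin n → ℤ) :
    sumSMul v hv (delta r) = v r := by
  change ∑' l, delta r l • v l = v r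
  rw [tsum_eq_single r]
  · simp [delta_apply]
  · intro l hl
    simp [delta_apply, hl]

end SumSMul

lemma Seq.clm_ext {E : Type*} [NormedAddCommGroup E] [NormedSpace ℂ E]
    {S T : Seq n →L[ℂ] E} (h : ∀ r, S (delta r) = T (delta r)) : S = T := by
  ext a
  have h1 := a.hasSum_delta.mapL S
  have h2 := a.hasSum_delta.mapL T
  simp only [map_smul, h] at h1 h2
  exact h1.unique h2

variable (θ : Matrix (Fin n) (Fin n) ℝ)

lemma norm_bichar (r l : Fin n → ℤ) : ‖bichar θ r l‖ = 1 := by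
  rw [bichar, mul_assoc, mul_comm, ← Complex.ofReal_mul]
  exact Complex.norm_exp_ofReal_mul_I _

lemma bichar_add_left (r r' l : Fin n → ℤ) :
    bichar θ (r + r') l = bichar θ r l * bichar θ r' l := by
  have : (fun i => (((r + r') i : ℤ) : ℝ)) = (fun i => (r i : ℝ)) + fun i => (r' i : ℝ) := by
    ext i
    simp
  rw [bichar, bichar, bichar, ← Complex.exp_add, this, Matrix.mulVec_add, add_dotProduct]
  push_cast
  ring_nf

lemma bichar_add_right (r l l' : Fin n → ℤ) :
    bichar θ r (l + l') = bichar θ r l * bichar θ r l' := by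
  have : (fun i => (((l + l') i : ℤ) : ℝ)) = (fun i => (l i : ℝ)) + fun i => (l' i : ℝ) := by
    ext i
    simp
  rw [bichar, bichar, bichar, ← Complex.exp_add, this, dotProduct_add]
  push_cast
  ring_nf

lemma bichar_zero_right (r : Fin n → ℤ) : bichar θ r 0 = 1 := by
  have : (fun i : Fin n => (((0 : Fin n → ℤ) i : ℤ) : ℝ)) = 0 := by
    ext i
    simp
  rw [bichar, this]
  simp

lemma bichar_zero_left (l : Fin n → ℤ) : bichar θ 0 l = 1 := by
  have : (fun i : Fin n => (((0 : Fin n → ℤ) i : ℤ) : ℝ)) = 0 := by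
    ext i
    simp
  rw [bichar, this]
  simp

lemma norm_bichar_smul_delta (r l s : Fin n → ℤ) : ‖bichar θ r l • delta s‖ ≤ 1 := by
  rw [norm_smul, norm_bichar, norm_delta, mul_one]

/-- Right twisted translation by `l`: `δ_r ↦ χ_θ(r, l) δ_{r + l}`. -/
def rightShift (l : Fin n → ℤ) : Seq n →L[ℂ] Seq n :=
  sumSMul (fun r => bichar θ r l • delta (r + l)) fun _ => norm_bichar_smul_delta θ _ _ _

/-- Left twisted translation by `r`: `δ_l ↦ χ_θ(r, l) δ_{r + l}`. -/
def leftShift (r : Fin n → ℤ) : Seq n →L[ℂ] Seq n :=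
  sumSMul (fun l => bichar θ r l • delta (r + l)) fun _ => norm_bichar_smul_delta θ _ _ _

lemma rightShift_delta (l r : Fin n → ℤ) :
    rightShift θ l (delta r) = bichar θ r l • delta (r + l) := sumSMul_delta _ _ _

lemma leftShift_delta (l r : Fin n → ℤ) :
    leftShift θ r (delta l) = bichar θ r l • delta (r + l) := sumSMul_delta _ _ _

lemma leftShift_mul_rightShift (r l : Fin n → ℤ) :
    leftShift θ r * rightShift θ l = rightShift θ l * leftShift θ r := by
  refine Seq.clm_ext fun s => ?_
  simp only [mul_apply_eq_comp, leftShift_delta, rightShift_delta, map_smul, smul_smul,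
    bichar_add_left, bichar_add_right, add_assoc]
  congr 1
  ring

/-- The twisted convolution algebra of `ℤⁿ`: the bounded operators on `ℓ¹(ℤⁿ)` that commute with
all right twisted translations.  Such an operator is left twisted convolution with the image of
`δ_0`, so that the algebra is `ℓ¹(ℤⁿ)` with the product `δ_r δ_l = χ_θ(r, l) δ_{r + l}`; as a
closed algebra of operators it is a Banach algebra. -/
abbrev Twisted : Type := Subalgebra.centralizer ℂ (Set.range (rightShift θ))

instance : CompleteSpace (Twisted θ) := by
  have : IsClosed (Subalgebra.centralizer ℂ (Set.range (rightShift θ)) : Set (Seq n →L[ℂ] Seq n)) := by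
    rw [Subalgebra.coe_centralizer]
    exact Set.isClosed_centralizer _
  exact this.completeSpace_coe

variable {θ}

namespace Twisted

/-- The sequence of coefficients of an element of the twisted convolution algebra. -/
def toSeq : Twisted θ →L[ℂ] Seq n :=
  (ContinuousLinearMap.apply ℂ (Seq n) (delta 0)).comp
    (Subalgebra.toSubmodule (Subalgebra.centralizer ℂ (Set.range (rightShift θ)))).subtypeL

lemma toSeq_apply (x : Twisted θ) : toSeq x = x.1 (delta 0) := rfl

/-- The coefficient of `δ_r`. -/
def coeff (r : Fin n → ℤ) : Twisted θ →L[ℂ] ℂ :=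
  (lp.evalCLM ℂ (fun _ : Fin n → ℤ => ℂ) 1 r).comp toSeq

lemma coeff_apply (x : Twisted θ) (r : Fin n → ℤ) : coeff r x = toSeq x r := rfl

/-- The sum of the coefficients. -/
def total : Twisted θ →L[ℂ] ℂ := (lp.tsumCLM ℂ (Fin n → ℤ) ℂ).comp toSeq

lemma total_apply (x : Twisted θ) : total x = ∑' r, coeff r x := rfl

lemma summable_norm_coeff (x : Twisted θ) : Summable fun r => ‖coeff r x‖ :=
  (toSeq x).summable_norm

/-- An element of the algebra is determined by its value on `δ_0`: it commutes with right translations,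
which carry `δ_0` to `δ_l`. -/
lemma apply_delta (x : Twisted θ) (l : Fin n → ℤ) :
    x.1 (delta l) = rightShift θ l (toSeq x) := by
  have h := (Subalgebra.mem_centralizer_iff ℂ).1 x.2 (rightShift θ l) ⟨l, rfl⟩
  have := congr($h (delta 0))
  rw [mul_apply_eq_comp, mul_apply_eq_comp, rightShift_delta,
    bichar_zero_left, one_smul, zero_add] at this
  exact this.symm

lemma rightShift_apply (l : Fin n → ℤ) (a : Seq n) (r : Fin n → ℤ) :
    rightShift θ l a r = bichar θ (r - l) l * a (r - l) := by
  have h := (a.hasSum_delta.mapL (rightShift θ l)).mapL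
    (lp.evalCLM ℂ (fun _ : Fin n → ℤ => ℂ) 1 r)
  have hf (s : Fin n → ℤ) : lp.evalCLM ℂ (fun _ : Fin n → ℤ => ℂ) 1 r
      (rightShift θ l (a s • delta s)) = a s * (bichar θ s l * if r = s + l then 1 else 0) := by
    rw [map_smul, map_smul, rightShift_delta, map_smul, ← delta_apply]
    rfl
  simp only [hf] at h
  refine h.unique ?_
  have := hasSum_single (f := fun s => a s * (bichar θ s l * if r = s + l then 1 else 0)) (r - l)
    fun s hs => by
      have : r ≠ s + l := fun h' => hs (by rw [h']; abel)
      simp [this]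
  simpa [mul_comm] using this

lemma toSeq_mul (x y : Twisted θ) :
    HasSum (fun l => coeff l y • rightShift θ l (toSeq x)) (toSeq (x * y)) := by
  have h := (toSeq y).hasSum_delta.mapL x.1
  simp only [map_smul, apply_delta] at h
  exact h

lemma coeff_mul (x y : Twisted θ) (r : Fin n → ℤ) :
    HasSum (fun l => bichar θ (r - l) l * coeff (r - l) x * coeff l y) (coeff r (x * y)) := by
  have h := (toSeq_mul x y).mapL (lp.evalCLM ℂ (fun _ : Fin n → ℤ => ℂ) 1 r)
  refine h.congr_fun fun l => ?_
  change _ = coeff l y * rightShift θ l (toSeq x) r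
  rw [rightShift_apply, ← coeff_apply]
  ring

lemma tsum_rightShift (l : Fin n → ℤ) (a : Seq n) :
    lp.tsumCLM ℂ (Fin n → ℤ) ℂ (rightShift θ l a) = ∑' r, bichar θ r l * a r := by
  have h := (a.hasSum_delta.mapL (rightShift θ l)).mapL (lp.tsumCLM ℂ (Fin n → ℤ) ℂ)
  rw [← h.tsum_eq]
  refine tsum_congr fun r => ?_
  have : lp.tsumCLM ℂ (Fin n → ℤ) ℂ (delta (r + l)) = 1 := by
    change ∑' s, delta (r + l) s = 1
    simp [delta_apply]
  rw [map_smul, map_smul, rightShift_delta, map_smul, this]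
  simp [mul_comm]

/-- The sum of the coefficients turns the product of the algebra into the deformed product. -/
lemma total_mul (x y : Twisted θ) :
    total (x * y) = ∑' p : (Fin n → ℤ) × (Fin n → ℤ),
      bichar θ p.1 p.2 * coeff p.1 x * coeff p.2 y := by
  have hs : Summable fun p : (Fin n → ℤ) × (Fin n → ℤ) =>
      bichar θ p.2 p.1 * coeff p.2 x * coeff p.1 y := by
    refine .of_norm ?_
    have := (summable_norm_coeff y).mul_of_nonneg (summable_norm_coeff x)
      (fun _ => norm_nonneg _) (fun _ => norm_nonneg _)
    refine this.congr fun p => ?_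
    rw [norm_mul, norm_mul, norm_bichar, one_mul, mul_comm]
  have h := (toSeq_mul x y).mapL (lp.tsumCLM ℂ (Fin n → ℤ) ℂ)
  rw [← (Equiv.prodComm _ _).tsum_eq]
  simp only [Equiv.prodComm_apply, Prod.fst_swap, Prod.snd_swap]
  rw [hs.tsum_prod, total, ContinuousLinearMap.comp_apply, ← h.tsum_eq]
  refine tsum_congr fun l => ?_
  rw [map_smul, tsum_rightShift, smul_eq_mul, ← tsum_mul_left]
  refine tsum_congr fun r => ?_
  rw [coeff_apply x]
  ring

lemma coeff_one (r : Fin n → ℤ) : coeff r (1 : Twisted θ) = if r = 0 then 1 else 0 :=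
  delta_apply _ _

lemma total_one : total (1 : Twisted θ) = 1 := by
  simp [total_apply, coeff_one]

/-- The generator `δ_r` of the twisted convolution algebra. -/
def gen (r : Fin n → ℤ) : Twisted θ :=
  ⟨leftShift θ r, by
    rw [Subalgebra.mem_centralizer_iff]
    rintro _ ⟨l, rfl⟩
    exact (leftShift_mul_rightShift θ r l).symm⟩

lemma coeff_gen (r l : Fin n → ℤ) : coeff l (gen r : Twisted θ) = if l = r then 1 else 0 := by
  rw [coeff_apply, toSeq_apply]
  change leftShift θ r (delta 0) l = _
  rw [leftShift_delta, bichar_zero_right, one_smul, add_zero, delta_apply]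

lemma norm_gen_le (r : Fin n → ℤ) : ‖(gen r : Twisted θ)‖ ≤ 1 :=
  norm_sumSMul_le _ fun _ => norm_bichar_smul_delta θ _ _ _

end Twisted

end Twisted

/-! ### Lifting functions to the twisted convolution algebra -/

section Lift

variable {n : ℕ} {X Y : Type*} {θ : Matrix (Fin n) (Fin n) ℝ}

section Fourier

/-- The normalized Haar measure on the circle, as used in `UnitAddTorus.mFourierCoeff`. -/
local instance : MeasureTheory.MeasureSpace UnitAddCircle := ⟨AddCircle.haarAddCircle⟩

local instance :
    MeasureTheory.Measure.IsAddHaarMeasure (MeasureTheory.volume : MeasureTheory.Measure UnitAddCircle) :=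
  inferInstanceAs (MeasureTheory.Measure.IsAddHaarMeasure AddCircle.haarAddCircle)

local instance :
    MeasureTheory.IsProbabilityMeasure (MeasureTheory.volume : MeasureTheory.Measure UnitAddCircle) :=
  inferInstanceAs (MeasureTheory.IsProbabilityMeasure AddCircle.haarAddCircle)

lemma mFourier_add_right (r : Fin n → ℤ) (t s : UnitAddTorus (Fin n)) :
    UnitAddTorus.mFourier r (t + s) = UnitAddTorus.mFourier r t * UnitAddTorus.mFourier r s := by
  simp [UnitAddTorus.mFourier, fourier_apply, smul_add, AddCircle.toCircle_add,
    Finset.prod_mul_distrib]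

lemma integrable_mFourier_smul (g : C(UnitAddTorus (Fin n), ℂ)) (r : Fin n → ℤ) :
    MeasureTheory.Integrable (fun t => UnitAddTorus.mFourier (-r) t • g t) :=
  (((UnitAddTorus.mFourier (-r)).continuous.smul g.continuous).integrable_of_hasCompactSupport
    (HasCompactSupport.of_compactSpace _))

/-- The `r`-th Fourier coefficient, as a bounded functional on continuous functions. -/
def fourierCLM (r : Fin n → ℤ) : C(UnitAddTorus (Fin n), ℂ) →L[ℂ] ℂ :=
  LinearMap.mkContinuous
    { toFun := fun g => UnitAddTorus.mFourierCoeff g r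
      map_add' := fun f g => by
        rw [UnitAddTorus.mFourierCoeff, UnitAddTorus.mFourierCoeff, UnitAddTorus.mFourierCoeff,
          ← MeasureTheory.integral_add (integrable_mFourier_smul f r) (integrable_mFourier_smul g r)]
        simp [mul_add]
      map_smul' := fun c g => by
        rw [UnitAddTorus.mFourierCoeff, UnitAddTorus.mFourierCoeff, RingHom.id_apply,
          ← MeasureTheory.integral_smul]
        simp [mul_left_comm] } 1 fun g => by
      refine (MeasureTheory.norm_integral_le_of_norm_le_const (C := 1 * ‖g‖)
        (.of_forall fun t => ?_)).trans (by simp)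
      rw [norm_smul]
      exact mul_le_mul (((UnitAddTorus.mFourier (-r)).norm_coe_le_norm t).trans_eq
        UnitAddTorus.mFourier_norm) (g.norm_coe_le_norm t) (norm_nonneg _) zero_le_one

lemma fourierCLM_apply (r : Fin n → ℤ) (g : C(UnitAddTorus (Fin n), ℂ)) :
    fourierCLM r g = UnitAddTorus.mFourierCoeff g r := rfl

lemma norm_fourierCLM_le (r : Fin n → ℤ) : ‖fourierCLM r‖ ≤ 1 :=
  LinearMap.mkContinuous_norm_le _ zero_le_one _

lemma mFourierCoeff_translate (g : UnitAddTorus (Fin n) → ℂ) (r : Fin n → ℤ)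
    (s : UnitAddTorus (Fin n)) :
    UnitAddTorus.mFourierCoeff (fun t => g (t + s)) r
      = UnitAddTorus.mFourier r s * UnitAddTorus.mFourierCoeff g r := by
  rw [UnitAddTorus.mFourierCoeff, UnitAddTorus.mFourierCoeff, ← MeasureTheory.integral_const_mul,
    ← MeasureTheory.integral_add_right_eq_self (μ := MeasureTheory.volume)
      (fun t => UnitAddTorus.mFourier r s * UnitAddTorus.mFourier (-r) t • g t) s]
  refine MeasureTheory.integral_congr_ae (.of_forall fun t => ?_)
  have h : UnitAddTorus.mFourier r s * UnitAddTorus.mFourier (-r) s = 1 := by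
    rw [← UnitAddTorus.mFourier_add, add_neg_cancel, UnitAddTorus.mFourier_zero]
    rfl
  simp only [mFourier_add_right, smul_eq_mul]
  linear_combination (-UnitAddTorus.mFourier (-r) t * g (t + s)) * h

lemma fourierCLM_mFourier (r l : Fin n → ℤ) :
    fourierCLM r (UnitAddTorus.mFourier l) = if l = r then 1 else 0 := by
  have h := orthonormal_iff_ite.1 (UnitAddTorus.orthonormal_mFourier (d := Fin n)) r l
  simp only [MeasureTheory.ContinuousMap.inner_toLp, ← UnitAddTorus.mFourier_neg] at h
  rw [fourierCLM_apply, UnitAddTorus.mFourierCoeff]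
  simpa only [smul_eq_mul, mul_comm, eq_comm] using h

end Fourier

variable (θ) in
/-- `Fh` lifts the function `F` on the torus space `(X, a)` to the twisted convolution algebra: the
coefficients of `Fh x` sum up to `F x`, and along the orbit of `x` the `r`-th coefficient varies by
the character `r`.  Then the coefficients of `Fh x` are the values at `x` of the isotypic components
of `F`, and the deformed product of functions corresponds to the product in the algebra. -/
structure IsLift (a : UnitAddTorus (Fin n) → X → X) (Fh : X → Twisted θ) (F : X → ℂ) : Prop where
  total_eq : ∀ x, Twisted.total (Fh x) = F x
  coeff_act : ∀ t x r, Twisted.coeff r (Fh (a (-t) x))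
    = UnitAddTorus.mFourier r t * Twisted.coeff r (Fh x)

namespace IsLift

open Twisted

variable {a : UnitAddTorus (Fin n) → X → X} {Fh Gh : X → Twisted θ} {F G : X → ℂ}

/-- The isotypic components of `F` are the coefficients of its lift: along the orbit of `x`, the
absolutely convergent series of coefficients is a Fourier series. -/
lemma component_eq (hF : IsLift θ a Fh F) (r : Fin n → ℤ) (x : X) :
    component a F r x = coeff r (Fh x) := by
  have hs : Summable fun l => coeff l (Fh x) • UnitAddTorus.mFourier (d := Fin n) l := by
    refine .of_norm ((summable_norm_coeff (Fh x)).congr fun l => ?_)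
    rw [norm_smul, UnitAddTorus.mFourier_norm, mul_one]
  have hf : (fun t => F (a (-t) x))
      = ⇑(∑' l, coeff l (Fh x) • UnitAddTorus.mFourier (d := Fin n) l) := by
    ext t
    rw [← hF.total_eq, total_apply, ← ContinuousMap.tsum_apply hs]
    refine tsum_congr fun l => ?_
    rw [hF.coeff_act, ContinuousMap.smul_apply, smul_eq_mul, mul_comm]
  rw [component, hf, ← fourierCLM_apply, ContinuousLinearMap.map_tsum _ hs, tsum_eq_single r]
  · simp [fourierCLM_mFourier]
  · intro l hl
    simp [fourierCLM_mFourier, hl]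

lemma comp {b : UnitAddTorus (Fin n) → Y → Y} {q : Y → X} (hF : IsLift θ a Fh F)
    (hq : ∀ t y, q (b t y) = a t (q y)) :
    IsLift θ b (fun y => Fh (q y)) (fun y => F (q y)) :=
  ⟨fun y => hF.total_eq _, fun t y r => by rw [hq, hF.coeff_act]⟩

lemma one : IsLift θ a (fun _ => 1) (fun _ => 1) :=
  ⟨fun _ => total_one, fun t x r => by
    by_cases h : r = 0
    · simp [coeff_one, h, UnitAddTorus.mFourier_zero]
    · simp [coeff_one, h]⟩

lemma add (hF : IsLift θ a Fh F) (hG : IsLift θ a Gh G) :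
    IsLift θ a (fun x => Fh x + Gh x) (fun x => F x + G x) :=
  ⟨fun x => by rw [map_add, hF.total_eq, hG.total_eq],
    fun t x r => by rw [map_add, map_add, hF.coeff_act, hG.coeff_act, mul_add]⟩

lemma sub (hF : IsLift θ a Fh F) (hG : IsLift θ a Gh G) :
    IsLift θ a (fun x => Fh x - Gh x) (fun x => F x - G x) :=
  ⟨fun x => by rw [map_sub, hF.total_eq, hG.total_eq],
    fun t x r => by rw [map_sub, map_sub, hF.coeff_act, hG.coeff_act, mul_sub]⟩

lemma const_smul (c : ℂ) (hF : IsLift θ a Fh F) :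
    IsLift θ a (fun x => c • Fh x) (fun x => c * F x) :=
  ⟨fun x => by rw [map_smul, hF.total_eq, smul_eq_mul],
    fun t x r => by rw [map_smul, map_smul, hF.coeff_act, smul_eq_mul, smul_eq_mul, mul_left_comm]⟩

lemma star (hF : IsLift θ a Fh F) (hG : IsLift θ a Gh G) :
    IsLift θ a (fun x => Fh x * Gh x) (ConnesLandi.star θ a F G) := by
  refine ⟨fun x => ?_, fun t x r => ?_⟩
  · rw [total_mul, ConnesLandi.star]
    simp only [hF.component_eq, hG.component_eq]
  · refine (coeff_mul _ _ r).unique ?_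
    have := (coeff_mul (Fh x) (Gh x) r).mul_left (UnitAddTorus.mFourier r t)
    refine this.congr_fun fun l => ?_
    rw [hF.coeff_act, hG.coeff_act]
    have h : UnitAddTorus.mFourier r t
        = UnitAddTorus.mFourier (r - l) t * UnitAddTorus.mFourier l t := by
      rw [← UnitAddTorus.mFourier_add, sub_add_cancel]
    rw [h]
    ring

lemma starPow (hF : IsLift θ a Fh F) (j : ℕ) :
    IsLift θ a (fun x => Fh x ^ j) (ConnesLandi.starPow θ a F j) := by
  induction j with
  | zero =>
    simp only [pow_zero]
    exact one
  | succ j ih =>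
    simp only [pow_succ']
    exact hF.star ih

lemma tsum {ι : Type*} {Fh : ι → X → Twisted θ} {F : ι → X → ℂ} (hF : ∀ p, IsLift θ a (Fh p) (F p))
    (h : ∀ x, HasSum (fun p => Fh p x) (Gh x)) :
    IsLift θ a Gh (fun x => ∑' p, F p x) := by
  refine ⟨fun x => ?_, fun t x r => ?_⟩
  · rw [← ((h x).mapL total).tsum_eq]
    exact tsum_congr fun p => (hF p).total_eq x
  · refine ((h (a (-t) x)).mapL (coeff r)).unique ?_
    simp only [(hF _).coeff_act]
    exact ((h x).mapL (coeff r)).mul_left _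

lemma summable {ι : Type*} {Fh : ι → X → Twisted θ} {F : ι → X → ℂ}
    (hF : ∀ p, IsLift θ a (Fh p) (F p)) {x : X} (h : Summable (fun p => Fh p x)) :
    Summable (fun p => F p x) := by
  simpa only [(hF _).total_eq] using h.mapL total

lemma starExp (hF : IsLift θ a Fh F) :
    IsLift θ a (fun x => NormedSpace.exp (Fh x)) (ConnesLandi.starExp θ a F) := by
  refine tsum (Fh := fun (j : ℕ) x => ((j ! : ℂ)⁻¹) • Fh x ^ j) (fun j => ?_) fun x => ?_
  · simpa only [div_eq_inv_mul] using (hF.starPow j).const_smul ((j ! : ℂ)⁻¹)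
  · exact NormedSpace.exp_series_hasSum_exp' (𝕂 := ℂ) (Fh x)

end IsLift

/-- The bounded operator `ψ ↦ 2 (ψ h - h ψ)` on a Banach algebra. -/
def modOp {A : Type*} [NormedRing A] [NormedAlgebra ℂ A] (h : A) : A →L[ℂ] A :=
  (2 : ℂ) • ((ContinuousLinearMap.mul ℂ A).flip h - ContinuousLinearMap.mul ℂ A h)

lemma modOp_apply {A : Type*} [NormedRing A] [NormedAlgebra ℂ A] (h x : A) :
    modOp h x = (2 : ℂ) • (x * h - h * x) := rfl

namespace IsLift

variable {a : UnitAddTorus (Fin n) → X → X} {hh Fh Gh : X → Twisted θ} {h F G : X → ℂ}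

lemma modDer (hh' : IsLift θ a hh h) (hF : IsLift θ a Fh F) :
    IsLift θ a (fun x => modOp (hh x) (Fh x)) (ConnesLandi.modDer θ a h F) := by
  simp only [modOp_apply]
  exact ((hF.star hh').sub (hh'.star hF)).const_smul 2

lemma modDer_iterate (hh' : IsLift θ a hh h) (hF : IsLift θ a Fh F) (p : ℕ) :
    IsLift θ a (fun x => (modOp (hh x) ^ p) (Fh x)) ((ConnesLandi.modDer θ a h)^[p] F) := by
  induction p with
  | zero => simpa using hF
  | succ p ih =>
    rw [Function.iterate_succ_apply']
    simp only [pow_succ', mul_apply_eq_comp]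
    exact hh'.modDer ih

lemma calcTerm₁ (hh' : IsLift θ a hh h) (hF : IsLift θ a Fh F) (f : ℝ → ℝ) (p : ℕ) :
    IsLift θ a (fun x => (taylor₁ f p : ℂ) • (modOp (hh x) ^ p) (Fh x))
      (fun x => ConnesLandi.calcTerm₁ θ a h f F x p) :=
  (hh'.modDer_iterate hF p).const_smul _

lemma calcTerm₂ (hh' : IsLift θ a hh h) (hF : IsLift θ a Fh F) (hG : IsLift θ a Gh G)
    (f : ℝ → ℝ → ℝ) (p : ℕ × ℕ) :
    IsLift θ a (fun x => (taylor₂ f p.1 p.2 : ℂ) •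
        ((modOp (hh x) ^ p.1) (Fh x) * (modOp (hh x) ^ p.2) (Gh x)))
      (fun x => ConnesLandi.calcTerm₂ θ a h f F G x p) :=
  ((hh'.modDer_iterate hF p.1).star (hh'.modDer_iterate hG p.2)).const_smul _

end IsLift

end Lift

/-! ### Power series and superpositions of exponentials -/

section Calculus

open Filter Topology MeasureTheory

lemma taylor₁_eq_of_hasSum {f : ℝ → ℝ} {c : ℕ → ℝ}
    (h : ∀ s, HasSum (fun p => c p * s ^ p) (f s)) (p : ℕ) : taylor₁ f p = c p := by
  have h1 : HasFPowerSeriesAt f (FormalMultilinearSeries.ofScalars ℝ c) 0 := by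
    rw [hasFPowerSeriesAt_iff]
    refine .of_forall fun z => ?_
    simpa [FormalMultilinearSeries.coeff_ofScalars, mul_comm] using h z
  have h2 := h1.analyticAt.hasFPowerSeriesAt.eq_formalMultilinearSeries h1
  have := congr(FormalMultilinearSeries.coeff $h2 p)
  simpa [FormalMultilinearSeries.coeff_ofScalars, taylor₁] using this

/-- The iterated derivatives in `taylor₂` pick the coefficients of a double power series, since the
series may be summed first over one index and then over the other. -/
lemma taylor₂_eq_of_hasSum {f : ℝ → ℝ → ℝ} {c : ℕ → ℕ → ℝ}
    (h : ∀ s t, HasSum (fun p : ℕ × ℕ => c p.1 p.2 * s ^ p.1 * t ^ p.2) (f s t)) (p q : ℕ) :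
    taylor₂ f p q = c p q := by
  have hs (s t : ℝ) : HasSum (fun p : ℕ × ℕ => c p.2 p.1 * s ^ p.2 * t ^ p.1) (f s t) :=
    (Equiv.prodComm ℕ ℕ).hasSum_iff.2 (h s t)
  have hin (s : ℝ) (q : ℕ) : Summable fun p => c p q * s ^ p := by
    have := (hs s 1).summable.prod_factor q
    simpa using this
  have h1 (s t : ℝ) : HasSum (fun q => (∑' p, c p q * s ^ p) * t ^ q) (f s t) :=
    (hs s t).prod_fiberwise fun q => (hin s q).hasSum.mul_right (t ^ q)
  have h2 (s : ℝ) (q : ℕ) : iteratedDeriv q (fun t => f s t) 0 / q ! = ∑' p, c p q * s ^ p :=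
    taylor₁_eq_of_hasSum (h1 s) q
  have h3 := taylor₁_eq_of_hasSum
    (f := fun s => iteratedDeriv q (fun t => f s t) 0 / q !) (c := fun p => c p q)
    (fun s => by rw [h2]; exact (hin s q).hasSum) p
  rw [← h3, taylor₁, taylor₂]
  simp only [div_eq_mul_inv]
  rw [iteratedDeriv_mul_const_field, mul_inv]
  ring

/-- Integration of an exponential series in its exponent, by dominated convergence. -/
lemma hasSum_integral_exp {A : Type*} [NormedAddCommGroup A] [NormedSpace ℝ A] [CompleteSpace A]
    {x : ℕ → A} {K R : ℝ} (hx : ∀ p, ‖x p‖ ≤ K * R ^ p) {ex : ℝ → A}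
    (hex : ∀ l : ℝ, HasSum (fun p => (l ^ p / p !) • x p) (ex l))
    {b l : ℝ → ℝ} (hb : Continuous b) (hl : Continuous l) :
    HasSum (fun p => (∫ v in (0 : ℝ)..1, b v * (l v ^ p / p !)) • x p)
      (∫ v in (0 : ℝ)..1, b v • ex (l v)) := by
  obtain ⟨B, hB⟩ := (isCompact_Icc (a := (0 : ℝ)) (b := 1)).exists_bound_of_continuousOn
    hb.continuousOn
  obtain ⟨Λ, hΛ⟩ := (isCompact_Icc (a := (0 : ℝ)) (b := 1)).exists_bound_of_continuousOn
    hl.continuousOn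
  have hK : 0 ≤ K := by simpa using (norm_nonneg _).trans (hx 0)
  have h0 : (0 : ℝ) ∈ Set.Icc (0 : ℝ) 1 := by simp
  have hB0 : 0 ≤ B := (norm_nonneg _).trans (hB 0 h0)
  have hΛ0 : 0 ≤ Λ := (norm_nonneg _).trans (hΛ 0 h0)
  simp only [← intervalIntegral.integral_smul_const]
  have hsum : Summable fun p : ℕ => B * K * ((Λ * R) ^ p / p !) :=
    (Real.summable_pow_div_factorial (Λ * R)).mul_left _
  refine intervalIntegral.hasSum_integral_of_dominated_convergence
    (fun p _ => B * K * ((Λ * R) ^ p / p !)) (fun p => ?_) (fun p => .of_forall fun v hv => ?_)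
    (.of_forall fun _ _ => hsum) (by simp) (.of_forall fun v _ => ?_)
  · exact Continuous.aestronglyMeasurable (by fun_prop)
  · rw [Set.uIoc_of_le zero_le_one] at hv
    have hv' := Set.Ioc_subset_Icc_self hv
    rw [norm_smul, norm_mul, norm_div, norm_pow, Real.norm_natCast, mul_pow]
    calc ‖b v‖ * (‖l v‖ ^ p / p !) * ‖x p‖ ≤ B * (Λ ^ p / p !) * (K * R ^ p) := by
          refine mul_le_mul ?_ (hx p) (norm_nonneg _) (by positivity)
          gcongr
          · exact hB v hv'
          · exact hΛ v hv'
      _ = _ := by ring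
  · simpa only [mul_smul] using (hex (l v)).const_smul (b v)

/-- The analogue of `hasSum_integral_exp` for a product of two exponential series and a double integral. -/
lemma hasSum_integral_exp_mul_exp {A : Type*} [NormedRing A] [NormedAlgebra ℝ A] [CompleteSpace A]
    {x y : ℕ → A} {K R K' : ℝ} (hx : ∀ p, ‖x p‖ ≤ K * R ^ p) (hy : ∀ p, ‖y p‖ ≤ K' * R ^ p)
    {ex ey : ℝ → A} (hex : ∀ l : ℝ, HasSum (fun p => (l ^ p / p !) • x p) (ex l))
    (hey : ∀ l : ℝ, HasSum (fun p => (l ^ p / p !) • y p) (ey l))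
    {b l m : ℝ → ℝ → ℝ} (hb : Continuous fun p : ℝ × ℝ => b p.1 p.2)
    (hl : Continuous fun p : ℝ × ℝ => l p.1 p.2) (hm : Continuous fun p : ℝ × ℝ => m p.1 p.2) :
    HasSum (fun p : ℕ × ℕ => (∫ v in (0 : ℝ)..1, ∫ w in (0 : ℝ)..1,
        b v w * (l v w ^ p.1 / p.1 !) * (m v w ^ p.2 / p.2 !)) • (x p.1 * y p.2))
      (∫ v in (0 : ℝ)..1, ∫ w in (0 : ℝ)..1, b v w • (ex (l v w) * ey (m v w))) := by
  have hc := (isCompact_Icc (a := (0 : ℝ)) (b := 1)).prod (isCompact_Icc (a := (0 : ℝ)) (b := 1))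
  obtain ⟨B, hB⟩ := hc.exists_bound_of_continuousOn hb.continuousOn
  obtain ⟨Λ, hΛ⟩ := hc.exists_bound_of_continuousOn hl.continuousOn
  obtain ⟨Μ, hΜ⟩ := hc.exists_bound_of_continuousOn hm.continuousOn
  have hK : 0 ≤ K := by simpa using (norm_nonneg _).trans (hx 0)
  have hK' : 0 ≤ K' := by simpa using (norm_nonneg _).trans (hy 0)
  have h0 : ((0, 0) : ℝ × ℝ) ∈ Set.Icc (0 : ℝ) 1 ×ˢ Set.Icc (0 : ℝ) 1 := by simp
  have hB0 : 0 ≤ B := (norm_nonneg _).trans (hB _ h0)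
  have hΛ0 : 0 ≤ Λ := (norm_nonneg _).trans (hΛ _ h0)
  have hΜ0 : 0 ≤ Μ := (norm_nonneg _).trans (hΜ _ h0)
  have hR0 (p : ℕ) : 0 ≤ K * R ^ p := (norm_nonneg _).trans (hx p)
  simp only [← intervalIntegral.integral_smul_const]
  set F : ℕ × ℕ → ℝ → ℝ → A := fun p v w =>
    (b v w * (l v w ^ p.1 / p.1 !) * (m v w ^ p.2 / p.2 !)) • (x p.1 * y p.2) with hF
  set c : ℕ × ℕ → ℝ := fun p =>
    B * K * K' * (((Λ * R) ^ p.1 / p.1 !) * ((Μ * R) ^ p.2 / p.2 !)) with hcdef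
  have hsum : Summable c :=
    (summable_mul_of_summable_norm (Real.summable_pow_div_factorial (Λ * R)).norm
      (Real.summable_pow_div_factorial (Μ * R)).norm).mul_left _
  have hFc (p : ℕ × ℕ) : Continuous fun q : ℝ × ℝ => F p q.1 q.2 := by
    simp only [hF]
    fun_prop
  have hFb (p : ℕ × ℕ) {v w : ℝ} (hv : v ∈ Set.uIoc (0 : ℝ) 1) (hw : w ∈ Set.uIoc (0 : ℝ) 1) :
      ‖F p v w‖ ≤ c p := by
    rw [Set.uIoc_of_le zero_le_one] at hv hw
    have hvw : (v, w) ∈ Set.Icc (0 : ℝ) 1 ×ˢ Set.Icc (0 : ℝ) 1 :=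
      ⟨Set.Ioc_subset_Icc_self hv, Set.Ioc_subset_Icc_self hw⟩
    simp only [hF, hcdef]
    rw [norm_smul, norm_mul, norm_mul, norm_div, norm_div, norm_pow, norm_pow, Real.norm_natCast,
      Real.norm_natCast, mul_pow, mul_pow]
    calc _ ≤ B * (Λ ^ p.1 / p.1 !) * (Μ ^ p.2 / p.2 !) * ((K * R ^ p.1) * (K' * R ^ p.2)) := by
          refine mul_le_mul ?_ ((norm_mul_le _ _).trans
            (mul_le_mul (hx _) (hy _) (norm_nonneg _) (hR0 _))) (norm_nonneg _) (by positivity)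
          gcongr
          · exact hB _ hvw
          · exact hΛ _ hvw
          · exact hΜ _ hvw
      _ = _ := by ring
  have hinner (v : ℝ) (hv : v ∈ Set.uIoc (0 : ℝ) 1) : HasSum (fun p => ∫ w in (0 : ℝ)..1, F p v w)
      (∫ w in (0 : ℝ)..1, b v w • (ex (l v w) * ey (m v w))) := by
    refine intervalIntegral.hasSum_integral_of_dominated_convergence
      (fun p _ => c p) (fun p => ?_) (fun p => .of_forall fun w hw => hFb p hv hw)
      (.of_forall fun _ _ => hsum) (by simp) (.of_forall fun w _ => ?_)
    · exact Continuous.aestronglyMeasurable ((hFc p).comp (Continuous.prodMk_right v))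
    · have h1 := hex (l v w)
      have h2 := hey (m v w)
      have n1 : Summable fun p => ‖(l v w ^ p / p !) • x p‖ := by
        refine ((Real.summable_pow_div_factorial (‖l v w‖ * R)).mul_left K).of_nonneg_of_le
          (fun _ => norm_nonneg _) fun p => ?_
        rw [norm_smul, norm_div, norm_pow, Real.norm_natCast, mul_pow]
        calc _ ≤ ‖l v w‖ ^ p / p ! * (K * R ^ p) := by gcongr; exact hx p
          _ = _ := by ring
      have n2 : Summable fun p => ‖(m v w ^ p / p !) • y p‖ := by
        refine ((Real.summable_pow_div_factorial (‖m v w‖ * R)).mul_left K').of_nonneg_of_le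
          (fun _ => norm_nonneg _) fun p => ?_
        rw [norm_smul, norm_div, norm_pow, Real.norm_natCast, mul_pow]
        calc _ ≤ ‖m v w‖ ^ p / p ! * (K' * R ^ p) := by gcongr; exact hy p
          _ = _ := by ring
      have h3 := (summable_mul_of_summable_norm n1 n2).hasSum
      rw [← tsum_mul_tsum_of_summable_norm n1 n2, h1.tsum_eq, h2.tsum_eq] at h3
      refine (h3.const_smul (b v w)).congr_fun fun p => ?_
      simp only [hF, smul_mul_smul_comm, smul_smul]
      ring_nf
  refine intervalIntegral.hasSum_integral_of_dominated_convergence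
      (fun p _ => c p) (fun p => ?_) (fun p => .of_forall fun v hv => ?_)
      (.of_forall fun _ _ => hsum) (by simp) (.of_forall fun v hv => hinner v hv)
  · exact Continuous.aestronglyMeasurable
      (intervalIntegral.continuous_parametric_intervalIntegral_of_continuous' (hFc p) 0 1)
  · refine (intervalIntegral.norm_integral_le_of_norm_le_const fun w hw => hFb p hv hw).trans ?_
    simp

lemma norm_pow_apply_le {A : Type*} [NormedAddCommGroup A] [NormedSpace ℂ A]
    (D : A →L[ℂ] A) (x : A) (p : ℕ) : ‖(D ^ p) x‖ ≤ ‖x‖ * ‖D‖ ^ p := by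
  induction p with
  | zero => simp
  | succ p ih =>
    rw [pow_succ', mul_apply_eq_comp, pow_succ, ← mul_assoc, mul_comm _ ‖D‖]
    exact (D.le_opNorm _).trans (by gcongr)

lemma hasSum_exp_real (s l : ℝ) : HasSum (fun p : ℕ => (l ^ p / p !) • s ^ p) (Real.exp (l * s)) := by
  have := NormedSpace.expSeries_div_hasSum_exp (l * s)
  rw [Real.exp_eq_exp_ℝ]
  refine this.congr_fun fun p => ?_
  rw [smul_eq_mul, mul_pow]
  ring

lemma norm_pow_le_one_mul (s : ℝ) (p : ℕ) : ‖s ^ p‖ ≤ 1 * |s| ^ p := by simp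

variable {A : Type*} [NormedRing A] [NormedAlgebra ℂ A] [CompleteSpace A]

/-- Functional calculus of a one-variable superposition of exponentials: if
`f(s) = ∑ᵢ ∫₀¹ bᵢ(v) e^{lᵢ(v) s} dv`, then `∑ f⁽ᵖ⁾(0)/p! Dᵖ(x) = ∑ᵢ ∫₀¹ bᵢ(v) e^{lᵢ(v) D}(x) dv`. -/
lemma hasSum_taylor₁_smul {ι : Type*} [Fintype ι] {b l : ι → ℝ → ℝ} (hb : ∀ i, Continuous (b i))
    (hl : ∀ i, Continuous (l i)) {f : ℝ → ℝ}
    (hf : ∀ s, f s = ∑ i, ∫ v in (0 : ℝ)..1, b i v * Real.exp (l i v * s))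
    (D : A →L[ℂ] A) (x : A) {ex : ℝ → A}
    (hex : ∀ l : ℝ, HasSum (fun p => (l ^ p / p !) • (D ^ p) x) (ex l)) :
    HasSum (fun p => (taylor₁ f p : ℂ) • (D ^ p) x)
      (∑ i, ∫ v in (0 : ℝ)..1, b i v • ex (l i v)) := by
  have hc (p : ℕ) : taylor₁ f p = ∑ i, ∫ v in (0 : ℝ)..1, b i v * (l i v ^ p / p !) := by
    refine taylor₁_eq_of_hasSum (c := fun p => ∑ i, ∫ v in (0 : ℝ)..1, b i v * (l i v ^ p / p !))
      (fun s => ?_) p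
    rw [hf]
    simp only [Finset.sum_mul]
    exact hasSum_sum fun i _ => by
      simpa using hasSum_integral_exp (norm_pow_le_one_mul s) (hasSum_exp_real s) (hb i) (hl i)
  simp only [hc, Complex.coe_smul, Finset.sum_smul]
  exact hasSum_sum fun i _ => hasSum_integral_exp (norm_pow_apply_le D x) hex (hb i) (hl i)

/-- The analogue of `hasSum_taylor₁_smul` in two variables. -/
lemma hasSum_taylor₂_smul {ι : Type*} [Fintype ι] {b l m : ι → ℝ → ℝ → ℝ}
    (hb : ∀ i, Continuous fun p : ℝ × ℝ => b i p.1 p.2)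
    (hl : ∀ i, Continuous fun p : ℝ × ℝ => l i p.1 p.2)
    (hm : ∀ i, Continuous fun p : ℝ × ℝ => m i p.1 p.2) {f : ℝ → ℝ → ℝ}
    (hf : ∀ s t, f s t = ∑ i, ∫ v in (0 : ℝ)..1, ∫ w in (0 : ℝ)..1,
      b i v w * (Real.exp (l i v w * s) * Real.exp (m i v w * t)))
    (D : A →L[ℂ] A) (x y : A) {ex ey : ℝ → A}
    (hex : ∀ l : ℝ, HasSum (fun p => (l ^ p / p !) • (D ^ p) x) (ex l))
    (hey : ∀ l : ℝ, HasSum (fun p => (l ^ p / p !) • (D ^ p) y) (ey l)) :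
    HasSum (fun p : ℕ × ℕ => (taylor₂ f p.1 p.2 : ℂ) • ((D ^ p.1) x * (D ^ p.2) y))
      (∑ i, ∫ v in (0 : ℝ)..1, ∫ w in (0 : ℝ)..1, b i v w • (ex (l i v w) * ey (m i v w))) := by
  have hc (p q : ℕ) : taylor₂ f p q = ∑ i, ∫ v in (0 : ℝ)..1, ∫ w in (0 : ℝ)..1,
      b i v w * (l i v w ^ p / p !) * (m i v w ^ q / q !) := by
    refine taylor₂_eq_of_hasSum (c := fun p q => ∑ i, ∫ v in (0 : ℝ)..1, ∫ w in (0 : ℝ)..1,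
      b i v w * (l i v w ^ p / p !) * (m i v w ^ q / q !)) (fun s t => ?_) p q
    rw [hf]
    simp only [Finset.sum_mul]
    refine hasSum_sum fun i _ => ?_
    have hx (r : ℝ) (hr : |r| ≤ max |s| |t|) (p : ℕ) : ‖r ^ p‖ ≤ 1 * max |s| |t| ^ p := by
      rw [norm_pow, one_mul]
      exact pow_le_pow_left₀ (norm_nonneg _) hr p
    simpa only [smul_eq_mul, mul_assoc] using hasSum_integral_exp_mul_exp (hx s (le_max_left _ _))
      (hx t (le_max_right _ _)) (hasSum_exp_real s) (hasSum_exp_real t) (hb i) (hl i) (hm i)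
  simp only [hc, Complex.coe_smul, Finset.sum_smul]
  exact hasSum_sum fun i _ => hasSum_integral_exp_mul_exp (norm_pow_apply_le D x)
    (norm_pow_apply_le D y) hex hey (hb i) (hl i) (hm i)

lemma exp_smul_mul_apply (h x : A) (c : ℝ) :
    NormedSpace.exp (c • ContinuousLinearMap.mul ℂ A h) x = NormedSpace.exp (c • h) * x := by
  have h1 := (NormedSpace.exp_series_hasSum_exp' (𝕂 := ℝ) (c • ContinuousLinearMap.mul ℂ A h)).mapL
    (ContinuousLinearMap.apply ℂ A x)
  have h2 := (NormedSpace.exp_series_hasSum_exp' (𝕂 := ℝ) (c • h)).mul_right x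
  refine h1.unique (h2.congr_fun fun p => ?_)
  have : ((ContinuousLinearMap.mul ℂ A h) ^ p) x = h ^ p * x := by
    induction p with
    | zero => simp
    | succ p ih => rw [pow_succ', mul_apply_eq_comp, ih, pow_succ', mul_assoc]; rfl
  simp [smul_pow, this]

lemma exp_smul_mul_flip_apply (h x : A) (c : ℝ) :
    NormedSpace.exp (c • (ContinuousLinearMap.mul ℂ A).flip h) x = x * NormedSpace.exp (c • h) := by
  have h1 := (NormedSpace.exp_series_hasSum_exp' (𝕂 := ℝ)
    (c • (ContinuousLinearMap.mul ℂ A).flip h)).mapL (ContinuousLinearMap.apply ℂ A x)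
  have h2 := (NormedSpace.exp_series_hasSum_exp' (𝕂 := ℝ) (c • h)).mul_left x
  refine h1.unique (h2.congr_fun fun p => ?_)
  have : (((ContinuousLinearMap.mul ℂ A).flip h) ^ p) x = x * h ^ p := by
    induction p with
    | zero => simp
    | succ p ih => rw [pow_succ', mul_apply_eq_comp, ih, pow_succ, ← mul_assoc]; rfl
  simp [smul_pow, this]

/-- The modular group: `e^{l D}(x) = e^{-2lh} x e^{2lh}` for `D = modOp h`. -/
lemma hasSum_exp_modOp (h x : A) (l : ℝ) :
    HasSum (fun p => (l ^ p / p !) • (modOp h ^ p) x)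
      (NormedSpace.exp ((-2 * l) • h) * x * NormedSpace.exp ((2 * l) • h)) := by
  have hD : l • modOp h = (-2 * l) • ContinuousLinearMap.mul ℂ A h
      + (2 * l) • (ContinuousLinearMap.mul ℂ A).flip h := by
    ext x
    have h2 (z : A) : (2 : ℂ) • z = (2 : ℝ) • z := by
      rw [← Complex.coe_smul]
      simp
    simp only [modOp, h2, smul_apply, add_apply,
      sub_apply]
    module
  have hcomm : Commute (ContinuousLinearMap.mul ℂ A h) ((ContinuousLinearMap.mul ℂ A).flip h) := by
    ext x
    simp [mul_assoc]
  let _ : NormedAlgebra ℚ (A →L[ℂ] A) := NormedAlgebra.restrictScalars ℚ ℂ _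
  have h1 := (NormedSpace.exp_series_hasSum_exp' (𝕂 := ℝ) (l • modOp h)).mapL
    (ContinuousLinearMap.apply ℂ A x)
  rw [hD, NormedSpace.exp_add_of_commute ((hcomm.smul_left _).smul_right _), ← hD] at h1
  simp only [ContinuousLinearMap.apply_apply, mul_apply_eq_comp, exp_smul_mul_apply,
    exp_smul_mul_flip_apply, ← mul_assoc] at h1
  refine h1.congr_fun fun p => ?_
  have hp : ((l • modOp h) ^ p) x = l ^ p • (modOp h ^ p) x := by
    induction p with
    | zero => simp
    | succ p ih =>
      rw [pow_succ', mul_apply_eq_comp, ih, smul_apply, ContinuousLinearMap.map_smul_of_tower,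
        smul_smul, pow_succ' l, pow_succ' (modOp h), mul_apply_eq_comp]
  rw [smul_apply, hp, smul_smul, div_eq_inv_mul]

end Calculus

/-! ### First and second derivative of the exponential in a Banach algebra -/

section Duhamel

open Filter Topology NormedSpace

variable {A : Type*} [NormedRing A] [NormedAlgebra ℝ A] [CompleteSpace A]

lemma continuous_exp_algebra : Continuous (NormedSpace.exp : A → A) := by
  let _ : NormedAlgebra ℚ A := NormedAlgebra.restrictScalars ℚ ℝ A
  exact NormedSpace.exp_continuous

lemma contDiff_exp_algebra {n : WithTop ℕ∞} : ContDiff ℝ n (NormedSpace.exp : A → A) :=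
  contDiff_iff_contDiffAt.2 fun x => (NormedSpace.exp_analytic (𝕂 := ℝ) x).contDiffAt

@[fun_prop]
lemma Continuous.algebra_exp {X : Type*} [TopologicalSpace X] {f : X → A} (hf : Continuous f) :
    Continuous fun x => NormedSpace.exp (f x) :=
  continuous_exp_algebra.comp hf

/-- Duhamel's formula. -/
lemma exp_sub_exp_eq_integral (a b : A) :
    exp b - exp a
      = ∫ v in (0 : ℝ)..1, exp ((1 - v) • a) * (b - a) * exp (v • b) := by
  have hd (v : ℝ) : HasDerivAt (fun v : ℝ => exp ((1 - v) • a) * exp (v • b))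
      (exp ((1 - v) • a) * (b - a) * exp (v • b)) v := by
    have h1 : HasDerivAt (fun v : ℝ => exp ((1 - v) • a)) (-(exp ((1 - v) • a) * a)) v := by
      simpa [Function.comp_def] using (hasDerivAt_exp_smul_const (𝕂 := ℝ) a (1 - v)).scomp v
        ((hasDerivAt_id v).const_sub 1)
    refine (h1.mul (hasDerivAt_exp_smul_const' (𝕂 := ℝ) b v)).congr_deriv ?_
    noncomm_ring
  rw [intervalIntegral.integral_eq_sub_of_hasDerivAt (fun v _ => hd v)
    (Continuous.intervalIntegrable (by fun_prop) _ _)]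
  simp

lemma exp_smul_eq_add_integral (a b : A) (v : ℝ) :
    exp (v • b) = exp (v • a)
      + v • ∫ w in (0 : ℝ)..1, exp ((v - v * w) • a) * (b - a) * exp ((v * w) • b) := by
  rw [← sub_eq_iff_eq_add', exp_sub_exp_eq_integral, ← intervalIntegral.integral_smul]
  refine intervalIntegral.integral_congr fun w _ => ?_
  simp only [smul_smul, ← smul_sub, mul_smul_comm, smul_mul_assoc]
  ring_nf

/-- The modular group `x ↦ e^{-2la} x e^{2la}` of an element `a`. -/
def modGroup (a : A) (l : ℝ) (x : A) : A := exp ((-2 * l) • a) * x * exp ((2 * l) • a)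

/-- The first order term of the exponential. -/
def expD₁ (a d : A) : A := exp a * ∫ v in (0 : ℝ)..1, modGroup a (v / 2) d

/-- The second order term of the exponential. -/
def expD₂ (a d : A) : A := exp a * ∫ v in (0 : ℝ)..1, ∫ w in (0 : ℝ)..1,
  v • (modGroup a (v / 2) d * modGroup a (v * w / 2) d)

lemma exp_smul_mul_exp_smul (a : A) (s t : ℝ) :
    exp (s • a) * exp (t • a) = exp ((s + t) • a) := by
  let _ : NormedAlgebra ℚ A := NormedAlgebra.restrictScalars ℚ ℝ A
  rw [add_smul, NormedSpace.exp_add_of_commute (((Commute.refl a).smul_left s).smul_right t)]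

/-- The remainder in the second order expansion of the exponential. -/
def expRem (a d : A) (s : ℝ) : A := ∫ v in (0 : ℝ)..1, ∫ w in (0 : ℝ)..1,
  v • (exp ((1 - v) • a) * d * (exp ((v - v * w) • a) * d * exp ((v * w) • (a + s • d))))

lemma exp_mul_modGroup (a d : A) (v : ℝ) :
    exp a * modGroup a (v / 2) d = exp ((1 - v) • a) * d * exp (v • a) := by
  have h := exp_smul_mul_exp_smul a 1 (-2 * (v / 2))
  rw [one_smul] at h
  rw [modGroup, ← mul_assoc, ← mul_assoc, h]
  congr 4 <;> ring

lemma exp_mul_modGroup_mul_modGroup (a d : A) (v w : ℝ) :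
    exp a * (modGroup a (v / 2) d * modGroup a (v * w / 2) d)
      = exp ((1 - v) • a) * d * (exp ((v - v * w) • a) * d * exp ((v * w) • a)) := by
  have h := exp_smul_mul_exp_smul a v (-2 * (v * w / 2))
  rw [show v + -2 * (v * w / 2) = v - v * w by ring] at h
  rw [← mul_assoc, exp_mul_modGroup, modGroup, mul_assoc _ (exp (v • a)), ← mul_assoc (exp (v • a)),
    ← mul_assoc (exp (v • a)), h, show 2 * (v * w / 2) = v * w by ring]

lemma mul_intervalIntegral (c : A) {f : ℝ → A} (hf : Continuous f) :
    c * ∫ v in (0 : ℝ)..1, f v = ∫ v in (0 : ℝ)..1, c * f v :=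
  ((ContinuousLinearMap.mul ℝ A c).intervalIntegral_comp_comm (hf.intervalIntegrable _ _)).symm

@[fun_prop]
lemma continuous_modGroup {X : Type*} [TopologicalSpace X] {f : X → ℝ} (hf : Continuous f)
    (a d : A) : Continuous fun x => modGroup a (f x) d := by
  unfold modGroup
  fun_prop

omit [CompleteSpace A] in
lemma continuous_integral_right {f : ℝ → ℝ → A} (hf : Continuous fun p : ℝ × ℝ => f p.1 p.2) :
    Continuous fun v => ∫ w in (0 : ℝ)..1, f v w :=
  intervalIntegral.continuous_parametric_intervalIntegral_of_continuous' hf 0 1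

lemma expD₁_eq (a d : A) :
    expD₁ a d = ∫ v in (0 : ℝ)..1, exp ((1 - v) • a) * d * exp (v • a) := by
  rw [expD₁, mul_intervalIntegral _ (by fun_prop)]
  simp only [exp_mul_modGroup]

lemma expRem_zero (a d : A) : expRem a d 0 = expD₂ a d := by
  rw [expRem, expD₂, mul_intervalIntegral _ (continuous_integral_right (by fun_prop))]
  refine intervalIntegral.integral_congr fun v _ => ?_
  rw [mul_intervalIntegral _ (by fun_prop)]
  refine intervalIntegral.integral_congr fun w _ => ?_
  rw [mul_smul_comm, exp_mul_modGroup_mul_modGroup, zero_smul, add_zero]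

/-- Duhamel's formula applied twice gives the second order expansion of the exponential, with a
remainder that is continuous in the parameter. -/
lemma exp_add_smul_eq (a d : A) (s : ℝ) :
    exp (a + s • d) = exp a + s • expD₁ a d + s ^ 2 • expRem a d s := by
  have h (v : ℝ) : exp ((1 - v) • a) * (a + s • d - a) * exp (v • (a + s • d))
      = s • (exp ((1 - v) • a) * d * exp (v • a)) + s ^ 2 • ∫ w in (0 : ℝ)..1,
        v • (exp ((1 - v) • a) * d *
          (exp ((v - v * w) • a) * d * exp ((v * w) • (a + s • d)))) := by
    have h1 : ∫ w in (0 : ℝ)..1, exp ((v - v * w) • a) * (s • d) * exp ((v * w) • (a + s • d))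
        = s • ∫ w in (0 : ℝ)..1, exp ((v - v * w) • a) * d * exp ((v * w) • (a + s • d)) := by
      rw [← intervalIntegral.integral_smul]
      simp only [mul_smul_comm, smul_mul_assoc]
    rw [intervalIntegral.integral_smul, ← mul_intervalIntegral _ (by fun_prop),
      exp_smul_eq_add_integral a (a + s • d) v, add_sub_cancel_left, h1, mul_add]
    simp only [mul_smul_comm, smul_mul_assoc]
    module
  have hc : Continuous fun v : ℝ => s ^ 2 • ∫ w in (0 : ℝ)..1, v • (exp ((1 - v) • a) * d *
      (exp ((v - v * w) • a) * d * exp ((v * w) • (a + s • d)))) :=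
    (continuous_integral_right (by fun_prop)).const_smul _
  rw [add_assoc, ← sub_eq_iff_eq_add', exp_sub_exp_eq_integral]
  simp only [h]
  rw [intervalIntegral.integral_add (Continuous.intervalIntegrable (by fun_prop) _ _)
    (hc.intervalIntegrable _ _), intervalIntegral.integral_smul,
    intervalIntegral.integral_smul, ← expD₁_eq, expRem]

lemma continuous_expRem (a d : A) : Continuous (expRem a d) := by
  refine intervalIntegral.continuous_parametric_intervalIntegral_of_continuous' ?_ 0 1
  refine intervalIntegral.continuous_parametric_intervalIntegral_of_continuous'
    (f := fun (p : ℝ × ℝ) w => p.2 • (exp ((1 - p.2) • a) * d * (exp ((p.2 - p.2 * w) • a) * d *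
      exp ((p.2 * w) • (a + p.1 • d))))) ?_ 0 1
  fun_prop

lemma hasDerivAt_comp_add_smul {E F : Type*} [NormedAddCommGroup E] [NormedSpace ℝ E]
    [NormedAddCommGroup F] [NormedSpace ℝ F] {G : E → F} (a d : E) {s : ℝ}
    (hG : DifferentiableAt ℝ G (a + s • d)) :
    HasDerivAt (fun s : ℝ => G (a + s • d)) (fderiv ℝ G (a + s • d) d) s := by
  have h : HasDerivAt (fun s : ℝ => a + s • d) d s := by
    simpa using ((hasDerivAt_id s).smul_const d).const_add a
  exact hG.hasFDerivAt.comp_hasDerivAt s h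

lemma hasDerivAt_exp_add_smul (a d : A) : HasDerivAt (fun s : ℝ => exp (a + s • d)) (expD₁ a d) 0 := by
  have h : HasDerivAt (fun s : ℝ => s ^ 2) 0 0 := by simpa using hasDerivAt_pow 2 (0 : ℝ)
  have hr : HasDerivAt (fun s : ℝ => s ^ 2 • expRem a d s) 0 0 := by
    rw [hasDerivAt_iff_isLittleO_nhds_zero]
    simp only [zero_add, ne_eq, OfNat.ofNat_ne_zero, not_false_eq_true, zero_pow, zero_smul,
      sub_zero, smul_zero]
    have h1 : (fun s : ℝ => s ^ 2) =o[𝓝 0] fun s => s := by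
      simpa using h.isLittleO
    have h2 : (fun s => expRem a d s) =O[𝓝 0] fun _ => (1 : ℝ) :=
      (continuous_expRem a d).continuousAt.isBigO_one ℝ
    simpa using h1.smul_isBigO h2
  have := ((hasDerivAt_id (0 : ℝ)).smul_const (expD₁ a d)).const_add (exp a) |>.add hr
  simp only [one_smul, add_zero] at this
  exact this.congr_of_eventuallyEq (.of_forall fun s => exp_add_smul_eq a d s)

lemma fderiv_exp_apply (a d : A) : fderiv ℝ exp a d = expD₁ a d := by
  have h := hasDerivAt_comp_add_smul (G := (exp : A → A)) a d (s := 0)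
    ((contDiff_exp_algebra (n := 1)).differentiable one_ne_zero _)
  rw [zero_smul, add_zero] at h
  exact h.unique (hasDerivAt_exp_add_smul a d)

lemma deriv_deriv_comp_add_smul {E F : Type*} [NormedAddCommGroup E] [NormedSpace ℝ E]
    [NormedAddCommGroup F] [NormedSpace ℝ F] {G : E → F} (hG : ContDiff ℝ 2 G) (a d : E) :
    deriv (deriv fun s : ℝ => G (a + s • d)) 0 = fderiv ℝ (fderiv ℝ G) a d d := by
  have h1 : (deriv fun s : ℝ => G (a + s • d)) = fun s => fderiv ℝ G (a + s • d) d := by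
    ext s
    exact (hasDerivAt_comp_add_smul a d ((hG.differentiable two_ne_zero) _)).deriv
  have h2 : Differentiable ℝ (fderiv ℝ G) :=
    (hG.fderiv_right (m := 1) (by norm_num)).differentiable one_ne_zero
  have h3 := (hasDerivAt_comp_add_smul (G := fderiv ℝ G) a d (s := 0) (h2 _)).clm_apply
    (hasDerivAt_const (0 : ℝ) d)
  rw [h1, h3.deriv]
  simp

/-- The second derivative on the diagonal is twice the second order coefficient, by comparison of
`exp_add_smul_eq` with Taylor's formula. -/
lemma fderiv_fderiv_exp_apply (a d : A) :
    fderiv ℝ (fderiv ℝ exp) a d d = (2 : ℝ) • expD₂ a d := by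
  set f : ℝ → A := fun s => exp (a + s • d) with hf
  have hfc : ContDiff ℝ 2 f := contDiff_exp_algebra.comp (by fun_prop)
  have h2 : deriv (deriv f) 0 = fderiv ℝ (fderiv ℝ exp) a d d :=
    deriv_deriv_comp_add_smul contDiff_exp_algebra a d
  have h3 : deriv f 0 = expD₁ a d := (hasDerivAt_exp_add_smul a d).deriv
  have ht := taylor_tendsto (n := 2) convex_univ (Set.mem_univ (0 : ℝ)) hfc.contDiffOn
  have hev : (fun s : ℝ => ((s - 0) ^ 2)⁻¹ • (f s - taylorWithinEval f 2 Set.univ 0 s))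
      =ᶠ[𝓝[≠] 0] fun s => expRem a d s - (2⁻¹ : ℝ) • deriv (deriv f) 0 := by
    filter_upwards [self_mem_nhdsWithin] with s hs
    have hs' : s ≠ 0 := hs
    have h4 : taylorWithinEval f 2 Set.univ 0 s
        = exp a + s • expD₁ a d + (s ^ 2 * 2⁻¹) • deriv (deriv f) 0 := by
      have hit : iteratedDerivWithin 2 f Set.univ 0 = deriv (deriv f) 0 := by
        rw [iteratedDerivWithin_univ, iteratedDeriv_succ, iteratedDeriv_one]
      have hit1 : iteratedDerivWithin 1 f Set.univ 0 = expD₁ a d := by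
        rw [iteratedDerivWithin_univ, iteratedDeriv_one, h3]
      rw [taylorWithinEval_succ, taylorWithinEval_succ, taylor_within_zero_eval, hit, hit1]
      simp only [hf, zero_smul, add_zero, sub_zero]
      norm_num
      ring_nf
    have h5 : f s = exp a + s • expD₁ a d + s ^ 2 • expRem a d s := exp_add_smul_eq a d s
    rw [h4, h5, sub_zero, show exp a + s • expD₁ a d + s ^ 2 • expRem a d s
      - (exp a + s • expD₁ a d + (s ^ 2 * 2⁻¹) • deriv (deriv f) 0)
      = s ^ 2 • (expRem a d s - (2⁻¹ : ℝ) • deriv (deriv f) 0) by module, smul_smul,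
      inv_mul_cancel₀ (pow_ne_zero 2 hs'), one_smul]
  rw [nhdsWithin_univ] at ht
  have hlim := (ht.mono_left (nhdsWithin_le_nhds (s := {0}ᶜ))).congr' hev
  have hlim2 : Tendsto (fun s => expRem a d s - (2⁻¹ : ℝ) • deriv (deriv f) 0) (𝓝[≠] 0)
      (𝓝 (expD₂ a d - (2⁻¹ : ℝ) • deriv (deriv f) 0)) := by
    rw [← expRem_zero]
    exact ((continuous_expRem a d).tendsto 0 |>.mono_left nhdsWithin_le_nhds).sub_const _
  have := tendsto_nhds_unique hlim2 hlim
  rw [sub_eq_zero] at this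
  rw [← h2, this, smul_smul]
  norm_num

end Duhamel

/-! ### The curvature functions as superpositions of exponentials -/

section CurvatureFunctions

open intervalIntegral

/-- The character `(s, t) ↦ e^{λ s + μ t}` as a function of `(λ, μ)`. -/
def expChar : Multiplicative (ℝ × ℝ) →* (ℝ × ℝ → ℝ) where
  toFun a := fun p => Real.exp (a.toAdd.1 * p.1 + a.toAdd.2 * p.2)
  map_one' := by
    ext p
    simp
  map_mul' a b := by
    ext p
    simp only [toAdd_mul, Prod.fst_add, Prod.snd_add, Pi.mul_apply, ← Real.exp_add]
    ring_nf

/-- The algebra of exponential polynomials `∑ᵢ cᵢ e^{λᵢ s + μᵢ t}` in two variables. -/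
def expPoly : Subalgebra ℝ (ℝ × ℝ → ℝ) := (AddMonoidAlgebra.lift ℝ _ _ expChar).range

lemma exp_mem_expPoly (l m : ℝ) : (fun p : ℝ × ℝ => Real.exp (l * p.1 + m * p.2)) ∈ expPoly :=
  ⟨AddMonoidAlgebra.of ℝ (ℝ × ℝ) (Multiplicative.ofAdd (l, m)), by
    simp only [AddMonoidAlgebra.of_apply]
    erw [AddMonoidAlgebra.lift_single]
    simp [expChar]⟩

lemma exists_sum_of_mem_expPoly {f : ℝ × ℝ → ℝ} (hf : f ∈ expPoly) :
    ∃ (ι : Type) (_ : Fintype ι) (c l m : ι → ℝ),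
      ∀ s t, f (s, t) = ∑ i, c i * (Real.exp (l i * s) * Real.exp (m i * t)) := by
  obtain ⟨x, rfl⟩ := hf
  refine ⟨x.coeff.support, inferInstance, fun i => x.coeff i, fun i => i.1.1, fun i => i.1.2, fun s t => ?_⟩
  erw [AddMonoidAlgebra.lift_apply]
  simp only [← Real.exp_add]
  rw [Finsupp.sum, Finset.sum_apply, ← Finset.sum_coe_sort]
  rfl

/-- The algebra of functions `G(u, (s, t))` that are smooth in `u` at `u = 0` and all of whose
`u`-derivatives at `u = 0` are exponential polynomials in `(s, t)`. -/
def jetAlgebra : Subalgebra ℝ (ℝ → ℝ × ℝ → ℝ) where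
  carrier := {G | (∀ p, ContDiffAt ℝ ∞ (fun u => G u p) 0) ∧
    ∀ N, (fun p => iteratedDeriv N (fun u => G u p) 0) ∈ expPoly}
  mul_mem' {F G} hF hG := by
    refine ⟨fun p => (hF.1 p).mul (hG.1 p), fun N => ?_⟩
    have : (fun p => iteratedDeriv N (fun u => (F * G) u p) 0)
        = ∑ i ∈ Finset.range (N + 1), (N.choose i : ℝ → ℝ × ℝ → ℝ) 0 *
          (fun p => iteratedDeriv i (fun u => F u p) 0) *
          fun p => iteratedDeriv (N - i) (fun u => G u p) 0 := by
      ext p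
      rw [Finset.sum_apply]
      exact iteratedDeriv_fun_mul ((hF.1 p).of_le (mod_cast le_top)) ((hG.1 p).of_le (mod_cast le_top))
    rw [this]
    exact sum_mem fun i _ => mul_mem (mul_mem (natCast_mem _ _) (hF.2 _)) (hG.2 _)
  add_mem' {F G} hF hG := by
    refine ⟨fun p => (hF.1 p).add (hG.1 p), fun N => ?_⟩
    have : (fun p => iteratedDeriv N (fun u => (F + G) u p) 0)
        = (fun p => iteratedDeriv N (fun u => F u p) 0) +
          fun p => iteratedDeriv N (fun u => G u p) 0 := by
      ext p
      exact iteratedDeriv_fun_add ((hF.1 p).of_le (mod_cast le_top)) ((hG.1 p).of_le (mod_cast le_top))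
    rw [this]
    exact add_mem (hF.2 _) (hG.2 _)
  algebraMap_mem' c := by
    refine ⟨fun p => contDiffAt_const, fun N => ?_⟩
    have : (fun p => iteratedDeriv N (fun u => algebraMap ℝ (ℝ → ℝ × ℝ → ℝ) c u p) 0)
        = algebraMap ℝ (ℝ × ℝ → ℝ) (if N = 0 then c else 0) := by
      ext p
      exact iteratedDeriv_const
    rw [this]
    exact Subalgebra.algebraMap_mem _ _

lemma const_mem_jetAlgebra {f : ℝ × ℝ → ℝ} (hf : f ∈ expPoly) : (fun _ => f) ∈ jetAlgebra := by
  refine ⟨fun p => contDiffAt_const, fun N => ?_⟩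
  simp only [iteratedDeriv_const]
  by_cases h : N = 0
  · simpa [h] using hf
  · simp only [h, if_false]
    exact zero_mem expPoly

lemma id_mem_jetAlgebra : (fun u _ => u) ∈ jetAlgebra := by
  refine ⟨fun p => contDiffAt_id, fun N => ?_⟩
  rcases N with _ | _ | N
  · simp only [iteratedDeriv_zero]
    exact zero_mem expPoly
  · simp only [zero_add, iteratedDeriv_one, deriv_id'']
    exact one_mem expPoly
  · have : (fun _ : ℝ × ℝ => iteratedDeriv (N + 1 + 1) (fun u : ℝ => u) 0) = 0 := by
      ext p
      rw [iteratedDeriv_succ', deriv_id'']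
      simp [iteratedDeriv_const]
    rw [this]
    exact zero_mem _

/-- The `u`-derivatives of `1 / (u - f)` at `0` are polynomials in `1 / f`. -/
lemma inv_sub_mem_jetAlgebra {f : ℝ × ℝ → ℝ} (h0 : ∀ p, f p ≠ 0) (hf : f⁻¹ ∈ expPoly) :
    (fun u p => (u - f p)⁻¹) ∈ jetAlgebra := by
  refine ⟨fun p => ?_, fun N => ?_⟩
  · exact (contDiffAt_id.sub contDiffAt_const).inv (by simpa using h0 p)
  · have : (fun p => iteratedDeriv N (fun u => (u - f p)⁻¹) 0)
        = ((-1) ^ N * (N ! : ℝ → ℝ × ℝ → ℝ) 0) * (-f⁻¹) ^ (N + 1) := by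
      ext p
      have h1 := congr_fun (iteratedDeriv_comp_sub_const N (Inv.inv : ℝ → ℝ) (f p)) 0
      refine h1.trans ?_
      rw [iteratedDeriv_eq_iterate, iter_deriv_inv]
      have h2 : (-1 - N : ℤ) = -((N + 1 : ℕ) : ℤ) := by
        push_cast
        ring
      rw [h2, zpow_neg, zpow_natCast, ← inv_pow, zero_sub, inv_neg]
      rfl
    rw [this]
    exact mul_mem (mul_mem (pow_mem (neg_mem (one_mem _)) _) (natCast_mem _ _))
      (pow_mem (neg_mem hf) _)

lemma exp_half_fst_mem : (fun p : ℝ × ℝ => Real.exp (p.1 / 2)) ∈ expPoly := by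
  convert exp_mem_expPoly (1 / 2) 0 using 3
  ring

lemma exp_half_snd_mem : (fun p : ℝ × ℝ => Real.exp (p.2 / 2)) ∈ expPoly := by
  convert exp_mem_expPoly 0 (1 / 2) using 3
  ring

lemma exp_fst_inv_mem : (fun p : ℝ × ℝ => Real.exp p.1)⁻¹ ∈ expPoly := by
  convert exp_mem_expPoly (-1) 0 using 1
  ext p
  simp [Real.exp_neg]

lemma exp_add_inv_mem : (fun p : ℝ × ℝ => Real.exp p.1 * Real.exp p.2)⁻¹ ∈ expPoly := by
  convert exp_mem_expPoly (-1) (-1) using 1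
  ext p
  simp [← Real.exp_add, ← Real.exp_neg]
  ring

lemma sqrt_exp (s : ℝ) : √(Real.exp s) = Real.exp (s / 2) := by
  rw [Real.exp_half]

lemma inv_sub_one_mem_jetAlgebra : (fun (u : ℝ) (_ : ℝ × ℝ) => (u - 1)⁻¹) ∈ jetAlgebra :=
  inv_sub_mem_jetAlgebra (f := 1) (fun _ => one_ne_zero) (by rw [inv_one]; exact one_mem _)

/-- In the variable `log s`, the function `F(u, s, m)` is a polynomial in `u`, `√s`, `(u - 1)⁻¹` and
`(u - s)⁻¹`, all of which have exponential polynomials as `u`-derivatives at `0`. -/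
lemma curvK_mem_expPoly (m : ℕ) : (fun p : ℝ × ℝ => curvK m (Real.exp p.1)) ∈ expPoly := by
  set U : ℝ → ℝ × ℝ → ℝ := fun u _ => u with hU
  set S : ℝ → ℝ × ℝ → ℝ := fun _ p => Real.exp (p.1 / 2) with hS
  set V : ℝ → ℝ × ℝ → ℝ := fun u _ => (u - 1)⁻¹ with hV
  set W : ℝ → ℝ × ℝ → ℝ := fun u p => (u - Real.exp p.1)⁻¹ with hW
  have mU : U ∈ jetAlgebra := id_mem_jetAlgebra
  have mS : S ∈ jetAlgebra := const_mem_jetAlgebra exp_half_fst_mem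
  have mV : V ∈ jetAlgebra := inv_sub_one_mem_jetAlgebra
  have mW : W ∈ jetAlgebra := inv_sub_mem_jetAlgebra (fun _ => (Real.exp_pos _).ne') exp_fst_inv_mem
  have mC (c : ℝ) : algebraMap ℝ (ℝ → ℝ × ℝ → ℝ) c ∈ jetAlgebra := Subalgebra.algebraMap_mem _ c
  have h : (algebraMap ℝ _ (m : ℝ) * (S + 1) * (U - 1)
      + algebraMap ℝ _ (2 : ℝ) * (algebraMap ℝ _ (2 : ℝ) * S + U + 1))
      * (algebraMap ℝ _ ((m : ℝ)⁻¹) * V ^ 3 * W) ∈ jetAlgebra := by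
    clear_value U S V W
    repeat' first
      | assumption
      | exact mC _
      | exact one_mem _
      | refine Subalgebra.sub_mem _ ?_ ?_
      | refine Subalgebra.add_mem _ ?_ ?_
      | refine Subalgebra.mul_mem _ ?_ ?_
  convert h.2 ((m - 4) / 2) using 4 with p
  simp only [curvK]
  congr 1
  ext u
  simp only [genF, sqrt_exp, hU, hS, hV, hW, Pi.add_apply, Pi.mul_apply, Pi.sub_apply, Pi.pow_apply,
    Pi.one_apply, Pi.algebraMap_apply, Algebra.algebraMap_self, RingHom.id_apply, div_eq_mul_inv,
    mul_inv, inv_pow]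

/-- In the variables `log s` and `log t`, the function `G(u, s, t, m)` is a polynomial in `u`, `√s`, `√t`,
`(u - 1)⁻¹`, `(u - s)⁻¹` and `(u - s t)⁻¹`. -/
lemma curvH_mem_expPoly (m : ℕ) :
    (fun p : ℝ × ℝ => curvH m (Real.exp p.1) (Real.exp p.2)) ∈ expPoly := by
  set U : ℝ → ℝ × ℝ → ℝ := fun u _ => u with hU
  set S : ℝ → ℝ × ℝ → ℝ := fun _ p => Real.exp (p.1 / 2) with hS
  set T : ℝ → ℝ × ℝ → ℝ := fun _ p => Real.exp (p.2 / 2) with hT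
  set V : ℝ → ℝ × ℝ → ℝ := fun u _ => (u - 1)⁻¹ with hV
  set W : ℝ → ℝ × ℝ → ℝ := fun u p => (u - Real.exp p.1)⁻¹ with hW
  set Z : ℝ → ℝ × ℝ → ℝ := fun u p => (u - Real.exp p.1 * Real.exp p.2)⁻¹ with hZ
  have mU : U ∈ jetAlgebra := id_mem_jetAlgebra
  have mS : S ∈ jetAlgebra := const_mem_jetAlgebra exp_half_fst_mem
  have mT : T ∈ jetAlgebra := const_mem_jetAlgebra exp_half_snd_mem
  have mV : V ∈ jetAlgebra := inv_sub_one_mem_jetAlgebra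
  have mW : W ∈ jetAlgebra := inv_sub_mem_jetAlgebra (fun _ => (Real.exp_pos _).ne') exp_fst_inv_mem
  have mZ : Z ∈ jetAlgebra := inv_sub_mem_jetAlgebra
    (fun _ => mul_ne_zero (Real.exp_pos _).ne' (Real.exp_pos _).ne') exp_add_inv_mem
  let C : ℝ → (ℝ → ℝ × ℝ → ℝ) := algebraMap ℝ (ℝ → ℝ × ℝ → ℝ)
  have mC (c : ℝ) : C c ∈ jetAlgebra := Subalgebra.algebraMap_mem _ c
  have h : (S ^ 3 * (C m * ((C 2 * S + 1) * T + C 2) - C 4 * ((C 2 * S + 1) * T + 1))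
      + U ^ 2 * (C 2 * (S ^ 2 + C 2 * S + C 3) * (S * T + 1)
        - C m * (S ^ 3 * T - C 2 * S ^ 2 * (T - 1) - C 2 * S + C 2))
      - U * S * (S ^ 2 * (C 6 * T + C 4) + S * (C 10 - C 4 * T) - C 2 * (T + 1)
        + C m * (C 2 * S ^ 3 * T + C 2 * S * (T - 1) + C 2 * S ^ 2 + T + C 2))
      + U ^ 3 * (C m * S * T + C 2 * C m + C 2 * S + C 2))
      * (C ((m : ℝ)⁻¹) * V ^ 3 * W ^ 2 * Z) ∈ jetAlgebra := by
    clear_value U S T V W Z C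
    repeat' first
      | assumption
      | exact mC _
      | exact one_mem _
      | refine Subalgebra.sub_mem _ ?_ ?_
      | refine Subalgebra.add_mem _ ?_ ?_
      | refine Subalgebra.mul_mem _ ?_ ?_
  convert h.2 ((m - 4) / 2) using 4 with p
  simp only [curvH]
  congr 1
  ext u
  have hs : Real.exp (p.1 * 2⁻¹) ^ 2 = Real.exp p.1 := by
    rw [← Real.exp_nat_mul]
    congr 1
    push_cast
    ring
  simp only [genG, sqrt_exp, C, hU, hS, hT, hV, hW, hZ, Pi.add_apply, Pi.mul_apply, Pi.sub_apply,
    Pi.pow_apply, Pi.one_apply, Pi.algebraMap_apply, Algebra.algebraMap_self, RingHom.id_apply,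
    div_eq_mul_inv, mul_inv, inv_pow, hs]

lemma f₁_eq_integral (s : ℝ) : f₁ s = ∫ v in (0 : ℝ)..1, Real.exp (v * s) := by
  rw [f₁]
  split_ifs with h
  · simp [h]
  · rw [integral_comp_mul_right (fun x => Real.exp x) h, integral_exp]
    simp [div_eq_inv_mul]

/-- The integral representation of the divided difference; at `t = 0`, where `g₂` is defined by a
derivative, it follows from the continuity of the integral. -/
lemma g₂_eq_integral (s t : ℝ) :
    g₂ s t = ∫ v in (0 : ℝ)..1, ∫ w in (0 : ℝ)..1, v * (Real.exp (v * s) * Real.exp (v * w * t)) := by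
  set J : ℝ → ℝ := fun t => ∫ v in (0 : ℝ)..1, ∫ w in (0 : ℝ)..1,
    v * (Real.exp (v * s) * Real.exp (v * w * t)) with hJ
  have hJc : Continuous J := by
    refine continuous_parametric_intervalIntegral_of_continuous' ?_ 0 1
    refine continuous_parametric_intervalIntegral_of_continuous'
      (f := fun (p : ℝ × ℝ) w => p.2 * (Real.exp (p.2 * s) * Real.exp (p.2 * w * p.1))) ?_ 0 1
    fun_prop
  have hd (t : ℝ) : f₁ (s + t) - f₁ s = t * J t := by
    have h1 (v : ℝ) : t * ∫ w in (0 : ℝ)..1, v * (Real.exp (v * s) * Real.exp (v * w * t))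
        = Real.exp (v * (s + t)) - Real.exp (v * s) := by
      have h2 := (f₁_eq_integral (v * t)).symm
      have h3 : v * t * f₁ (v * t) = Real.exp (v * t) - 1 := by
        rw [f₁]
        split_ifs with h
        · simp [h]
        · rw [mul_div_cancel₀ _ h]
      have h4 : (∫ w in (0 : ℝ)..1, Real.exp (v * w * t)) = f₁ (v * t) := by
        rw [← h2]
        refine integral_congr fun w _ => ?_
        ring_nf
      rw [integral_const_mul, integral_const_mul, h4, mul_add v s t, Real.exp_add]
      linear_combination Real.exp (v * s) * h3
    have hi (c : ℝ) : IntervalIntegrable (fun v : ℝ => Real.exp (v * c)) MeasureTheory.volume 0 1 :=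
      Continuous.intervalIntegrable (by fun_prop) 0 1
    rw [f₁_eq_integral, f₁_eq_integral, ← integral_sub (hi _) (hi _), hJ, ← integral_const_mul]
    exact integral_congr fun v _ => (h1 v).symm
  change _ = J t
  rw [g₂]
  split_ifs with h
  · refine HasDerivAt.deriv ?_
    rw [hasDerivAt_iff_tendsto_slope_zero, h]
    refine (hJc.tendsto 0).mono_left nhdsWithin_le_nhds |>.congr' ?_
    filter_upwards [self_mem_nhdsWithin] with t ht
    rw [hd, smul_eq_mul, inv_mul_cancel_left₀ ht]
  · rw [hd, mul_div_cancel_left₀ _ h]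

end CurvatureFunctions

/-! ### The second covariant derivative in a chart -/

section Chart

variable {m : ℕ} {M : Type*} [TopologicalSpace M] [ChartedSpace (EuclideanSpace ℝ (Fin m)) M]
  {G : Type*} [NormedAddCommGroup G] [NormedSpace ℝ G]

/-- The expression of a function on `M` in the preferred chart at `x`. -/
def inChart (x : M) (f : M → G) : EuclideanSpace ℝ (Fin m) → G := f ∘ (extChartAt (𝓡 m) x).symm

variable [IsManifold (𝓡 m) ∞ M]

variable (m) in
/-- The coordinates, in the preferred chart at `x`, of a tangent vector at a point `y` near `x`. -/
def coords (x : M) {y : M} (w : TangentSpace (𝓡 m) y) : EuclideanSpace ℝ (Fin m) :=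
  (trivializationAt (EuclideanSpace ℝ (Fin m)) (TangentSpace (𝓡 m)) x ⟨y, w⟩).2

lemma one_le_infty : (1 : ℕ∞ω) ≤ ∞ := mod_cast le_top

lemma two_le_infty : (2 : ℕ∞ω) ≤ ∞ := WithTop.coe_le_coe.2 (le_top : (2 : ℕ∞) ≤ ⊤)

lemma contDiffAt_inChart {n : ℕ∞ω} (hn : n ≤ ∞) {x y : M} {f : M → G}
    (hf : ContMDiffAt (𝓡 m) 𝓘(ℝ, G) n f y) (hy : y ∈ (chartAt (EuclideanSpace ℝ (Fin m)) x).source) :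
    ContDiffAt ℝ n (inChart x f) (extChartAt (𝓡 m) x y) := by
  have hy' : y ∈ (extChartAt (𝓡 m) x).source := by rwa [extChartAt_source]
  rw [← contMDiffAt_iff_contDiffAt]
  refine ContMDiffAt.comp (I' := 𝓡 m) _ ?_ ?_
  · rwa [(extChartAt (𝓡 m) x).left_inv hy']
  · exact ((contMDiffOn_extChartAt_symm (n := ∞) x).of_le hn).contMDiffAt
      ((isOpen_extChartAt_target x).mem_nhds ((extChartAt (𝓡 m) x).map_source hy'))

lemma mfderiv_extChartAt_eq_coords {x y : M} (w : TangentSpace (𝓡 m) y)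
    (hy : y ∈ (chartAt (EuclideanSpace ℝ (Fin m)) x).source) :
    mfderiv (𝓡 m) 𝓘(ℝ, EuclideanSpace ℝ (Fin m)) (extChartAt (𝓡 m) x) y w = coords m x w := by
  have h := congr_arg (fun L => L w)
    (TangentBundle.continuousLinearMapAt_trivializationAt (I := 𝓡 m) hy)
  refine h.symm.trans ?_
  exact congr_fun (Trivialization.coe_linearMapAt_of_mem _ (by simpa using hy)) w

lemma mvfderiv_comp_extChartAt {x y : M} {F : EuclideanSpace ℝ (Fin m) → G}
    (hy : y ∈ (chartAt (EuclideanSpace ℝ (Fin m)) x).source)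
    (hF : DifferentiableAt ℝ F (extChartAt (𝓡 m) x y)) (w : TangentSpace (𝓡 m) y) :
    mvfderiv (𝓡 m) (fun z => F (extChartAt (𝓡 m) x z)) y w
      = fderiv ℝ F (extChartAt (𝓡 m) x y) (coords m x w) := by
  rw [← mfderiv_extChartAt_eq_coords w hy, ← mfderiv_eq_fderiv]
  exact mfderiv_comp_apply (I' := 𝓘(ℝ, EuclideanSpace ℝ (Fin m))) y hF.mdifferentiableAt
    ((contMDiffAt_extChartAt' (n := ∞) hy).mdifferentiableAt (by simp)) w

omit [NormedAddCommGroup G] [NormedSpace ℝ G] [IsManifold (𝓡 m) ∞ M] in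
lemma eventuallyEq_inChart_comp {x y : M} (f : M → G)
    (hy : y ∈ (chartAt (EuclideanSpace ℝ (Fin m)) x).source) :
    f =ᶠ[nhds y] fun z => inChart x f (extChartAt (𝓡 m) x z) := by
  have hy' : y ∈ (extChartAt (𝓡 m) x).source := by rwa [extChartAt_source]
  filter_upwards [extChartAt_source_mem_nhds' (I := 𝓡 m) hy'] with z hz
  rw [inChart, Function.comp_apply, (extChartAt (𝓡 m) x).left_inv hz]

lemma mvfderiv_eq_fderiv_inChart {x y : M} {f : M → G} (hf : ContMDiffAt (𝓡 m) 𝓘(ℝ, G) 1 f y)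
    (hy : y ∈ (chartAt (EuclideanSpace ℝ (Fin m)) x).source) (w : TangentSpace (𝓡 m) y) :
    mvfderiv (𝓡 m) f y w = fderiv ℝ (inChart x f) (extChartAt (𝓡 m) x y) (coords m x w) := by
  rw [← mvfderiv_comp_extChartAt hy ((contDiffAt_inChart one_le_infty hf hy).differentiableAt one_ne_zero)]
  congr 1
  exact (eventuallyEq_inChart_comp f hy).mfderiv_eq

lemma coords_extend {x y : M} (hy : y ∈ (chartAt (EuclideanSpace ℝ (Fin m)) x).source)
    (v : TangentSpace (𝓡 m) x) :
    coords m x (FiberBundle.extend (EuclideanSpace ℝ (Fin m)) v y) = coords m x v := by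
  rw [coords, FiberBundle.extend, Trivialization.apply_mk_symm _ (by simpa using hy)]
  rfl

variable (m) in
omit [IsManifold (𝓡 m) ∞ M] in
lemma eventually_mem_chartAt_source (x : M) :
    ∀ᶠ y in nhds x, y ∈ (chartAt (EuclideanSpace ℝ (Fin m)) x).source :=
  (chartAt _ x).open_source.mem_nhds (mem_chart_source _ x)

lemma eventually_mvfderiv_eq {f : M → G} (hf : ContMDiff (𝓡 m) 𝓘(ℝ, G) 2 f)
    (x : M) (W : ∀ y : M, TangentSpace (𝓡 m) y) :
    (fun y => mvfderiv (𝓡 m) f y (W y)) =ᶠ[nhds x]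
      fun y => fderiv ℝ (inChart x f) (extChartAt (𝓡 m) x y) (coords m x (y := y) (W y)) := by
  filter_upwards [eventually_mem_chartAt_source m x] with y hy
  exact mvfderiv_eq_fderiv_inChart ((hf y).of_le (by norm_num)) hy (W y)

lemma mdifferentiableAt_mvfderiv_apply {f : M → G} (hf : ContMDiff (𝓡 m) 𝓘(ℝ, G) 2 f)
    {x : M} {W : ∀ y : M, TangentSpace (𝓡 m) y}
    (hW : MDifferentiableAt (𝓡 m) ((𝓡 m).prod 𝓘(ℝ, EuclideanSpace ℝ (Fin m)))
      (fun y => (⟨y, W y⟩ : TotalSpace (EuclideanSpace ℝ (Fin m)) (TangentSpace (𝓡 m)))) x) :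
    MDifferentiableAt (𝓡 m) 𝓘(ℝ, G) (fun y => mvfderiv (𝓡 m) f y (W y)) x := by
  refine MDifferentiableAt.congr_of_eventuallyEq ?_ (eventually_mvfderiv_eq hf x W)
  refine MDifferentiableAt.clm_apply ?_ ((mdifferentiableAt_section _ _).1 hW)
  have h1 := (contDiffAt_inChart two_le_infty (hf x) (mem_chart_source _ x)).fderiv_right
    (m := 1) (by norm_num)
  exact MDifferentiableAt.comp (I' := 𝓘(ℝ, EuclideanSpace ℝ (Fin m))) x
    (h1.differentiableAt one_ne_zero).mdifferentiableAt
    ((contMDiffAt_extChartAt (n := ∞)).mdifferentiableAt (by simp))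

/-- The second covariant derivative is given, in the preferred chart at `x`, by the second
derivative of the function, corrected by the Christoffel symbols. -/
lemma hessian_eq_inChart
    (cov : CovariantDerivative (𝓡 m) (EuclideanSpace ℝ (Fin m))
      (TangentSpace (𝓡 m) : M → Type _))
    {f : M → ℂ} (hf : ContMDiff (𝓡 m) 𝓘(ℝ, ℂ) 2 f) (ξ : TwoVec m M) :
    hessian cov f ξ =
      fderiv ℝ (fderiv ℝ (inChart ξ.1 f)) (extChartAt (𝓡 m) ξ.1 ξ.1)
          (coords m ξ.1 ξ.2.1) (coords m ξ.1 ξ.2.2)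
        - fderiv ℝ (inChart ξ.1 f) (extChartAt (𝓡 m) ξ.1 ξ.1)
          (coords m ξ.1 (cov (FiberBundle.extend (EuclideanSpace ℝ (Fin m)) ξ.2.2) ξ.1 ξ.2.1)) := by
  obtain ⟨x, u, v⟩ := ξ
  have hx := mem_chart_source (EuclideanSpace ℝ (Fin m)) x
  have h1 := (contDiffAt_inChart two_le_infty (hf x) hx).fderiv_right (m := 1) (by norm_num)
  have h2 := h1.differentiableAt one_ne_zero
  rw [hessian, mvfderiv_eq_fderiv_inChart ((hf x).of_le (by norm_num)) hx]
  congr 1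
  have h3 : (fun y => mvfderiv (𝓡 m) f y (FiberBundle.extend (EuclideanSpace ℝ (Fin m)) v y))
      =ᶠ[nhds x] fun y => (fun p => fderiv ℝ (inChart x f) p (coords m x v))
        (extChartAt (𝓡 m) x y) := by
    filter_upwards [eventually_mvfderiv_eq hf x
      (FiberBundle.extend (EuclideanSpace ℝ (Fin m)) v), eventually_mem_chartAt_source m x]
      with y hy hy'
    rw [hy, coords_extend hy']
  have h4 : mvfderiv (𝓡 m) (fun y => mvfderiv (𝓡 m) f y
      (FiberBundle.extend (EuclideanSpace ℝ (Fin m)) v y)) x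
      = mvfderiv (𝓡 m) (fun y => (fun p => fderiv ℝ (inChart x f) p (coords m x v))
        (extChartAt (𝓡 m) x y)) x := h3.mfderiv_eq
  refine (congr_arg (fun L => L u) h4).trans ?_
  refine (mvfderiv_comp_extChartAt
    (F := fun p => fderiv ℝ (inChart x f) p (coords m x v)) hx (by fun_prop) u).trans ?_
  rw [fderiv_clm_apply h2 (by fun_prop)]
  simp

end Chart

/-! ### Invariance of the second covariant derivative under isometries -/

section Isometry

variable {m : ℕ} {M : Type*} [TopologicalSpace M] [ChartedSpace (EuclideanSpace ℝ (Fin m)) M]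
  [IsManifold (𝓡 m) ∞ M]

/-- Differentiability at a point of a vector field. -/
def VFDiffAt (V : ∀ y : M, TangentSpace (𝓡 m) y) (x : M) : Prop :=
  MDifferentiableAt (𝓡 m) ((𝓡 m).prod 𝓘(ℝ, EuclideanSpace ℝ (Fin m)))
    (fun y => (⟨y, V y⟩ : TotalSpace (EuclideanSpace ℝ (Fin m)) (TangentSpace (𝓡 m)))) x

lemma vfDiffAt_extend {x : M} (v : TangentSpace (𝓡 m) x) :
    VFDiffAt (FiberBundle.extend (EuclideanSpace ℝ (Fin m)) v) x :=
  FiberBundle.mdifferentiableAt_extend (𝓡 m) (EuclideanSpace ℝ (Fin m)) v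

/-- For a fixed direction `u`, the expression `u(V f) - (∇_u V) f` depends only on the value of
the vector field `V` at the point. -/
lemma tensorialAt_hessian
    (cov : CovariantDerivative (𝓡 m) (EuclideanSpace ℝ (Fin m))
      (TangentSpace (𝓡 m) : M → Type _))
    {f : M → ℂ} (hf : ContMDiff (𝓡 m) 𝓘(ℝ, ℂ) 2 f) {x : M} (u : TangentSpace (𝓡 m) x) :
    TensorialAt (𝓡 m) (EuclideanSpace ℝ (Fin m))
      (fun V : ∀ y : M, TangentSpace (𝓡 m) y =>
        mvfderiv (𝓡 m) (fun y => mvfderiv (𝓡 m) f y (V y)) x u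
          - mvfderiv (𝓡 m) f x (cov V x u)) x where
  smul {g V} hg hV := by
    have h1 := mdifferentiableAt_mvfderiv_apply hf hV
    have h2 : (fun y => mvfderiv (𝓡 m) f y ((g • V) y))
        = g • fun y => mvfderiv (𝓡 m) f y (V y) := by
      ext y
      exact map_smul (mvfderiv (𝓡 m) f y) (g y) (V y)
    rw [h2, mvfderiv_smul hg h1, cov.isCovariantDerivativeOnUniv.leibniz hV hg]
    simp only [add_apply, smul_apply, ContinuousLinearMap.smulRight_apply, map_add, map_smul]
    module
  add {V W} hV hW := by
    have h1 := mdifferentiableAt_mvfderiv_apply hf hV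
    have h2 := mdifferentiableAt_mvfderiv_apply hf hW
    have h3 : (fun y => mvfderiv (𝓡 m) f y ((V + W) y))
        = (fun y => mvfderiv (𝓡 m) f y (V y)) + fun y => mvfderiv (𝓡 m) f y (W y) := by
      ext y
      exact map_add (mvfderiv (𝓡 m) f y) (V y) (W y)
    rw [h3, mvfderiv_add h1 h2, cov.isCovariantDerivativeOnUniv.add hV hW]
    simp only [add_apply, map_add]
    abel

variable {τ κ : M → M}

omit [IsManifold (𝓡 m) ∞ M] in
lemma mfderiv_mfderiv_inverse (hτ : ContMDiff (𝓡 m) (𝓡 m) ∞ τ) (hκ : ContMDiff (𝓡 m) (𝓡 m) ∞ κ)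
    (hr : ∀ x, τ (κ x) = x) {x y : M} (hxy : κ y = x) (z : TangentSpace (𝓡 m) y) :
    mfderiv (𝓡 m) (𝓡 m) τ x (mfderiv (𝓡 m) (𝓡 m) κ y z) = z := by
  have h := mfderiv_comp_apply_of_eq (I := 𝓡 m) (I' := 𝓡 m) (I'' := 𝓡 m) (x := y) (g := τ) (f := κ)
    ((hτ x).mdifferentiableAt (by simp)) ((hκ y).mdifferentiableAt (by simp)) hxy z
  refine h.symm.trans ?_
  have h2 : τ ∘ κ = id := funext hr
  exact congr_arg (fun F : M → M => (mfderiv (𝓡 m) (𝓡 m) F y z : EuclideanSpace ℝ (Fin m))) h2 |>.trans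
    (congr_arg (fun L => L z) (mfderiv_id (I := 𝓡 m) (x := y)))

omit [IsManifold (𝓡 m) ∞ M] in
lemma mpullback_apply_of_inverse (hτ : ContMDiff (𝓡 m) (𝓡 m) ∞ τ) (hκ : ContMDiff (𝓡 m) (𝓡 m) ∞ κ)
    (hl : ∀ x, κ (τ x) = x) (hr : ∀ x, τ (κ x) = x) (V : ∀ y : M, TangentSpace (𝓡 m) y) (y : M) :
    VectorField.mpullback (𝓡 m) (𝓡 m) κ V (τ y) = mfderiv (𝓡 m) (𝓡 m) τ y (V y) := by
  have hinv : (mfderiv (𝓡 m) (𝓡 m) κ (τ y)).inverse = mfderiv (𝓡 m) (𝓡 m) τ y := by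
    refine ContinuousLinearMap.inverse_eq ?_ ?_
    · ext1 z
      exact mfderiv_mfderiv_inverse hκ hτ hl (y := y) rfl z
    · ext1 z
      exact mfderiv_mfderiv_inverse hτ hκ hr (hl y) z
  have h1 : (V (κ (τ y)) : EuclideanSpace ℝ (Fin m)) = V y :=
    congr_arg (fun z => (V z : EuclideanSpace ℝ (Fin m))) (hl y)
  rw [VectorField.mpullback_apply]
  refine (congr_arg (fun L => L (V (κ (τ y)))) hinv).trans ?_
  exact congr_arg (fun z : EuclideanSpace ℝ (Fin m) => mfderiv (𝓡 m) (𝓡 m) τ y z) h1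

lemma vfDiffAt_mpullback (hτ : ContMDiff (𝓡 m) (𝓡 m) ∞ τ) (hκ : ContMDiff (𝓡 m) (𝓡 m) ∞ κ)
    (hl : ∀ x, κ (τ x) = x) (hr : ∀ x, τ (κ x) = x) {V : ∀ y : M, TangentSpace (𝓡 m) y} {x : M}
    (hV : VFDiffAt V x) : VFDiffAt (VectorField.mpullback (𝓡 m) (𝓡 m) κ V) (τ x) := by
  refine MDifferentiableAt.mpullback_vectorField (n := ∞) ?_ (hκ _) ?_ two_le_infty
  · rwa [hl]
  · exact ContinuousLinearMap.IsInvertible.of_inverse (g := mfderiv (𝓡 m) (𝓡 m) τ x)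
      (by ext1 z; exact mfderiv_mfderiv_inverse hκ hτ hl (y := x) rfl z)
      (by ext1 z; exact mfderiv_mfderiv_inverse hτ hκ hr (hl x) z)

variable [RiemannianBundle (fun x : M => TangentSpace (𝓡 m) x)]
  [IsContMDiffRiemannianBundle (𝓡 m) ∞ (EuclideanSpace ℝ (Fin m))
    (fun x : M => TangentSpace (𝓡 m) x)]

set_option synthInstance.maxHeartbeats 400000 in
set_option maxHeartbeats 1000000 in
/-- An isometry preserves the Levi-Civita connection: the difference of the connection and its
push-forward is symmetric because both are torsion-free, and skew because both are metric; hence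
it vanishes. -/
lemma IsLeviCivita.mfderiv_cov {cov : CovariantDerivative (𝓡 m) (EuclideanSpace ℝ (Fin m))
      (TangentSpace (𝓡 m) : M → Type _)} (hcov : IsLeviCivita cov)
    (hτ : ContMDiff (𝓡 m) (𝓡 m) ∞ τ) (hκ : ContMDiff (𝓡 m) (𝓡 m) ∞ κ)
    (hl : ∀ x, κ (τ x) = x) (hr : ∀ x, τ (κ x) = x)
    (hiso : ∀ (x : M) (u v : TangentSpace (𝓡 m) x),
      inner ℝ (mfderiv (𝓡 m) (𝓡 m) τ x u) (mfderiv (𝓡 m) (𝓡 m) τ x v) = inner ℝ u v)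
    {x : M} (u v : TangentSpace (𝓡 m) x) :
    mfderiv (𝓡 m) (𝓡 m) τ x (cov (FiberBundle.extend (EuclideanSpace ℝ (Fin m)) v) x u)
      = cov (VectorField.mpullback (𝓡 m) (𝓡 m) κ (FiberBundle.extend (EuclideanSpace ℝ (Fin m)) v))
          (τ x) (mfderiv (𝓡 m) (𝓡 m) τ x u) := by
  obtain ⟨hmet, htor⟩ := hcov
  rw [CovariantDerivative.torsion_eq_zero_iff] at htor
  set dτ := mfderiv (𝓡 m) (𝓡 m) τ x with hdτ
  set e : TangentSpace (𝓡 m) x → ∀ y : M, TangentSpace (𝓡 m) y :=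
    fun v => FiberBundle.extend (EuclideanSpace ℝ (Fin m)) v with he
  set P : (∀ y : M, TangentSpace (𝓡 m) y) → ∀ y : M, TangentSpace (𝓡 m) y :=
    fun V => VectorField.mpullback (𝓡 m) (𝓡 m) κ V with hP
  have hPx (V) (y : M) : P V (τ y) = mfderiv (𝓡 m) (𝓡 m) τ y (V y) :=
    mpullback_apply_of_inverse hτ hκ hl hr V y
  have hev (v) : e v x = v := FiberBundle.extend_apply_self _ v
  have hed (v) : VFDiffAt (e v) x := vfDiffAt_extend v
  have hPd (v) : VFDiffAt (P (e v)) (τ x) := vfDiffAt_mpullback hτ hκ hl hr (hed v)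
  have hPev (v) : P (e v) (τ x) = dτ v := by rw [hPx, hev]
  let D (v u : TangentSpace (𝓡 m) x) : TangentSpace (𝓡 m) (τ x) :=
    dτ (cov (e v) x u) - cov (P (e v)) (τ x) (dτ u)
  have : IsManifold (𝓡 m) (minSmoothness ℝ 2) M := by
    rw [minSmoothness_of_isRCLikeNormedField]
    infer_instance
  have hsymm (v w) : D v w = D w v := by
    have h1 := htor (hed w) (hed v)
    have h2 := htor (hPd w) (hPd v)
    have h3 : VectorField.mlieBracket (𝓡 m) (P (e w)) (P (e v)) (τ x)
        = dτ (VectorField.mlieBracket (𝓡 m) (e w) (e v) x) := by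
      rw [← hPx (VectorField.mlieBracket (𝓡 m) (e w) (e v)) x]
      refine (VectorField.mpullback_mlieBracket (n := ∞) ?_ ?_ (hκ _) ?_).symm
      · rw [hl]; exact hed w
      · rw [hl]; exact hed v
      · rw [minSmoothness_of_isRCLikeNormedField]; exact two_le_infty
    rw [h3, ← h1, hPev, hPev, hev, hev, map_sub] at h2
    simp only [D]
    rw [sub_eq_sub_iff_sub_eq_sub]
    exact h2.symm
  have : IsContMDiffRiemannianBundle (𝓡 m) 1 (EuclideanSpace ℝ (Fin m))
      (fun x : M => TangentSpace (𝓡 m) x) :=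
    IsContMDiffRiemannianBundle.of_le (n := ∞) one_le_infty
  have hskew (u v w) : inner ℝ (D v u) (dτ w) = - inner ℝ (D w u) (dτ v) := by
    have h1 := hmet.mvfderiv_inner_eq (e u) (hed v) (hed w)
    have h2 := hmet.mvfderiv_inner_eq (P (e u)) (hPd v) (hPd w)
    have h3 : (fun y => inner ℝ (e v y) (e w y))
        = (fun y => inner ℝ (P (e v) y) (P (e w) y)) ∘ τ := by
      ext y
      simp only [Function.comp_apply, hPx, hiso]
    have h4 := mvfderiv_comp_apply (I := 𝓡 m) (I' := 𝓡 m) (f := τ)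
      (g := fun y => inner ℝ (P (e v) y) (P (e w) y)) x ((hPd v).inner_bundle (hPd w))
      ((hτ x).mdifferentiableAt (by simp)) u
    rw [← h3] at h4
    rw [hev] at h1
    rw [hPev] at h2
    rw [← hdτ, h1, h2] at h4
    simp only [hev, hPev] at h4
    simp only [D, inner_sub_left, hdτ, hiso]
    rw [hdτ] at h4
    rw [real_inner_comm v, real_inner_comm (mfderiv (𝓡 m) (𝓡 m) τ x v)]
    linear_combination h4
  -- A trilinear form that is symmetric in its first two arguments and skew in the first and the third
  -- vanishes.
  have hzero (a b c) : inner ℝ (D a b) (dτ c) = 0 := by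
    have h : inner ℝ (D a b) (dτ c) = - inner ℝ (D a b) (dτ c) :=
      calc inner ℝ (D a b) (dτ c) = inner ℝ (D b a) (dτ c) := by rw [hsymm]
        _ = - inner ℝ (D c a) (dτ b) := hskew _ _ _
        _ = - inner ℝ (D a c) (dτ b) := by rw [hsymm]
        _ = inner ℝ (D b c) (dτ a) := by rw [hskew, neg_neg]
        _ = inner ℝ (D c b) (dτ a) := by rw [hsymm]
        _ = - inner ℝ (D a b) (dτ c) := hskew _ _ _
    linarith
  have hD : D v u = 0 := by
    have h := hzero v u (mfderiv (𝓡 m) (𝓡 m) κ (τ x) (D v u))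
    rw [hdτ, mfderiv_mfderiv_inverse hτ hκ hr (hl x)] at h
    exact inner_self_eq_zero.1 h
  exact sub_eq_zero.1 hD

/-- Invariance of the second covariant derivative under an isometry. -/
lemma IsLeviCivita.hessian_comp {cov : CovariantDerivative (𝓡 m) (EuclideanSpace ℝ (Fin m))
      (TangentSpace (𝓡 m) : M → Type _)} (hcov : IsLeviCivita cov)
    (hτ : ContMDiff (𝓡 m) (𝓡 m) ∞ τ) (hκ : ContMDiff (𝓡 m) (𝓡 m) ∞ κ)
    (hl : ∀ x, κ (τ x) = x) (hr : ∀ x, τ (κ x) = x)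
    (hiso : ∀ (x : M) (u v : TangentSpace (𝓡 m) x),
      inner ℝ (mfderiv (𝓡 m) (𝓡 m) τ x u) (mfderiv (𝓡 m) (𝓡 m) τ x v) = inner ℝ u v)
    {f : M → ℂ} (hf : ContMDiff (𝓡 m) 𝓘(ℝ, ℂ) 2 f) (x : M) (u v : TangentSpace (𝓡 m) x) :
    hessian cov (fun y => f (τ y)) ⟨x, u, v⟩
      = hessian cov f ⟨τ x, mfderiv (𝓡 m) (𝓡 m) τ x u, mfderiv (𝓡 m) (𝓡 m) τ x v⟩ := by
  set V : ∀ y : M, TangentSpace (𝓡 m) y := FiberBundle.extend (EuclideanSpace ℝ (Fin m)) v with hV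
  set W := VectorField.mpullback (𝓡 m) (𝓡 m) κ V with hW
  have hWd : VFDiffAt W (τ x) := vfDiffAt_mpullback hτ hκ hl hr (vfDiffAt_extend v)
  have hWx (y : M) : W (τ y) = mfderiv (𝓡 m) (𝓡 m) τ y (V y) :=
    mpullback_apply_of_inverse hτ hκ hl hr V y
  have hfd (y : M) : MDifferentiableAt (𝓡 m) 𝓘(ℝ, ℂ) f y := (hf y).mdifferentiableAt (by simp)
  have hτd (y : M) : MDifferentiableAt (𝓡 m) (𝓡 m) τ y := (hτ y).mdifferentiableAt (by simp)
  have hcomp {g : M → ℂ} {y : M} (hg : MDifferentiableAt (𝓡 m) 𝓘(ℝ, ℂ) g (τ y))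
      (w : TangentSpace (𝓡 m) y) : mvfderiv (𝓡 m) (fun z => g (τ z)) y w
        = mvfderiv (𝓡 m) g (τ y) (mfderiv (𝓡 m) (𝓡 m) τ y w) :=
    mfderiv_comp_apply y hg (hτd y) w
  have h1 := (tensorialAt_hessian cov hf (mfderiv (𝓡 m) (𝓡 m) τ x u)).pointwise hWd
    (vfDiffAt_extend (mfderiv (𝓡 m) (𝓡 m) τ x v)) (by
      rw [hWx, hV, FiberBundle.extend_apply_self, FiberBundle.extend_apply_self])
  refine Eq.trans ?_ h1
  rw [hessian]
  dsimp only
  rw [← hV, hcomp (hfd _)]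
  congr 1
  · have h2 : (fun y => mvfderiv (𝓡 m) (fun y => f (τ y)) y (V y))
        = fun y => (fun z => mvfderiv (𝓡 m) f z (W z)) (τ y) := by
      ext y
      dsimp only
      rw [hcomp (hfd _), hWx]
    rw [h2, hcomp (mdifferentiableAt_mvfderiv_apply hf hWd)]
  · rw [hV, hcov.mfderiv_cov hτ hκ hl hr hiso]

end Isometry

/-! ### Smooth families of functions on a compact space -/

section Curry

variable {E V F : Type} [NormedAddCommGroup E] [NormedSpace ℝ E] [NormedAddCommGroup V]
  [NormedSpace ℝ V] [NormedAddCommGroup F] [NormedSpace ℝ F]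
  {T : Type} [TopologicalSpace T] [CompactSpace T]

/-- For a bilinear map `b : L × E → F`, a continuous family in `L` parametrized by `T` acts as a
linear map from `E` to continuous families in `F`. -/
def flipFamilyₗ {L : Type} [NormedAddCommGroup L] [NormedSpace ℝ L] (b : L →L[ℝ] E →L[ℝ] F) :
    C(T, L) →ₗ[ℝ] E →ₗ[ℝ] C(T, F) where
  toFun d :=
    { toFun := fun e => ⟨fun t => b (d t) e, by fun_prop⟩
      map_add' := fun e e' => by ext t; simp
      map_smul' := fun c e => by ext t; simp }
  map_add' d d' := by ext e t; simp
  map_smul' c d := by ext e t; simp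

/-- The bounded version of `flipFamilyₗ`. -/
def flipFamily {L : Type} [NormedAddCommGroup L] [NormedSpace ℝ L] (b : L →L[ℝ] E →L[ℝ] F) :
    C(T, L) →L[ℝ] E →L[ℝ] C(T, F) :=
  LinearMap.mkContinuous₂ (flipFamilyₗ b) ‖b‖ fun d e => by
    refine (ContinuousMap.norm_le _ (by positivity)).2 fun t => ?_
    refine (b.le_opNorm₂ (d t) e).trans ?_
    gcongr
    exact d.norm_coe_le_norm t

lemma flipFamily_apply {L : Type} [NormedAddCommGroup L] [NormedSpace ℝ L]
    (b : L →L[ℝ] E →L[ℝ] F) (d : C(T, L)) (e : E) (t : T) : flipFamily b d e t = b (d t) e := rfl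

variable {q : V → T} {U : Set E}

omit [NormedSpace ℝ E] [NormedSpace ℝ V] [NormedSpace ℝ F] [CompactSpace T] in
lemma continuousOn_of_uncurry (hq : IsOpenQuotientMap q) {f : T → E → F}
    (hf : ContinuousOn (fun p : V × E => f (q p.1) p.2) (Set.univ ×ˢ U)) {g : E → C(T, F)}
    (hg : ∀ y ∈ U, ∀ t, g y t = f t y) : ContinuousOn g U := by
  rw [continuousOn_iff_continuous_domRestrict]
  refine ContinuousMap.continuous_of_continuous_uncurry _ ?_
  rw [← (IsOpenQuotientMap.prodMap (IsOpenQuotientMap.id (X := U)) hq).continuous_comp_iff]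
  have h1 : Continuous fun p : U × V => ((p.2, p.1.1) : V × E) := by fun_prop
  refine (hf.comp_continuous h1 fun p => ⟨trivial, p.1.2⟩).congr fun p => ?_
  exact (hg p.1 p.1.2 (q p.2)).symm

set_option synthInstance.maxHeartbeats 200000 in
/-- A family of functions on a compact space `T` that depends smoothly on a parameter, jointly with
the coordinates of a covering `V → T`, is a smooth map into the Banach space of continuous functions
on `T`. -/
lemma contDiffOn_of_uncurry (hq : IsOpenQuotientMap q) (hU : IsOpen U) (n : ℕ) {f : T → E → F}
    (hf : ContDiffOn ℝ n (fun p : V × E => f (q p.1) p.2) (Set.univ ×ˢ U)) {g : E → C(T, F)}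
    (hg : ∀ y ∈ U, ∀ t, g y t = f t y) : ContDiffOn ℝ n g U := by
  induction n generalizing F with
  | zero =>
    rw [Nat.cast_zero, contDiffOn_zero]
    exact continuousOn_of_uncurry hq hf.continuousOn hg
  | succ n ih =>
    classical
    have hVU : IsOpen ((Set.univ : Set V) ×ˢ U) := isOpen_univ.prod hU
    rw [Nat.cast_add, Nat.cast_one, contDiffOn_succ_iff_fderiv_of_isOpen hVU] at hf
    obtain ⟨hfd, -, hf'⟩ := hf
    have hd (s : V) {y : E} (hy : y ∈ U) : HasFDerivAt (f (q s))
        ((fderiv ℝ (fun p : V × E => f (q p.1) p.2) (s, y)) ∘L ContinuousLinearMap.inr ℝ V E) y := by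
      have h1 := ((hfd (s, y) ⟨trivial, hy⟩).differentiableAt (hVU.mem_nhds ⟨trivial, hy⟩)).hasFDerivAt
      exact h1.comp y (hasFDerivAt_prodMk_right s y)
    have hf'' : ContDiffOn ℝ n (fun p : V × E => fderiv ℝ (f (q p.1)) p.2) (Set.univ ×ˢ U) := by
      refine (hf'.clm_comp (contDiffOn_const (c := ContinuousLinearMap.inr ℝ V E))).congr fun p hp => ?_
      exact (hd p.1 hp.2).fderiv
    have hcont {y : E} (hy : y ∈ U) : Continuous fun t => fderiv ℝ (f t) y := by
      rw [← hq.continuous_comp_iff]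
      have h1 : Continuous fun s : V => ((s, y) : V × E) := by fun_prop
      exact hf''.continuousOn.comp_continuous h1 fun s => ⟨trivial, hy⟩
    let g' : E → C(T, E →L[ℝ] F) := fun y =>
      if hy : y ∈ U then ⟨fun t => fderiv ℝ (f t) y, hcont hy⟩ else 0
    have hg' : ∀ y ∈ U, ∀ t, g' y t = fderiv ℝ (f t) y := fun y hy t => by simp [g', hy]
    have hg's : ContDiffOn ℝ n g' U := ih hf'' hg'
    have hdt (t : T) {y : E} (hy : y ∈ U) : HasFDerivAt (f t) (g' y t) y := by
      obtain ⟨s, rfl⟩ := hq.surjective t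
      rw [hg' y hy]
      exact (hd s hy).differentiableAt.hasFDerivAt
    have hder {y : E} (hy : y ∈ U) : HasFDerivAt g (flipFamily (.id ℝ (E →L[ℝ] F)) (g' y)) y := by
      rw [hasFDerivAt_iff_isLittleO, Asymptotics.isLittleO_iff]
      intro c hc
      have h1 : ∀ᶠ z in nhds y, z ∈ U ∧ dist (g' z) (g' y) < c :=
        (hU.eventually_mem hy).and ((hg's.continuousOn.continuousAt (hU.mem_nhds hy)).eventually
          (Metric.ball_mem_nhds _ hc))
      obtain ⟨δ, hδ, h2⟩ := Metric.eventually_nhds_iff_ball.1 h1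
      filter_upwards [Metric.ball_mem_nhds y hδ] with z hz
      refine (ContinuousMap.norm_le _ (by positivity)).2 fun t => ?_
      rw [ContinuousMap.sub_apply, ContinuousMap.sub_apply, flipFamily_apply, hg z (h2 z hz).1,
        hg y hy]
      refine (convex_ball y δ).norm_image_sub_le_of_norm_hasFDerivWithin_le'
        (fun w hw => (hdt t (h2 w hw).1).hasFDerivWithinAt) (fun w hw => ?_)
        (Metric.mem_ball_self hδ) hz
      refine (ContinuousMap.norm_coe_le_norm (g' w - g' y) t).trans ?_
      rw [← dist_eq_norm]
      exact (h2 w hw).2.le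
    rw [Nat.cast_add, Nat.cast_one, contDiffOn_succ_iff_fderiv_of_isOpen hU]
    refine ⟨fun y hy => (hder hy).differentiableAt.differentiableWithinAt, by simp, ?_⟩
    refine ((flipFamily (.id ℝ (E →L[ℝ] F))).contDiff.comp_contDiffOn hg's).congr fun y hy => ?_
    exact (hder hy).fderiv

end Curry

section Torus

variable {n : ℕ}

/-- The covering `ℝⁿ → 𝕋ⁿ`. -/
def toTorus (s : Fin n → ℝ) : UnitAddTorus (Fin n) := fun i => (s i : UnitAddCircle)

lemma isOpenQuotientMap_toTorus : IsOpenQuotientMap (toTorus (n := n)) :=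
  IsOpenQuotientMap.piMap (f := fun _ (x : ℝ) => (x : UnitAddCircle))
    fun _ => QuotientAddGroup.isOpenQuotientMap_mk

lemma toTorus_add (s t : Fin n → ℝ) : toTorus (s + t) = toTorus s + toTorus t := rfl

lemma toTorus_zero : toTorus (0 : Fin n → ℝ) = 0 := rfl

lemma hasDerivAt_mFourier_toTorus (r : Fin n → ℤ) (s : Fin n → ℝ) (j : Fin n) :
    HasDerivAt (fun x : ℝ => UnitAddTorus.mFourier r (toTorus (s + x • Pi.single j 1)))
      (2 * Real.pi * Complex.I * r j * UnitAddTorus.mFourier r (toTorus s)) 0 := by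
  have h1 (x : ℝ) : UnitAddTorus.mFourier r (toTorus (s + x • Pi.single j 1))
      = UnitAddTorus.mFourier r (toTorus s) * fourier (r j) (x : UnitAddCircle) := by
    rw [toTorus_add, mFourier_add_right]
    congr 1
    change ∏ i, fourier (r i) _ = _
    rw [Finset.prod_eq_single j]
    · simp [toTorus]
    · intro i _ hi
      simp [toTorus, hi]
    · simp
  simp only [h1]
  have h2 := (hasDerivAt_fourier (1 : ℝ) (r j) 0).const_mul (UnitAddTorus.mFourier r (toTorus s))
  refine h2.congr_deriv ?_
  rw [QuotientAddGroup.mk_zero, fourier_eval_zero]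
  push_cast
  ring

lemma summable_prod_inv_one_add_sq :
    Summable fun r : Fin n → ℤ => ∏ j, (1 + (r j : ℝ) ^ 2)⁻¹ := by
  induction n with
  | zero => exact Summable.of_finite
  | succ n ih =>
    have h1 : Summable fun k : ℤ => (1 + (k : ℝ) ^ 2)⁻¹ := by
      refine Summable.of_nonneg_of_le (fun k => by positivity) (fun k => ?_)
        (f := fun k : ℤ => 2 * (if k = 0 then 1 else 0) + 1 / (k : ℝ) ^ 2) ?_
      · by_cases hk : k = 0
        · simp [hk]
        · have : (0 : ℝ) < (k : ℝ) ^ 2 := by positivity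
          simp only [hk, if_false, mul_zero, zero_add, one_div]
          gcongr
          linarith
      · exact ((summable_of_hasFiniteSupport ((Set.finite_singleton (0 : ℤ)).subset fun k hk => by
          by_contra h
          simp_all)).mul_left 2).add (Real.summable_one_div_int_pow.2 one_lt_two)
    rw [← (Fin.consEquiv fun _ : Fin (n + 1) => ℤ).summable_iff]
    refine (Summable.mul_of_nonneg h1 ih (fun k => by positivity)
      (fun r => Finset.prod_nonneg fun j _ => by positivity)).congr fun p => ?_
    simp [Fin.prod_univ_succ, mul_comm]

end Torus

/-! ### Smooth functions lift to smooth maps into the twisted algebra -/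

section SmoothLift

open UnitAddTorus

variable {n : ℕ} {E : Type} [NormedAddCommGroup E] [NormedSpace ℝ E] {U : Set E}

/-- If along `ℝⁿ` the Fourier coefficients of a smooth family of functions on the torus vary by
characters, then differentiating the family in the `j`-th direction multiplies the `r`-th
coefficient by `2πi r_j`. -/
lemma fourierCLM_fderiv_single (hU : IsOpen U) {g : (Fin n → ℝ) × E → C(UnitAddTorus (Fin n), ℂ)}
    (hg : ContDiffOn ℝ ∞ g (Set.univ ×ˢ U)) {κ : (Fin n → ℤ) → E → ℂ}
    (hκ : ∀ s, ∀ y ∈ U, ∀ r, fourierCLM r (g (s, y)) = mFourier r (toTorus s) * κ r y) (j : Fin n) :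
    ContDiffOn ℝ ∞ (fun p => fderiv ℝ g p (Pi.single j 1, 0)) (Set.univ ×ˢ U) ∧
    ∀ s, ∀ y ∈ U, ∀ r, fourierCLM r (fderiv ℝ g (s, y) (Pi.single j 1, 0))
      = mFourier r (toTorus s) * (2 * Real.pi * Complex.I * r j * κ r y) := by
  have hVU : IsOpen ((Set.univ : Set (Fin n → ℝ)) ×ˢ U) := isOpen_univ.prod hU
  rw [contDiffOn_infty_iff_fderiv_of_isOpen hVU] at hg
  refine ⟨hg.2.clm_apply contDiffOn_const, fun s y hy r => ?_⟩
  have h1 := ((hg.1 (s, y) ⟨trivial, hy⟩).differentiableAt (hVU.mem_nhds ⟨trivial, hy⟩)).hasFDerivAt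
  have h2 := h1.hasLineDerivAt (Pi.single j 1, 0)
  have h3 : HasDerivAt (fun x : ℝ => fourierCLM r (g ((s, y) + x • (Pi.single j 1, 0))))
      (fourierCLM r (fderiv ℝ g (s, y) (Pi.single j 1, 0))) 0 :=
    ((fourierCLM r).restrictScalars ℝ).hasFDerivAt.comp_hasDerivAt (0 : ℝ) h2
  refine h3.unique ?_
  refine ((hasDerivAt_mFourier_toTorus r s j).mul_const (κ r y)).congr_deriv (by ring)
    |>.congr_of_eventuallyEq (.of_forall fun x => ?_)
  simp only [Prod.smul_mk, Prod.mk_add_mk, smul_zero, add_zero]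
  exact hκ _ y hy r

/-- A smooth family remains smooth when its Fourier coefficients are multiplied by the polynomial
`∏ (1 + r_j²)`, because this is the effect of the differential operators `1 - ∂_j² / 4π²`. -/
lemma exists_fourierCLM_eq_prod_mul (hU : IsOpen U)
    {g : (Fin n → ℝ) × E → C(UnitAddTorus (Fin n), ℂ)}
    (hg : ContDiffOn ℝ ∞ g (Set.univ ×ˢ U)) {κ : (Fin n → ℤ) → E → ℂ}
    (hκ : ∀ s, ∀ y ∈ U, ∀ r, fourierCLM r (g (s, y)) = mFourier r (toTorus s) * κ r y)
    (J : Finset (Fin n)) :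
    ∃ g' : (Fin n → ℝ) × E → C(UnitAddTorus (Fin n), ℂ), ContDiffOn ℝ ∞ g' (Set.univ ×ˢ U) ∧
      ∀ s, ∀ y ∈ U, ∀ r, fourierCLM r (g' (s, y))
        = mFourier r (toTorus s) * ((∏ j ∈ J, (1 + (r j : ℂ) ^ 2)) * κ r y) := by
  classical
  induction J using Finset.induction_on with
  | empty => exact ⟨g, hg, by simpa using hκ⟩
  | insert j J hj ih =>
    obtain ⟨g₀, hg₀, h₀⟩ := ih
    obtain ⟨hg₁, h₁⟩ := fourierCLM_fderiv_single hU hg₀ h₀ j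
    obtain ⟨hg₂, h₂⟩ := fourierCLM_fderiv_single hU hg₁ h₁ j
    refine ⟨_, hg₀.sub (hg₂.const_smul ((4 * Real.pi ^ 2)⁻¹ : ℝ)), fun s y hy r => ?_⟩
    have h3 := ((fourierCLM r).restrictScalars ℝ).map_smul ((4 * Real.pi ^ 2)⁻¹ : ℝ)
      (fderiv ℝ (fun p => fderiv ℝ g₀ p (Pi.single j 1, 0)) (s, y) (Pi.single j 1, 0))
    simp only [ContinuousLinearMap.coe_restrictScalars'] at h3
    rw [map_sub, h₀ s y hy, h3, h₂ s y hy, Finset.prod_insert hj, Complex.real_smul]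
    have hpi : (Real.pi : ℂ) ≠ 0 := by exact_mod_cast Real.pi_ne_zero
    push_cast
    field_simp
    linear_combination (-4 * mFourier r (toTorus s) * (r j) ^ 2 * (∏ j ∈ J, (1 + (r j : ℂ) ^ 2)) * κ r y)
      * Complex.I_sq

/-- The summable weights used to control the Fourier series of a smooth function. -/
def fourierWeight (r : Fin n → ℤ) : ℝ := ∏ j, (1 + (r j : ℝ) ^ 2)⁻¹

lemma fourierWeight_mul_prod (r : Fin n → ℤ) :
    (fourierWeight r : ℂ) * ∏ j, (1 + (r j : ℂ) ^ 2) = 1 := by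
  have h (j) : (1 + (r j : ℝ) ^ 2) ≠ 0 := by positivity
  have h1 : fourierWeight r * ∏ j, (1 + (r j : ℝ) ^ 2) = 1 := by
    rw [fourierWeight, ← Finset.prod_mul_distrib]
    exact Finset.prod_eq_one fun j _ => inv_mul_cancel₀ (h j)
  exact_mod_cast h1

/-- The operator `g ↦ ∑ᵢ wᵢ φᵢ(g) eᵢ`, for summable weights `w`. -/
def weightedSeries {ι A B : Type*} [NormedAddCommGroup A] [NormedSpace ℂ A] [NormedAddCommGroup B]
    [NormedSpace ℂ B] (w : ι → ℝ) (p : ι → A →L[ℂ] ℂ) (e : ι → B) : A →L[ℂ] B :=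
  ∑' i, (w i : ℂ) • (p i).smulRight (e i)

lemma hasSum_weightedSeries {ι A B : Type*} [NormedAddCommGroup A] [NormedSpace ℂ A]
    [NormedAddCommGroup B] [NormedSpace ℂ B] [CompleteSpace B] {w : ι → ℝ} (hw : Summable w)
    (h0 : ∀ i, 0 ≤ w i) {p : ι → A →L[ℂ] ℂ} (hp : ∀ i, ‖p i‖ ≤ 1) {e : ι → B} (he : ∀ i, ‖e i‖ ≤ 1)
    (g : A) : HasSum (fun i => ((w i : ℂ) * p i g) • e i) (weightedSeries w p e g) := by
  have hs : Summable fun i => (w i : ℂ) • (p i).smulRight (e i) := by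
    refine .of_norm_bounded hw fun i => ?_
    rw [norm_smul, ContinuousLinearMap.norm_smulRight_apply, Complex.norm_real,
      Real.norm_of_nonneg (h0 i)]
    exact mul_le_of_le_one_right (h0 i) (mul_le_one₀ (hp i) (norm_nonneg _) (he i))
  simp only [mul_smul]
  exact hs.hasSum.mapL (ContinuousLinearMap.apply ℂ B g)

variable {θ : Matrix (Fin n) (Fin n) ℝ} {m : ℕ} {M : Type*} [TopologicalSpace M]
  [ChartedSpace (EuclideanSpace ℝ (Fin m)) M] [IsManifold (𝓡 m) ∞ M]
  [AddAction (UnitAddTorus (Fin n)) M]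

omit [IsManifold (𝓡 m) ∞ M] in
lemma SmoothAction.contMDiff_vadd (hact : SmoothAction m n M) (t : UnitAddTorus (Fin n)) :
    ContMDiff (𝓡 m) (𝓡 m) ∞ (fun x : M => t +ᵥ x) := by
  obtain ⟨s, rfl⟩ := isOpenQuotientMap_toTorus.surjective t
  exact hact.comp (contMDiff_const.prodMk contMDiff_id : ContMDiff (𝓡 m)
    (𝓘(ℝ, Fin n → ℝ).prod (𝓡 m)) ∞ fun x : M => ((s, x) : (Fin n → ℝ) × M))

omit [IsManifold (𝓡 m) ∞ M] in
lemma SmoothAction.continuous_vadd_const (hact : SmoothAction m n M) (x : M) :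
    Continuous fun t : UnitAddTorus (Fin n) => t +ᵥ x := by
  rw [← isOpenQuotientMap_toTorus.continuous_comp_iff]
  have h1 : Continuous fun s : Fin n → ℝ => (s, x) := by fun_prop
  exact hact.continuous.comp h1

omit [TopologicalSpace M] [ChartedSpace (EuclideanSpace ℝ (Fin m)) M] [IsManifold (𝓡 m) ∞ M] in
lemma component_vadd (f : M → ℂ) (r : Fin n → ℤ)
    (t : UnitAddTorus (Fin n)) (x : M) :
    component (act₀ M) f r (-t +ᵥ x) = mFourier r t * component (act₀ M) f r x := by
  rw [component, component, ← mFourierCoeff_translate]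
  congr 1
  ext t'
  rw [act₀, act₀, vadd_vadd, neg_add]

/-- The orbit maps of a smooth function, read in a chart with an additional translation parameter,
form a smooth family of functions on the torus. -/
lemma SmoothAction.exists_smooth_family (hact : SmoothAction m n M) {h : M → ℂ}
    (hh : ContMDiff (𝓡 m) 𝓘(ℝ, ℂ) ∞ h) (x₀ : M) :
    ∃ g : (Fin n → ℝ) × EuclideanSpace ℝ (Fin m) → C(UnitAddTorus (Fin n), ℂ),
      ContDiffOn ℝ ∞ g (Set.univ ×ˢ (extChartAt (𝓡 m) x₀).target) ∧
      ∀ s, ∀ y ∈ (extChartAt (𝓡 m) x₀).target, ∀ r, fourierCLM r (g (s, y))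
        = mFourier r (toTorus s) * component (act₀ M) h r ((extChartAt (𝓡 m) x₀).symm y) := by
  set c := extChartAt (𝓡 m) x₀ with hc
  let g : (Fin n → ℝ) × EuclideanSpace ℝ (Fin m) → C(UnitAddTorus (Fin n), ℂ) := fun p =>
    ⟨fun t => h (-(t + toTorus p.1) +ᵥ c.symm p.2), by
      have h1 := hact.continuous_vadd_const (c.symm p.2)
      have h2 := hh.continuous
      exact h2.comp (h1.comp (by fun_prop))⟩
  refine ⟨g, ?_, fun s y hy r => ?_⟩
  · rw [contDiffOn_infty]
    intro N
    refine contDiffOn_of_uncurry (f := fun t p => h (-(t + toTorus p.1) +ᵥ c.symm p.2))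
      isOpenQuotientMap_toTorus (isOpen_univ.prod (isOpen_extChartAt_target x₀)) N ?_
      fun p _ t => rfl
    rw [← contMDiffOn_iff_contDiffOn]
    have h1 : ContMDiffOn 𝓘(ℝ, (Fin n → ℝ) × (Fin n → ℝ) × EuclideanSpace ℝ (Fin m)) (𝓡 m) ∞
        (fun p : (Fin n → ℝ) × (Fin n → ℝ) × EuclideanSpace ℝ (Fin m) => c.symm p.2.2)
        (Set.univ ×ˢ Set.univ ×ˢ c.target) :=
      (contMDiffOn_extChartAt_symm x₀).comp
        (ContDiff.contMDiff (by fun_prop)).contMDiffOn fun p hp => hp.2.2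
    have h2 : ContMDiff 𝓘(ℝ, (Fin n → ℝ) × (Fin n → ℝ) × EuclideanSpace ℝ (Fin m))
        𝓘(ℝ, Fin n → ℝ) ∞
        (fun p : (Fin n → ℝ) × (Fin n → ℝ) × EuclideanSpace ℝ (Fin m) => -(p.1 + p.2.1)) :=
      ContDiff.contMDiff (by fun_prop)
    have h3 := hh.comp_contMDiffOn (hact.comp_contMDiffOn (h2.contMDiffOn.prodMk h1))
    exact h3.of_le (mod_cast le_top)
  · rw [fourierCLM_apply, component, ← mFourierCoeff_translate]
    rfl

variable (θ) in
/-- A smooth function on a manifold with a smooth torus action lifts to a smooth map into the twisted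
algebra. -/
lemma SmoothAction.exists_isLift (hact : SmoothAction m n M) {h : M → ℂ}
    (hh : ContMDiff (𝓡 m) 𝓘(ℝ, ℂ) ∞ h) :
    ∃ hh : M → Twisted θ, ContMDiff (𝓡 m) 𝓘(ℝ, Twisted θ) ∞ hh ∧ IsLift θ (act₀ M) hh h := by
  let L : C(UnitAddTorus (Fin n), ℂ) →L[ℂ] Twisted θ :=
    weightedSeries fourierWeight fourierCLM Twisted.gen
  have hL := hasSum_weightedSeries (B := Twisted θ) (w := fourierWeight (n := n))
    summable_prod_inv_one_add_sq (fun r => Finset.prod_nonneg fun j _ => by positivity)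
    norm_fourierCLM_le (e := Twisted.gen) Twisted.norm_gen_le
  -- The lift is the Fourier series. Locally it is the image of a smooth family of functions on the
  -- torus under a bounded operator, once the weights are absorbed into the family.
  let F : M → Twisted θ := fun x => ∑' r, component (act₀ M) h r x • (Twisted.gen r : Twisted θ)
  have hloc (x₀ : M) : ∃ g : EuclideanSpace ℝ (Fin m) → C(UnitAddTorus (Fin n), ℂ),
      ContDiffOn ℝ ∞ g (extChartAt (𝓡 m) x₀).target ∧ ∀ y ∈ (extChartAt (𝓡 m) x₀).target,
        HasSum (fun r => component (act₀ M) h r ((extChartAt (𝓡 m) x₀).symm y) •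
          (Twisted.gen r : Twisted θ)) (L (g y)) := by
    obtain ⟨g, hg, hκ⟩ := hact.exists_smooth_family hh x₀
    obtain ⟨g', hg', hκ'⟩ := exists_fourierCLM_eq_prod_mul (isOpen_extChartAt_target x₀) hg
      (κ := fun r y => component (act₀ M) h r ((extChartAt (𝓡 m) x₀).symm y)) hκ Finset.univ
    refine ⟨fun y => g' (0, y), hg'.comp (by fun_prop : ContDiff ℝ ∞ fun y => ((0, y) :
      (Fin n → ℝ) × EuclideanSpace ℝ (Fin m))).contDiffOn fun y hy => ⟨trivial, hy⟩, fun y hy => ?_⟩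
    refine (hL (g' (0, y))).congr_fun fun r => ?_
    rw [hκ' 0 y hy r, toTorus_zero, ← mul_assoc, ← mul_assoc, mul_right_comm (fourierWeight r : ℂ),
      fourierWeight_mul_prod]
    simp [mFourier]
  have hsum (x : M) : HasSum (fun r => component (act₀ M) h r x • (Twisted.gen r : Twisted θ))
      (F x) := by
    obtain ⟨g, -, hg⟩ := hloc x
    have h1 := hg _ (mem_extChartAt_target x)
    rw [extChartAt_to_inv] at h1
    exact h1.summable.hasSum
  have hcoeff (r : Fin n → ℤ) (x : M) : Twisted.coeff r (F x) = component (act₀ M) h r x := by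
    have h1 := (hsum x).mapL (Twisted.coeff r)
    refine h1.unique ?_
    convert hasSum_ite_eq r (component (act₀ M) h r x) using 2 with l
    rw [map_smul, Twisted.coeff_gen]
    split_ifs with h2 h3 h3
    · simp [h2]
    · exact absurd h2.symm h3
    · exact absurd h3.symm h2
    · simp
  refine ⟨F, fun x₀ => ?_, fun x => ?_, fun t x r => ?_⟩
  · obtain ⟨g, hg, hgL⟩ := hloc x₀
    have h1 : ContDiffAt ℝ ∞ (fun y => L (g y)) (extChartAt (𝓡 m) x₀ x₀) :=
      (L.restrictScalars ℝ).contDiff.contDiffAt.comp _ (hg.contDiffAt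
        ((isOpen_extChartAt_target x₀).mem_nhds (mem_extChartAt_target x₀)))
    have h2 := h1.contMDiffAt.comp x₀ (contMDiffAt_extChartAt (I := 𝓡 m) (n := ∞))
    refine h2.congr_of_eventuallyEq ?_
    filter_upwards [extChartAt_source_mem_nhds (I := 𝓡 m) x₀] with x hx
    have h3 := hgL _ ((extChartAt (𝓡 m) x₀).map_source hx)
    rw [(extChartAt (𝓡 m) x₀).left_inv hx] at h3
    exact (hsum x).unique h3
  · let f : C(UnitAddTorus (Fin n), ℂ) := ⟨fun t => h (-t +ᵥ x),
      hh.continuous.comp ((hact.continuous_vadd_const x).comp (by fun_prop))⟩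
    have h1 : Summable (UnitAddTorus.mFourierCoeff f) :=
      ((Twisted.summable_norm_coeff (F x)).congr fun r => by rw [hcoeff]; rfl).of_norm
    have h2 := hasSum_mFourier_series_apply_of_summable h1 0
    rw [Twisted.total_apply]
    refine Eq.trans (tsum_congr fun r => ?_) (h2.tsum_eq.trans ?_)
    · rw [hcoeff]
      simp [mFourier]
      rfl
    · simp [f]
  · rw [hcoeff, hcoeff]
    exact component_vadd h r t x

end SmoothLift

/-! ### The change of variables in the twisted algebra -/

section ChangeOfVariables

open NormedSpace

variable {A : Type*} [NormedRing A] [NormedAlgebra ℝ A] [CompleteSpace A]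

lemma exp_smul_mul_exp_smul_of_add_eq_zero (a : A) (s t : ℝ) (h : s + t = 0) :
    exp (s • a) * exp (t • a) = 1 := by
  rw [exp_smul_mul_exp_smul, h, zero_smul, exp_zero]

lemma modGroup_mul (a : A) (l : ℝ) (x y : A) :
    modGroup a l (x * y) = modGroup a l x * modGroup a l y := by
  have h := exp_smul_mul_exp_smul_of_add_eq_zero a (2 * l) (-2 * l) (by ring)
  simp only [modGroup]
  calc exp ((-2 * l) • a) * (x * y) * exp ((2 * l) • a)
      = exp ((-2 * l) • a) * x * 1 * y * exp ((2 * l) • a) := by noncomm_ring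
    _ = _ := by
      rw [← h]
      noncomm_ring

lemma modGroup_modGroup (a : A) (l k : ℝ) (x : A) :
    modGroup a l (modGroup a k x) = modGroup a (l + k) x := by
  have h1 := exp_smul_mul_exp_smul a (-2 * l) (-2 * k)
  have h2 := exp_smul_mul_exp_smul a (2 * k) (2 * l)
  simp only [modGroup]
  rw [show -2 * (l + k) = -2 * l + -2 * k by ring, show 2 * (l + k) = 2 * k + 2 * l by ring, ← h1,
    ← h2]
  noncomm_ring

lemma modGroup_exp (a : A) (l : ℝ) : modGroup a l (exp a) = exp a := by
  have h1 := exp_smul_mul_exp_smul a (-2 * l) 1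
  have h2 := exp_smul_mul_exp_smul a (-2 * l + 1) (2 * l)
  rw [one_smul] at h1
  rw [modGroup, h1, h2, show -2 * l + 1 + 2 * l = 1 by ring, one_smul]

/-- Moving `exp a` to the left costs half a step of the modular group. -/
lemma mul_exp_eq (a x : A) : x * exp a = exp a * modGroup a (1 / 2) x := by
  have h := exp_mul_modGroup a x 1
  rw [h]
  simp

omit [CompleteSpace A] in
lemma modGroup_add (a : A) (l : ℝ) (x y : A) :
    modGroup a l (x + y) = modGroup a l x + modGroup a l y := by
  simp only [modGroup]
  noncomm_ring

omit [CompleteSpace A] in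
lemma modGroup_smul (a : A) (l c : ℝ) (x : A) : modGroup a l (c • x) = c • modGroup a l x := by
  simp only [modGroup, mul_smul_comm, smul_mul_assoc]

lemma intervalIntegral_mul (c : A) {f : ℝ → A} (hf : Continuous f) :
    (∫ v in (0 : ℝ)..1, f v) * c = ∫ v in (0 : ℝ)..1, f v * c :=
  (((ContinuousLinearMap.mul ℝ A).flip c).intervalIntegral_comp_comm
    (hf.intervalIntegrable _ _)).symm

lemma modGroup_integral (a : A) (l : ℝ) {f : ℝ → A} (hf : Continuous f) :
    modGroup a l (∫ v in (0 : ℝ)..1, f v) = ∫ v in (0 : ℝ)..1, modGroup a l (f v) := by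
  simp only [modGroup]
  rw [mul_intervalIntegral _ hf, intervalIntegral_mul _ (by fun_prop)]

lemma modGroup_expD₁ (a d : A) (l : ℝ) :
    modGroup a l (expD₁ a d) = exp a * ∫ v in (0 : ℝ)..1, modGroup a (l + v / 2) d := by
  rw [expD₁, modGroup_mul, modGroup_exp, modGroup_integral _ _ (by fun_prop)]
  simp only [modGroup_modGroup]

lemma modGroup_expD₂ (a d : A) (l : ℝ) :
    modGroup a l (expD₂ a d) = exp a * ∫ v in (0 : ℝ)..1, ∫ w in (0 : ℝ)..1,
      v • (modGroup a (l + v / 2) d * modGroup a (l + v * w / 2) d) := by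
  rw [expD₂, modGroup_mul, modGroup_exp,
    modGroup_integral _ _ (continuous_integral_right (by fun_prop))]
  congr 1
  refine intervalIntegral.integral_congr fun v _ => ?_
  rw [modGroup_integral _ _ (by fun_prop)]
  simp only [modGroup_smul, modGroup_mul, modGroup_modGroup]

lemma modGroup_expD₁_mul_modGroup_expD₁ (a d : A) (l k : ℝ) :
    modGroup a l (expD₁ a d) * modGroup a k (expD₁ a d)
      = exp ((2 : ℝ) • a) * ∫ v in (0 : ℝ)..1, ∫ w in (0 : ℝ)..1,
        modGroup a (l + 1 / 2 + v / 2) d * modGroup a (k + w / 2) d := by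
  have h2 : exp ((2 : ℝ) • a) = exp a * exp a := by
    have := exp_smul_mul_exp_smul a 1 1
    rw [one_smul] at this
    rw [this]
    norm_num
  have h3 : modGroup a (1 / 2) (∫ v in (0 : ℝ)..1, modGroup a (l + v / 2) d)
      = ∫ v in (0 : ℝ)..1, modGroup a (l + 1 / 2 + v / 2) d := by
    rw [modGroup_integral _ _ (by fun_prop)]
    simp only [modGroup_modGroup]
    refine intervalIntegral.integral_congr fun v _ => ?_
    ring_nf
  have h4 : (∫ v in (0 : ℝ)..1, modGroup a (l + 1 / 2 + v / 2) d) *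
      (∫ w in (0 : ℝ)..1, modGroup a (k + w / 2) d)
      = ∫ v in (0 : ℝ)..1, ∫ w in (0 : ℝ)..1,
        modGroup a (l + 1 / 2 + v / 2) d * modGroup a (k + w / 2) d := by
    rw [intervalIntegral_mul _ (by fun_prop)]
    refine intervalIntegral.integral_congr fun v _ => ?_
    exact mul_intervalIntegral _ (by fun_prop)
  rw [modGroup_expD₁, modGroup_expD₁, h2, ← h4, ← h3]
  simp only [mul_assoc]
  rw [← mul_assoc _ (exp a), mul_exp_eq]
  simp only [mul_assoc]

/-- The change of variables from `k = e^a` to its logarithm `a`, for exponential sums in place of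
the curvature functions: here `expD₁ a d` and `expD₁ a e + 2 • expD₂ a d` stand for the first and
the second derivative of `e^a`, where `d` and `e` are those of `a`. -/
lemma exp_mul_sum_add_exp_mul_sum {ι ι' : Type*} [Fintype ι] [Fintype ι'] (a d e : A) (p : ℝ)
    (c l : ι → ℝ) (c' l' k' : ι' → ℝ) :
    exp ((1 - p) • a) * (∑ i, c i • modGroup a (l i) (expD₁ a e + (2 : ℝ) • expD₂ a d))
      + exp ((-p) • a) * (∑ j, c' j •
          (modGroup a (l' j) (expD₁ a d) * modGroup a (k' j) (expD₁ a d)))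
      = exp ((2 - p) • a) * ((∑ i, ∫ v in (0 : ℝ)..1, c i • modGroup a (l i + v / 2) e)
        + ((∑ j, ∫ v in (0 : ℝ)..1, ∫ w in (0 : ℝ)..1,
              c' j • (modGroup a (l' j + 1 / 2 + v / 2) d * modGroup a (k' j + w / 2) d))
          + ∑ i, ∫ v in (0 : ℝ)..1, ∫ w in (0 : ℝ)..1,
              (2 * c i * v) • (modGroup a (l i + v / 2) d * modGroup a (l i + v * w / 2) d))) := by
  have h1 : exp ((1 - p) • a) * exp a = exp ((2 - p) • a) := by
    have := exp_smul_mul_exp_smul a (1 - p) 1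
    rw [one_smul] at this
    rw [this]
    ring_nf
  have h2 : exp ((-p) • a) * exp ((2 : ℝ) • a) = exp ((2 - p) • a) := by
    rw [exp_smul_mul_exp_smul]
    ring_nf
  have h3 (i : ι) : exp ((1 - p) • a) * (c i • modGroup a (l i) (expD₁ a e + (2 : ℝ) • expD₂ a d))
      = exp ((2 - p) • a) * ((∫ v in (0 : ℝ)..1, c i • modGroup a (l i + v / 2) e)
        + ∫ v in (0 : ℝ)..1, ∫ w in (0 : ℝ)..1,
            (2 * c i * v) • (modGroup a (l i + v / 2) d * modGroup a (l i + v * w / 2) d)) := by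
    have h4 (v : ℝ) : (∫ w in (0 : ℝ)..1,
          (2 * c i * v) • (modGroup a (l i + v / 2) d * modGroup a (l i + v * w / 2) d))
        = (c i * 2) • ∫ w in (0 : ℝ)..1,
          v • (modGroup a (l i + v / 2) d * modGroup a (l i + v * w / 2) d) := by
      rw [← intervalIntegral.integral_smul]
      refine intervalIntegral.integral_congr fun w _ => ?_
      rw [smul_smul, mul_comm 2]
    simp only [h4]
    rw [intervalIntegral.integral_smul, intervalIntegral.integral_smul, modGroup_add, modGroup_smul,
      modGroup_expD₁, modGroup_expD₂, mul_smul, ← smul_add, mul_smul_comm, mul_smul_comm,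
      ← mul_smul_comm (2 : ℝ), ← mul_add, ← mul_assoc, h1]
  have h5 (j : ι') : exp ((-p) • a) * (c' j •
        (modGroup a (l' j) (expD₁ a d) * modGroup a (k' j) (expD₁ a d)))
      = exp ((2 - p) • a) * ∫ v in (0 : ℝ)..1, ∫ w in (0 : ℝ)..1,
          c' j • (modGroup a (l' j + 1 / 2 + v / 2) d * modGroup a (k' j + w / 2) d) := by
    simp only [intervalIntegral.integral_smul]
    rw [modGroup_expD₁_mul_modGroup_expD₁, mul_smul_comm, mul_smul_comm, ← mul_assoc, h2]
  rw [Finset.mul_sum, Finset.mul_sum, Finset.sum_congr rfl fun i _ => h3 i,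
    Finset.sum_congr rfl fun j _ => h5 j, ← Finset.mul_sum, ← Finset.mul_sum, ← mul_add,
    Finset.sum_add_distrib, add_assoc,
    add_comm (∑ i, ∫ v in (0 : ℝ)..1, ∫ w in (0 : ℝ)..1, _)]

end ChangeOfVariables

/-! ### The curvature functions of the two forms -/

section CurvatureFunctions

lemma exists_curvK_eq_sum (m : ℕ) : ∃ (ι : Type) (_ : Fintype ι) (c l : ι → ℝ),
    ∀ s, curvK m (Real.exp s) = ∑ i, c i * Real.exp (l i * s) := by
  obtain ⟨ι, hι, c, l, k, h⟩ := exists_sum_of_mem_expPoly (curvK_mem_expPoly m)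
  exact ⟨ι, hι, c, l, fun s => by simpa using h s 0⟩

lemma exists_curvH_eq_sum (m : ℕ) : ∃ (ι : Type) (_ : Fintype ι) (c l k : ι → ℝ),
    ∀ s t, curvH m (Real.exp s) (Real.exp t)
      = ∑ i, c i * (Real.exp (l i * s) * Real.exp (k i * t)) :=
  exists_sum_of_mem_expPoly (curvH_mem_expPoly m)

variable {ι ι' : Type} [Fintype ι] [Fintype ι'] {m : ℕ} {c l : ι → ℝ} {c' l' k' : ι' → ℝ}

/-- The one-variable curvature function of the `h`-form as a superposition of exponentials. -/
lemma curvK_mul_f₁_eq_sum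
    (hK : ∀ s, curvK m (Real.exp s) = ∑ i, c i * Real.exp (l i * s)) (s : ℝ) :
    curvK m (Real.exp s) * f₁ (s / 2)
      = ∑ i, ∫ v in (0 : ℝ)..1, c i * Real.exp ((l i + v / 2) * s) := by
  rw [hK, f₁_eq_integral, Finset.sum_mul]
  refine Finset.sum_congr rfl fun i _ => ?_
  rw [← intervalIntegral.integral_const_mul]
  refine intervalIntegral.integral_congr fun v _ => ?_
  rw [mul_assoc, ← Real.exp_add]
  ring_nf

/-- The two-variable curvature function of the `h`-form as a superposition of exponentials. -/
lemma curvH_mul_f₁_add_eq_sum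
    (hK : ∀ s, curvK m (Real.exp s) = ∑ i, c i * Real.exp (l i * s))
    (hH : ∀ s t, curvH m (Real.exp s) (Real.exp t)
      = ∑ i, c' i * (Real.exp (l' i * s) * Real.exp (k' i * t))) (s t : ℝ) :
    Real.exp (s / 2) * curvH m (Real.exp s) (Real.exp t) * f₁ (s / 2) * f₁ (t / 2)
        + 2 * curvK m (Real.exp (s + t)) * g₂ (s / 2) (t / 2)
      = (∑ j, ∫ v in (0 : ℝ)..1, ∫ w in (0 : ℝ)..1,
          c' j * (Real.exp ((l' j + 1 / 2 + v / 2) * s) * Real.exp ((k' j + w / 2) * t)))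
        + ∑ i, ∫ v in (0 : ℝ)..1, ∫ w in (0 : ℝ)..1,
          2 * c i * v * (Real.exp ((l i + v / 2) * s) * Real.exp ((l i + v * w / 2) * t)) := by
  rw [hK, hH, f₁_eq_integral, f₁_eq_integral, g₂_eq_integral, Finset.mul_sum, Finset.sum_mul,
    Finset.sum_mul, Finset.mul_sum, Finset.sum_mul]
  congr 1
  · refine Finset.sum_congr rfl fun j _ => ?_
    have h3 : Real.exp (s / 2) * (c' j * (Real.exp (l' j * s) * Real.exp (k' j * t))) *
          (∫ v in (0 : ℝ)..1, Real.exp (v * (s / 2))) * (∫ w in (0 : ℝ)..1, Real.exp (w * (t / 2)))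
        = ∫ v in (0 : ℝ)..1, (Real.exp (s / 2) * (c' j * (Real.exp (l' j * s) *
            Real.exp (k' j * t))) * ∫ w in (0 : ℝ)..1, Real.exp (w * (t / 2))) *
              Real.exp (v * (s / 2)) := by
      rw [intervalIntegral.integral_const_mul]
      ring
    rw [h3]
    refine intervalIntegral.integral_congr fun v _ => ?_
    rw [mul_right_comm, ← intervalIntegral.integral_const_mul]
    refine intervalIntegral.integral_congr fun w _ => ?_
    have h1 : Real.exp ((l' j + 1 / 2 + v / 2) * s)
        = Real.exp (s / 2) * Real.exp (l' j * s) * Real.exp (v * (s / 2)) := by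
      rw [← Real.exp_add, ← Real.exp_add]
      ring_nf
    have h2 : Real.exp ((k' j + w / 2) * t) = Real.exp (k' j * t) * Real.exp (w * (t / 2)) := by
      rw [← Real.exp_add]
      ring_nf
    simp only [h1, h2]
    ring
  · refine Finset.sum_congr rfl fun i _ => ?_
    rw [← intervalIntegral.integral_const_mul]
    refine intervalIntegral.integral_congr fun v _ => ?_
    rw [← intervalIntegral.integral_const_mul]
    refine intervalIntegral.integral_congr fun w _ => ?_
    have h1 : Real.exp (l i * (s + t)) = Real.exp (l i * s) * Real.exp (l i * t) := by
      rw [← Real.exp_add]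
      ring_nf
    have h2 : Real.exp ((l i + v / 2) * s) = Real.exp (l i * s) * Real.exp (v * (s / 2)) := by
      rw [← Real.exp_add]
      ring_nf
    have h3 : Real.exp ((l i + v * w / 2) * t)
        = Real.exp (l i * t) * Real.exp (v * w * (t / 2)) := by
      rw [← Real.exp_add]
      ring_nf
    simp only [h1, h2, h3]
    ring

end CurvatureFunctions

/-! ### Covariant derivatives of vector-valued functions -/

section VectorValued

variable {m : ℕ} {M : Type*} [TopologicalSpace M] [ChartedSpace (EuclideanSpace ℝ (Fin m)) M]
  [IsManifold (𝓡 m) ∞ M]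
  {E F G : Type*} [NormedAddCommGroup E] [NormedSpace ℝ E] [NormedAddCommGroup F] [NormedSpace ℝ F]
  [NormedAddCommGroup G] [NormedSpace ℝ G]

lemma fderiv_fderiv_comp_apply {f : F → G} {g : E → F} {p : E} (hf : ContDiff ℝ 2 f)
    (hg : ContDiffAt ℝ 2 g p) (u v : E) :
    fderiv ℝ (fderiv ℝ (f ∘ g)) p u v
      = fderiv ℝ (fderiv ℝ f) (g p) (fderiv ℝ g p u) (fderiv ℝ g p v)
        + fderiv ℝ f (g p) (fderiv ℝ (fderiv ℝ g) p u v) := by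
  have h1 : fderiv ℝ (f ∘ g) =ᶠ[nhds p] fun q => (fderiv ℝ f (g q)).comp (fderiv ℝ g q) := by
    filter_upwards [hg.eventually (by simp)] with q hq
    exact fderiv_comp q (hf.differentiable two_ne_zero _) (hq.differentiableAt two_ne_zero)
  have h2 : DifferentiableAt ℝ (fderiv ℝ g) p :=
    (hg.fderiv_right (m := 1) (by norm_num)).differentiableAt one_ne_zero
  have h3 : DifferentiableAt ℝ (fderiv ℝ f) (g p) :=
    (hf.fderiv_right (m := 1) (by norm_num)).differentiable one_ne_zero _
  have h4 : DifferentiableAt ℝ g p := hg.differentiableAt two_ne_zero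
  have h5 : HasFDerivAt (fun q => fderiv ℝ f (g q)) _ p := h3.hasFDerivAt.comp p h4.hasFDerivAt
  rw [h1.fderiv_eq, (h5.clm_comp h2.hasFDerivAt).fderiv]
  simp [add_comm]

/-- The second covariant derivative of a vector-valued function, in terms of the preferred chart at
the base point. -/
def chartHessian
    (cov : CovariantDerivative (𝓡 m) (EuclideanSpace ℝ (Fin m))
      (TangentSpace (𝓡 m) : M → Type _))
    (f : M → G) (ξ : TwoVec m M) : G :=
  fderiv ℝ (fderiv ℝ (inChart ξ.1 f)) (extChartAt (𝓡 m) ξ.1 ξ.1)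
      (coords m ξ.1 ξ.2.1) (coords m ξ.1 ξ.2.2)
    - fderiv ℝ (inChart ξ.1 f) (extChartAt (𝓡 m) ξ.1 ξ.1)
      (coords m ξ.1 (cov (FiberBundle.extend (EuclideanSpace ℝ (Fin m)) ξ.2.2) ξ.1 ξ.2.1))

variable (m) in
/-- The differential of a vector-valued function, in terms of the preferred chart at the base
point. -/
def chartGrad (f : M → G) {x : M} (u : TangentSpace (𝓡 m) x) : G :=
  fderiv ℝ (inChart x f) (extChartAt (𝓡 m) x x) (coords m x u)

omit [IsManifold (𝓡 m) ∞ M] [NormedAddCommGroup G] [NormedSpace ℝ G] in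
lemma inChart_self (x : M) (f : M → G) : inChart x f (extChartAt (𝓡 m) x x) = f x := by
  rw [inChart, Function.comp_apply, extChartAt_to_inv]

/-- The chain rule; the Christoffel symbols only meet the first derivative of the inner function. -/
lemma chartHessian_comp
    (cov : CovariantDerivative (𝓡 m) (EuclideanSpace ℝ (Fin m))
      (TangentSpace (𝓡 m) : M → Type _))
    {f : F → G} {g : M → F} (hf : ContDiff ℝ 2 f) (hg : ContMDiff (𝓡 m) 𝓘(ℝ, F) 2 g)
    (ξ : TwoVec m M) :
    chartHessian cov (fun x => f (g x)) ξ
      = fderiv ℝ (fderiv ℝ f) (g ξ.1) (chartGrad m g ξ.2.1) (chartGrad m g ξ.2.2)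
        + fderiv ℝ f (g ξ.1) (chartHessian cov g ξ) := by
  have h1 := contDiffAt_inChart two_le_infty (hg ξ.1) (mem_chart_source (EuclideanSpace ℝ (Fin m)) ξ.1)
  have h2 : inChart (m := m) ξ.1 (fun x => f (g x)) = f ∘ inChart ξ.1 g := rfl
  rw [chartHessian, h2, fderiv_fderiv_comp_apply hf h1,
    fderiv_comp _ (hf.differentiable two_ne_zero _) (h1.differentiableAt two_ne_zero),
    inChart_self, ContinuousLinearMap.comp_apply, add_sub_assoc, ← map_sub]
  rfl

lemma chartGrad_comp {f : F → G} {g : M → F} (hf : ContDiff ℝ 2 f)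
    (hg : ContMDiff (𝓡 m) 𝓘(ℝ, F) 2 g) {x : M} (u : TangentSpace (𝓡 m) x) :
    chartGrad m (fun y => f (g y)) u = fderiv ℝ f (g x) (chartGrad m g u) := by
  have h1 := contDiffAt_inChart two_le_infty (hg x) (mem_chart_source (EuclideanSpace ℝ (Fin m)) x)
  have h2 : inChart (m := m) x (fun x => f (g x)) = f ∘ inChart x g := rfl
  rw [chartGrad, h2,
    fderiv_comp _ (hf.differentiable two_ne_zero _) (h1.differentiableAt two_ne_zero),
    inChart_self, ContinuousLinearMap.comp_apply]
  rfl

variable {A : Type*} [NormedAddCommGroup A] [NormedSpace ℂ A]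

omit [IsManifold (𝓡 m) ∞ M] in
lemma contMDiff_clm_comp (L : A →L[ℂ] ℂ) {g : M → A} (hg : ContMDiff (𝓡 m) 𝓘(ℝ, A) 2 g) :
    ContMDiff (𝓡 m) 𝓘(ℝ, ℂ) 2 fun x => L (g x) :=
  ((L.restrictScalars ℝ).contDiff (n := 2)).contMDiff.comp hg

/-- A complex functional applied to a vector-valued function commutes with the second covariant
derivative. With the functionals `total` and `coeff r`, this reduces a function and its isotypic
components to one map into the twisted algebra. -/
lemma hessian_clm_comp
    (cov : CovariantDerivative (𝓡 m) (EuclideanSpace ℝ (Fin m))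
      (TangentSpace (𝓡 m) : M → Type _))
    (L : A →L[ℂ] ℂ) {g : M → A} (hg : ContMDiff (𝓡 m) 𝓘(ℝ, A) 2 g) (ξ : TwoVec m M) :
    hessian cov (fun x => L (g x)) ξ = L (chartHessian cov g ξ) := by
  have h1 := contMDiff_clm_comp L hg
  have h2 : fderiv ℝ (L.restrictScalars ℝ : A → ℂ) = fun _ => L.restrictScalars ℝ :=
    funext fun _ => (L.restrictScalars ℝ).fderiv
  refine (hessian_eq_inChart cov h1 ξ).trans ((chartHessian_comp cov (L.restrictScalars ℝ).contDiff hg ξ).trans ?_)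
  rw [h2]
  simp

lemma mvfderiv_clm_comp (L : A →L[ℂ] ℂ) {g : M → A} (hg : ContMDiff (𝓡 m) 𝓘(ℝ, A) 2 g) {x : M}
    (u : TangentSpace (𝓡 m) x) :
    mvfderiv (𝓡 m) (fun x => L (g x)) x u = L (chartGrad m g u) := by
  have h1 := contMDiff_clm_comp L hg
  refine (mvfderiv_eq_fderiv_inChart ((h1 x).of_le (by norm_num)) (mem_chart_source _ x) u).trans
    ((chartGrad_comp (L.restrictScalars ℝ).contDiff hg u).trans ?_)
  exact congr_arg (fun T : A →L[ℝ] ℂ => T (chartGrad m g u)) (L.restrictScalars ℝ).fderiv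

end VectorValued

section Lifts

variable {m n : ℕ} {M : Type*} [TopologicalSpace M] [ChartedSpace (EuclideanSpace ℝ (Fin m)) M]
  [IsManifold (𝓡 m) ∞ M] [AddAction (UnitAddTorus (Fin n)) M]
  {θ : Matrix (Fin n) (Fin n) ℝ} {Fh : M → Twisted θ} {F : M → ℂ}

namespace IsLift

omit [IsManifold (𝓡 m) ∞ M] in
lemma lift (hF : IsLift θ (act₀ M) Fh F) :
    IsLift θ (act₂ m M) (fun ξ => Fh ξ.1) (ConnesLandi.lift F) :=
  hF.comp (q := fun ξ : TwoVec m M => ξ.1) fun _ _ => rfl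

omit [TopologicalSpace M] in
/-- Translation by the torus multiplies the isotypic components by characters. -/
lemma coeff_comp_vadd (hF : IsLift θ (act₀ M) Fh F) (t : UnitAddTorus (Fin n)) (r : Fin n → ℤ) :
    (fun y : M => Twisted.coeff r (Fh (-t +ᵥ y)))
      = fun y => (UnitAddTorus.mFourier r t • Twisted.coeff r) (Fh y) :=
  funext fun y => hF.coeff_act t y r

omit [TopologicalSpace M] in
lemma eq_total (hF : IsLift θ (act₀ M) Fh F) : F = fun y => Twisted.total (Fh y) :=
  funext fun y => (hF.total_eq y).symm

lemma mvfderiv_coeff_vadd (hact : SmoothAction m n M) (hF : IsLift θ (act₀ M) Fh F)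
    (hFh : ContMDiff (𝓡 m) 𝓘(ℝ, Twisted θ) 2 Fh) (t : UnitAddTorus (Fin n)) (r : Fin n → ℤ) {x : M}
    (u : TangentSpace (𝓡 m) x) :
    Twisted.coeff r (chartGrad m Fh (mfderiv (𝓡 m) (𝓡 m) (fun y : M => -t +ᵥ y) x u))
      = UnitAddTorus.mFourier r t * Twisted.coeff r (chartGrad m Fh u) := by
  have h1 := mvfderiv_clm_comp (Twisted.coeff (θ := θ) r) hFh
    (mfderiv (𝓡 m) (𝓡 m) (fun y : M => -t +ᵥ y) x u)
  have h2 := mvfderiv_clm_comp (UnitAddTorus.mFourier r t • Twisted.coeff (θ := θ) r)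
    hFh u
  have h3 : MDifferentiableAt (𝓡 m) 𝓘(ℝ, ℂ) (fun y => Twisted.coeff r (Fh y)) (-t +ᵥ x) :=
    (contMDiff_clm_comp (Twisted.coeff (θ := θ) r) hFh _).mdifferentiableAt (by simp)
  have h4 : MDifferentiableAt (𝓡 m) (𝓡 m) (fun y : M => -t +ᵥ y) x :=
    (hact.contMDiff_vadd (-t) x).mdifferentiableAt (by simp)
  refine h1.symm.trans (Eq.trans ?_ h2)
  refine (mfderiv_comp_apply x h3 h4 u).symm.trans ?_
  exact congr_arg (fun f : M → ℂ => mvfderiv (𝓡 m) f x u) (hF.coeff_comp_vadd t r)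

lemma grad₁ (hact : SmoothAction m n M) (hF : IsLift θ (act₀ M) Fh F)
    (hFh : ContMDiff (𝓡 m) 𝓘(ℝ, Twisted θ) 2 Fh) :
    IsLift θ (act₂ m M) (fun ξ => chartGrad m Fh ξ.2.1) (ConnesLandi.grad₁ m F) := by
  refine ⟨fun ξ => ?_, fun t ξ r => hF.mvfderiv_coeff_vadd hact hFh t r ξ.2.1⟩
  rw [hF.eq_total]
  exact (mvfderiv_clm_comp (Twisted.total (θ := θ)) hFh ξ.2.1).symm

lemma grad₂ (hact : SmoothAction m n M) (hF : IsLift θ (act₀ M) Fh F)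
    (hFh : ContMDiff (𝓡 m) 𝓘(ℝ, Twisted θ) 2 Fh) :
    IsLift θ (act₂ m M) (fun ξ => chartGrad m Fh ξ.2.2) (ConnesLandi.grad₂ m F) := by
  refine ⟨fun ξ => ?_, fun t ξ r => hF.mvfderiv_coeff_vadd hact hFh t r ξ.2.2⟩
  rw [hF.eq_total]
  exact (mvfderiv_clm_comp (Twisted.total (θ := θ)) hFh ξ.2.2).symm

variable [RiemannianBundle (fun x : M => TangentSpace (𝓡 m) x)]
  [IsContMDiffRiemannianBundle (𝓡 m) ∞ (EuclideanSpace ℝ (Fin m))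
    (fun x : M => TangentSpace (𝓡 m) x)]
  {cov : CovariantDerivative (𝓡 m) (EuclideanSpace ℝ (Fin m))
    (TangentSpace (𝓡 m) : M → Type _)}

/-- The second covariant derivative of a lift is a lift of the second covariant derivative: the
isometric action leaves the Levi-Civita connection invariant. -/
lemma hessian [T2Space M] (hact : SmoothAction m n M) (hiso : IsometricAction m n M)
    (hcov : IsLeviCivita cov) (hF : IsLift θ (act₀ M) Fh F)
    (hFh : ContMDiff (𝓡 m) 𝓘(ℝ, Twisted θ) 2 Fh) :
    IsLift θ (act₂ m M) (chartHessian cov Fh) (ConnesLandi.hessian cov F) := by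
  refine ⟨fun ξ => ?_, fun t ξ r => ?_⟩
  · rw [hF.eq_total]
    exact (hessian_clm_comp cov (Twisted.total (θ := θ)) hFh ξ).symm
  · have h1 := hessian_clm_comp cov (Twisted.coeff (θ := θ) r) hFh (act₂ m M (-t) ξ)
    have h2 := hessian_clm_comp cov
      (UnitAddTorus.mFourier r t • Twisted.coeff (θ := θ) r) hFh ξ
    have h3 := contMDiff_clm_comp (Twisted.coeff (θ := θ) r) hFh
    refine h1.symm.trans (Eq.trans ?_ h2)
    refine (hcov.hessian_comp (hact.contMDiff_vadd (-t)) (hact.contMDiff_vadd t)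
      (fun x => vadd_neg_vadd t x) (fun x => neg_vadd_vadd t x) (hiso (-t)) h3 ξ.1 ξ.2.1
      ξ.2.2).symm.trans ?_
    exact congr_arg (fun f : M → ℂ => ConnesLandi.hessian cov f ξ) (hF.coeff_comp_vadd t r)

end IsLift

end Lifts

/-! ### Functional calculus of the curvature functions -/

section CurvatureCalculus

variable {A : Type*} [NormedRing A] [NormedAlgebra ℂ A] [CompleteSpace A]
  {ι ι' : Type} [Fintype ι] [Fintype ι'] {m : ℕ} {c l : ι → ℝ} {c' l' k' : ι' → ℝ}

lemma hasSum_curvK (hK : ∀ s, curvK m (Real.exp s) = ∑ i, c i * Real.exp (l i * s)) (h x : A) :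
    HasSum (fun p => (taylor₁ (fun s => curvK m (Real.exp s)) p : ℂ) • (modOp h ^ p) x)
      (∑ i, c i • modGroup h (l i) x) := by
  simpa using hasSum_taylor₁_smul (b := fun i _ => c i) (l := fun i _ => l i) (by fun_prop)
    (by fun_prop) (f := fun s => curvK m (Real.exp s)) (by simpa using hK) (modOp h) x
    (ex := fun l => modGroup h l x) (hasSum_exp_modOp h x)

lemma hasSum_curvH (hH : ∀ s t, curvH m (Real.exp s) (Real.exp t)
      = ∑ i, c' i * (Real.exp (l' i * s) * Real.exp (k' i * t))) (h x y : A) :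
    HasSum (fun p : ℕ × ℕ =>
        (taylor₂ (fun s t => curvH m (Real.exp s) (Real.exp t)) p.1 p.2 : ℂ) •
          ((modOp h ^ p.1) x * (modOp h ^ p.2) y))
      (∑ j, c' j • (modGroup h (l' j) x * modGroup h (k' j) y)) := by
  simpa using hasSum_taylor₂_smul (b := fun i _ _ => c' i) (l := fun i _ _ => l' i)
    (m := fun i _ _ => k' i) (by fun_prop) (by fun_prop) (by fun_prop)
    (f := fun s t => curvH m (Real.exp s) (Real.exp t)) (by simpa using hH) (modOp h) x y
    (ex := fun l => modGroup h l x) (ey := fun l => modGroup h l y) (hasSum_exp_modOp h x)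
    (hasSum_exp_modOp h y)

lemma hasSum_curvK_mul_f₁ (hK : ∀ s, curvK m (Real.exp s) = ∑ i, c i * Real.exp (l i * s))
    {f : ℝ → ℝ} (hf : ∀ s, f s = curvK m (Real.exp s) * f₁ (s / 2)) (h x : A) :
    HasSum (fun p => (taylor₁ f p : ℂ) • (modOp h ^ p) x)
      (∑ i, ∫ v in (0 : ℝ)..1, c i • modGroup h (l i + v / 2) x) :=
  hasSum_taylor₁_smul (b := fun i _ => c i) (l := fun i v => l i + v / 2) (by fun_prop)
    (by fun_prop) (fun s => (hf s).trans (curvK_mul_f₁_eq_sum hK s)) (modOp h) x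
    (ex := fun l => modGroup h l x) (hasSum_exp_modOp h x)

lemma hasSum_curvH_mul_f₁_add
    (hK : ∀ s, curvK m (Real.exp s) = ∑ i, c i * Real.exp (l i * s))
    (hH : ∀ s t, curvH m (Real.exp s) (Real.exp t)
      = ∑ i, c' i * (Real.exp (l' i * s) * Real.exp (k' i * t))) {f : ℝ → ℝ → ℝ}
    (hf : ∀ s t, f s t = Real.exp (s / 2) * curvH m (Real.exp s) (Real.exp t) * f₁ (s / 2)
      * f₁ (t / 2) + 2 * curvK m (Real.exp (s + t)) * g₂ (s / 2) (t / 2)) (h x y : A) :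
    HasSum (fun p : ℕ × ℕ => (taylor₂ f p.1 p.2 : ℂ) • ((modOp h ^ p.1) x * (modOp h ^ p.2) y))
      ((∑ j, ∫ v in (0 : ℝ)..1, ∫ w in (0 : ℝ)..1,
          c' j • (modGroup h (l' j + 1 / 2 + v / 2) x * modGroup h (k' j + w / 2) y))
        + ∑ i, ∫ v in (0 : ℝ)..1, ∫ w in (0 : ℝ)..1,
          (2 * c i * v) • (modGroup h (l i + v / 2) x * modGroup h (l i + v * w / 2) y)) := by
  have h1 := hasSum_taylor₂_smul
    (b := fun (i : ι' ⊕ ι) v _ => Sum.elim (fun j => c' j) (fun i => 2 * c i * v) i)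
    (l := fun (i : ι' ⊕ ι) v _ => Sum.elim (fun j => l' j + 1 / 2 + v / 2) (fun i => l i + v / 2) i)
    (m := fun (i : ι' ⊕ ι) v w => Sum.elim (fun j => k' j + w / 2) (fun i => l i + v * w / 2) i)
    (by rintro (i | i) <;> simp only [Sum.elim_inl, Sum.elim_inr] <;> fun_prop)
    (by rintro (i | i) <;> simp only [Sum.elim_inl, Sum.elim_inr] <;> fun_prop)
    (by rintro (i | i) <;> simp only [Sum.elim_inl, Sum.elim_inr] <;> fun_prop)
    (f := f) (fun s t => by
      rw [hf, curvH_mul_f₁_add_eq_sum hK hH, Fintype.sum_sum_type]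
      simp only [Sum.elim_inl, Sum.elim_inr]) (modOp h) x y
    (ex := fun l => modGroup h l x) (ey := fun l => modGroup h l y) (hasSum_exp_modOp h x)
    (hasSum_exp_modOp h y)
  rw [Fintype.sum_sum_type] at h1
  simpa only [Sum.elim_inl, Sum.elim_inr] using h1

end CurvatureCalculus

/-! ### The two forms of the curvature -/

section Exponential

variable {m : ℕ} {M : Type*} [TopologicalSpace M] [ChartedSpace (EuclideanSpace ℝ (Fin m)) M]
  {A : Type*} [NormedRing A] [NormedAlgebra ℂ A] [CompleteSpace A]

lemma contMDiff_exp_comp {g : M → A} (hg : ContMDiff (𝓡 m) 𝓘(ℝ, A) 2 g) :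
    ContMDiff (𝓡 m) 𝓘(ℝ, A) 2 fun x => NormedSpace.exp (g x) :=
  ContMDiff.comp (I' := 𝓘(ℝ, A)) (g := (NormedSpace.exp : A → A))
    (ContDiff.contMDiff (contDiff_exp_algebra (n := 2))) hg

variable [IsManifold (𝓡 m) ∞ M]

lemma chartGrad_exp {g : M → A} (hg : ContMDiff (𝓡 m) 𝓘(ℝ, A) 2 g) {x : M}
    (u : TangentSpace (𝓡 m) x) :
    chartGrad m (fun y => NormedSpace.exp (g y)) u = expD₁ (g x) (chartGrad m g u) :=
  (chartGrad_comp (f := (NormedSpace.exp : A → A)) contDiff_exp_algebra hg u).trans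
    (fderiv_exp_apply _ _)

/-- Only the diagonal is needed, since the contraction with the metric sees only pairs of equal
vectors. -/
lemma chartHessian_exp
    (cov : CovariantDerivative (𝓡 m) (EuclideanSpace ℝ (Fin m))
      (TangentSpace (𝓡 m) : M → Type _))
    {g : M → A} (hg : ContMDiff (𝓡 m) 𝓘(ℝ, A) 2 g) {x : M} (u : TangentSpace (𝓡 m) x) :
    chartHessian cov (fun y => NormedSpace.exp (g y)) ⟨x, u, u⟩
      = expD₁ (g x) (chartHessian cov g ⟨x, u, u⟩)
        + (2 : ℝ) • expD₂ (g x) (chartGrad m g u) := by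
  refine (chartHessian_comp (f := (NormedSpace.exp : A → A)) cov contDiff_exp_algebra hg _).trans
    ((add_comm _ _).trans ?_)
  exact congr_arg₂ (· + ·) (fderiv_exp_apply _ _) (fderiv_fderiv_exp_apply _ _)

end Exponential

lemma IsLift.lift_kPow {m n : ℕ} {M : Type*} [TopologicalSpace M]
    [ChartedSpace (EuclideanSpace ℝ (Fin m)) M] [AddAction (UnitAddTorus (Fin n)) M]
    {θ : Matrix (Fin n) (Fin n) ℝ} {hh : M → Twisted θ} {h : M → ℂ}
    (hl : IsLift θ (act₀ M) hh h) (p : ℝ) :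
    IsLift θ (act₂ m M) (fun ξ => NormedSpace.exp (p • hh ξ.1))
      (ConnesLandi.lift (kPow θ (act₀ M) h p)) := by
  have h1 := (hl.const_smul (p : ℂ)).starExp
  simp only [Complex.coe_smul] at h1
  exact h1.comp (q := fun ξ : TwoVec m M => ξ.1) fun _ _ => rfl

end ConnesLandi

end

theorem mainTheorem7 (m : ℕ) (hm : Even m) (hm4 : 4 ≤ m) :
    ∃ (𝒦 : ℝ → ℝ) (ℋ : ℝ → ℝ → ℝ),
      (∀ s : ℝ, 𝒦 s = ConnesLandi.curvK m (Real.exp s) * ConnesLandi.f₁ (s / 2)) ∧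
      (∀ s t : ℝ, ℋ s t =
        Real.exp (s / 2) * ConnesLandi.curvH m (Real.exp s) (Real.exp t)
            * ConnesLandi.f₁ (s / 2) * ConnesLandi.f₁ (t / 2)
          + 2 * ConnesLandi.curvK m (Real.exp (s + t)) * ConnesLandi.g₂ (s / 2) (t / 2)) ∧
      ∀ (n : ℕ) (M : Type*) [TopologicalSpace M] [T2Space M] [CompactSpace M]
        [ChartedSpace (EuclideanSpace ℝ (Fin m)) M] [IsManifold (𝓡 m) ∞ M]
        [RiemannianBundle (fun x : M => TangentSpace (𝓡 m) x)]
        [IsContMDiffRiemannianBundle (𝓡 m) ∞ (EuclideanSpace ℝ (Fin m))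
          (fun x : M => TangentSpace (𝓡 m) x)]
        [AddAction (UnitAddTorus (Fin n)) M],
        ConnesLandi.SmoothAction m n M → ConnesLandi.IsometricAction m n M →
        ∀ (cov : CovariantDerivative (𝓡 m) (EuclideanSpace ℝ (Fin m))
            (TangentSpace (𝓡 m) : M → Type _)),
        ConnesLandi.IsLeviCivita cov →
        ∀ (θ : Matrix (Fin n) (Fin n) ℝ), θᵀ = -θ →
        -- the self-adjoint log-Weyl factor, that is, a real-valued smooth function
        ∀ (h : M → ℝ), ContMDiff (𝓡 m) 𝓘(ℝ, ℝ) ∞ h →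
          let hc : M → ℂ := fun x => (h x : ℂ)
          let k : M → ℂ := ConnesLandi.starExp θ (ConnesLandi.act₀ M) hc
          let a := ConnesLandi.act₂ (n := n) m M
          (∀ ξ : ConnesLandi.TwoVec m M,
            Summable (ConnesLandi.calcTerm₁ θ a (ConnesLandi.lift hc)
              (fun s => ConnesLandi.curvK m (Real.exp s)) (ConnesLandi.hessian cov k) ξ) ∧
            Summable (ConnesLandi.calcTerm₂ θ a (ConnesLandi.lift hc)
              (fun s t => ConnesLandi.curvH m (Real.exp s) (Real.exp t))
              (ConnesLandi.grad₁ m k) (ConnesLandi.grad₂ m k) ξ) ∧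
            Summable (ConnesLandi.calcTerm₁ θ a (ConnesLandi.lift hc) 𝒦
              (ConnesLandi.hessian cov hc) ξ) ∧
            Summable (ConnesLandi.calcTerm₂ θ a (ConnesLandi.lift hc) ℋ
              (ConnesLandi.grad₁ m hc) (ConnesLandi.grad₂ m hc) ξ)) ∧
          ∀ x : M,
            ConnesLandi.curvatureK θ cov hc (ConnesLandi.curvK m) (ConnesLandi.curvH m) x
              = ConnesLandi.curvatureLogK θ cov hc 𝒦 ℋ x := by
  refine ⟨_, _, fun _ => rfl, fun _ _ => rfl, ?_⟩
  intro n M _ _ _ _ _ _ _ _ hact hiso cov hcov θ _ h hh hc k a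
  have hhc : ContMDiff (𝓡 m) 𝓘(ℝ, ℂ) ∞ hc := (Complex.ofRealCLM.contDiff (n := ∞)).contMDiff.comp hh
  obtain ⟨L, hL, hl⟩ := hact.exists_isLift θ hhc
  have hL2 := hL.of_le ConnesLandi.two_le_infty
  have hkl := hl.starExp
  have hk2 := ConnesLandi.contMDiff_exp_comp hL2
  obtain ⟨ι, _, c, l, hK⟩ := ConnesLandi.exists_curvK_eq_sum m
  obtain ⟨ι', _, c', l', k', hH⟩ := ConnesLandi.exists_curvH_eq_sum m
  have hlift := hl.lift (m := m)
  have t₁ := hlift.calcTerm₁ (hkl.hessian hact hiso hcov hk2) fun s =>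
    ConnesLandi.curvK m (Real.exp s)
  have t₂ := hlift.calcTerm₂ (hkl.grad₁ hact hk2) (hkl.grad₂ hact hk2) fun s t =>
    ConnesLandi.curvH m (Real.exp s) (Real.exp t)
  have t₃ := hlift.calcTerm₁ (hl.hessian hact hiso hcov hL2) fun s =>
    ConnesLandi.curvK m (Real.exp s) * ConnesLandi.f₁ (s / 2)
  have t₄ := hlift.calcTerm₂ (hl.grad₁ hact hL2) (hl.grad₂ hact hL2) fun s t =>
    Real.exp (s / 2) * ConnesLandi.curvH m (Real.exp s) (Real.exp t)
        * ConnesLandi.f₁ (s / 2) * ConnesLandi.f₁ (t / 2)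
      + 2 * ConnesLandi.curvK m (Real.exp (s + t)) * ConnesLandi.g₂ (s / 2) (t / 2)
  have s₁ (ξ : ConnesLandi.TwoVec m M) := ConnesLandi.hasSum_curvK hK (L ξ.1)
    (ConnesLandi.chartHessian cov (fun x => NormedSpace.exp (L x)) ξ)
  have s₂ (ξ : ConnesLandi.TwoVec m M) := ConnesLandi.hasSum_curvH hH (L ξ.1)
    (ConnesLandi.chartGrad m (fun x => NormedSpace.exp (L x)) ξ.2.1)
    (ConnesLandi.chartGrad m (fun x => NormedSpace.exp (L x)) ξ.2.2)
  have s₃ (ξ : ConnesLandi.TwoVec m M) := ConnesLandi.hasSum_curvK_mul_f₁ hK (fun _ => rfl) (L ξ.1)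
    (ConnesLandi.chartHessian cov L ξ)
  have s₄ (ξ : ConnesLandi.TwoVec m M) := ConnesLandi.hasSum_curvH_mul_f₁_add hK hH
    (fun _ _ => rfl) (L ξ.1) (ConnesLandi.chartGrad m L ξ.2.1) (ConnesLandi.chartGrad m L ξ.2.2)
  -- Absolute convergence holds in the twisted algebra, and passes to the sum of the coefficients.
  refine ⟨fun ξ => ⟨ConnesLandi.IsLift.summable t₁ (s₁ ξ).summable, ConnesLandi.IsLift.summable t₂ (s₂ ξ).summable,
    ConnesLandi.IsLift.summable t₃ (s₃ ξ).summable, ConnesLandi.IsLift.summable t₄ (s₄ ξ).summable⟩, fun x => ?_⟩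
  have e₁ := (hl.lift_kPow (m := m) (1 - m)).star (ConnesLandi.IsLift.tsum t₁ s₁)
  have e₂ := (hl.lift_kPow (m := m) (-m)).star (ConnesLandi.IsLift.tsum t₂ s₂)
  have e₃ := (hl.lift_kPow (m := m) (2 - m)).star ((ConnesLandi.IsLift.tsum t₃ s₃).add
    (ConnesLandi.IsLift.tsum t₄ s₄))
  -- The scalar curvature terms coincide; the others are compared for each vector of the frame.
  rw [ConnesLandi.curvatureK, ConnesLandi.curvatureLogK]
  congr 1
  rw [ConnesLandi.contract, ConnesLandi.contract, ConnesLandi.contract, ← Finset.sum_add_distrib]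
  refine Finset.sum_congr rfl fun i _ => ?_
  refine (congr_arg₂ (· + ·) (e₁.total_eq _).symm (e₂.total_eq _).symm).trans
    (Eq.trans ?_ (e₃.total_eq _))
  rw [← map_add]
  dsimp only
  rw [ConnesLandi.chartHessian_exp cov hL2, ConnesLandi.chartGrad_exp hL2]
  exact congr_arg _ (ConnesLandi.exp_mul_sum_add_exp_mul_sum _ _ _ _ _ _ _ _ _)
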